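/- **Setting.** Let $d\in\{2,3\}$ and let $\Omega\subset\mathbb R^d$ be a bounded open set with a finite mesh $\mathcal T_h$ of disjoint open polytopic elements $K$ (diameter $h_K$), whose boundaries are unions of non-overlapping $(d-1)$-simplices (faces) $F\in\mathcal F_h=\mathcal F_h^i\cup\mathcal F_h^b$ (interior faces, shared by two elements $K^\pm$ lying on opposite sides; boundary faces, with $K$ on one side and the complement of $\Omega$ on the other). Let $\mathcal T_h$ be polytopic-regular: there is a constant $c$ such that every element $K$ contains non-overlapping $d$-simplices $\tau_{K_F}$, one for each face $F\subset\partial K$ and having $F$ as a face, with $h_K\le c\,|\tau_{K_F}|/|F|$. Let $\mu>0$ be constant on each element, let $\ell,m\ge 1$ be integers, $\gamma_v,\gamma_p>0$, $f\in[L^2(\Omega)]^d$. Put $V=\{v\in[H^1(\Omega)]^d: v|_{\partial\Omega}=0\}$, $Q=L^2_0(\Omega)$ (zero average), and let $V_h^\ell\subset[L^2(\Omega)]^d$, $Q_h^m\subset L^2_0(\Omega)$ be the spaces of functions that are polynomials of total degree at most $\ell$, respectively $m$, on each element. On an interior face, with traces from $K^\pm$ and outward unit normals $n^\pm$, let $\{w\}=\frac12(w^++w^-)$,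 $[q]=q^+n^++q^-n^-$ for scalars, $[v]=v^+\otimes n^++v^-\otimes n^-$ for vectors; on a boundary face $\{w\}=w$, $[q]=qn$, $[v]=v\otimes n$. Let $\sigma_v|_F=\gamma_v\max_{K^\pm}\{\ell^2\mu/h_K\}$ on interior faces and $\gamma_v\ell^2\mu/h_K$ on boundary faces, and $\sigma_p|_F=\gamma_p\min_{K^\pm}\{h_K/m\}$ on interior faces. With the elementwise gradient $\nabla_h$ set $$a_h(u,v)=\int_\Omega\mu\nabla_hu:\nabla_hv-\sum_{F\in\mathcal F_h}\int_F\{\mu\nabla_hu\}:[v]-\sum_{F\in\mathcal F_h}\int_F[u]:\{\mu\nabla_hv\}+\sum_{F\in\mathcal F_h}\int_F\sigma_v[u]:[v],$$ $$b_h(p,v)=-\int_\Omega p\,\nabla_h\cdot v+\sum_{F\in\mathcal F_h}\int_F\{pI\}:[v],\qquad s_h(p,q)=\sum_{F\in\mathcal F_h^i}\int_F\sigma_p[p]\cdot[q],$$ $$\mathcal B_h((u,p),(v,q))=a_h(u,v)+b_h(p,v)-b_h(q,u)+s_h(p,q),$$ $$\|(v,q)\|_E^2=\|\mu^{1/2}\nabla_hv\|_{L^2(\Omega)}^2+\sum_{F\in\mathcal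 F_h}\|\sigma_v^{1/2}[v]\|_{L^2(F)}^2+\|q\|_{L^2(\Omega)}^2+s_h(q,q).$$ **Theorem (abstract error estimate).** Let $(u,p)\in V\times Q$ be a solution of the stationary Stokes problem $$\int_\Omega\mu\nabla u:\nabla v-\int_\Omega p\,\nabla\cdot v+\int_\Omega q\,\nabla\cdot u=\int_\Omega f\cdot v\qquad\forall(v,q)\in V\times Q$$ with the regularity $u\in[H^2(\Omega)]^d$, $p\in H^1(\Omega)$, and let $(u_h,p_h)\in V_h^\ell\times Q_h^m$ satisfy $\mathcal B_h((u_h,p_h),(v_h,q_h))=\int_\Omega f\cdot v_h$ for all $(v_h,q_h)\in V_h^\ell\times Q_h^m$. Assume that $\mathcal B_h$ is stable with constant $C^*>0$, $$C^*\|(v_h,q_h)\|_E\le\sup_{(w_h,r_h)\in V_h^\ell\times Q_h^m}\frac{\mathcal B_h((v_h,q_h),(w_h,r_h))}{\|(w_h,r_h)\|_E}\qquad\forall (v_h,q_h)\in V_h^\ell\times Q_h^m,$$ and bounded with constant $C_*\ge0$ on some linear space $W$ of pairs of functions that contains $V_h^\ell\times Q_h^m$ and $(u,p)$, $$|\mathcal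 B_h((v,q),(w_h,r_h))|\le C_*\|(v,q)\|_E\,\|(w_h,r_h)\|_E\qquad\forall(v,q)\in W,\ (w_h,r_h)\in V_h^\ell\times Q_h^m.$$ Then $$\|(u-u_h,p-p_h)\|_E\le\Big(1+\frac{C_*}{C^*}\Big)\inf_{(v_h,q_h)\in V_h^\ell\times Q_h^m}\|(u-v_h,p-q_h)\|_E.$$ -/

import Mathlib

open MeasureTheory Filter Topology
open scoped ContDiff

noncomputable section

namespace StokesDG

/-- The Euclidean space `ℝ^d`. -/
abbrev E (d : ℕ) := EuclideanSpace ℝ (Fin d)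

/-- Pairs (velocity, pressure) of functions on `ℝ^d`; only their values in the domain matter. -/
abbrev Pair (d : ℕ) := (E d → Fin d → ℝ) × (E d → ℝ)

variable {d : ℕ}

/-! ### Weak derivatives, Sobolev spaces and traces -/

/-- `g` is the weak partial derivative of `w` in direction `j` on the open set `U`. -/
def HasWeakDeriv (U : Set (E d)) (j : Fin d) (w g : E d → ℝ) : Prop :=
  LocallyIntegrableOn w U ∧ LocallyIntegrableOn g U ∧
    ∀ φ : E d → ℝ, ContDiff ℝ ∞ φ → HasCompactSupport φ → tsupport φ ⊆ U →
      ∫ x in U, w x * fderiv ℝ φ x (EuclideanSpace.single j 1) = -∫ x in U, g x * φ x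

open Classical in
/-- A representative of the weak derivative `∂_j w` on `U` (unique almost everywhere in `U`);
zero if `w` is not weakly differentiable on `U`. -/
def weakDeriv (U : Set (E d)) (j : Fin d) (w : E d → ℝ) : E d → ℝ :=
  if h : ∃ g, HasWeakDeriv U j w g then h.choose else 0

/-- The space `H^k(U)`. -/
def MemSobolev (U : Set (E d)) : ℕ → (E d → ℝ) → Prop
  | 0, w => MemLp w 2 (volume.restrict U)
  | k + 1, w => MemLp w 2 (volume.restrict U) ∧
      ∀ j, ∃ g, HasWeakDeriv U j w g ∧ MemSobolev U k g

/-- `c` is the trace of `w` at the boundary point `x`, taken from within `U`: the limit of the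
averages of `w` over the part in `U` of small balls around `x`. For a Sobolev function this agrees
with the trace operator at almost every point of a face of `U`. -/
def HasTrace (U : Set (E d)) (w : E d → ℝ) (x : E d) (c : ℝ) : Prop :=
  Tendsto (fun r : ℝ => ⨍ y in Metric.ball x r ∩ U, w y) (𝓝[>] 0) (𝓝 c)

/-- The trace of `w` at `x` from within `U`. -/
def trace (U : Set (E d)) (w : E d → ℝ) (x : E d) : ℝ :=
  limUnder (𝓝[>] 0) (fun r : ℝ => ⨍ y in Metric.ball x r ∩ U, w y)

/-- `V`, the vector fields in `[H^1(Ω)]^d` with zero trace on the boundary of `Ω`. -/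
def velocitySpace (Ω : Set (E d)) : Set (E d → Fin d → ℝ) :=
  {v | ∀ i, MemSobolev Ω 1 (fun y => v y i) ∧
    ∀ᵐ x ∂(μHE[d - 1] : Measure (E d)).restrict (frontier Ω), HasTrace Ω (fun y => v y i) x 0}

/-- `Q = L^2_0(Ω)`, the square-integrable functions with zero average. -/
def pressureSpace (Ω : Set (E d)) : Set (E d → ℝ) :=
  {q | MemLp q 2 (volume.restrict Ω) ∧ ∫ x in Ω, q x = 0}

/-! ### Polytopic meshes -/

/-- A mesh of `Ω` made of finitely many open polytopes. The faces are `(d-1)`-simplices; the face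
`F` lies on the boundary of the element `plus F` and, if it is an interior face, of the element
`K` with `minus F = some K`; boundary faces have `minus F = none`. The vector `normal F` is the
unit normal pointing out of `plus F`. -/
structure PolytopicMesh (Ω : Set (E d)) where
  numElem : ℕ
  numFace : ℕ
  elem : Fin numElem → Set (E d)
  face : Fin numFace → Affine.Simplex ℝ (E d) (d - 1)
  plus : Fin numFace → Fin numElem
  minus : Fin numFace → Option (Fin numElem)
  normal : Fin numFace → E d
  isOpen_elem : ∀ K, IsOpen (elem K)
  nonempty_elem : ∀ K, (elem K).Nonempty
  elem_subset : ∀ K, elem K ⊆ Ω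
  disjoint_elem : Pairwise fun K K' => Disjoint (elem K) (elem K')
  closure_eq : closure Ω = ⋃ K, closure (elem K)
  frontier_elem : ∀ K, frontier (elem K) =
    ⋃ F, ⋃ (_ : plus F = K ∨ minus F = some K), (face F).closedInterior
  disjoint_face : Pairwise fun F F' => Disjoint (face F).interior (face F').interior
  norm_normal : ∀ F, ‖normal F‖ = 1
  normal_orthogonal : ∀ F a b, inner ℝ (normal F) ((face F).points a - (face F).points b) = 0
  /-- Near each point of the relative interior of a face, `plus F` is the half-space which
  `normal F` points out of. -/
  plus_side : ∀ F, ∀ x ∈ (face F).interior, ∃ r > 0,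
    Metric.ball x r ∩ elem (plus F) = Metric.ball x r ∩ {y | inner ℝ (normal F) (y - x) < 0}
  /-- On the other side of an interior face lies the second element. -/
  minus_side : ∀ F K, minus F = some K → ∀ x ∈ (face F).interior, x ∈ Ω ∧ ∃ r > 0,
    Metric.ball x r ∩ elem K = Metric.ball x r ∩ {y | 0 < inner ℝ (normal F) (y - x)}
  /-- On the other side of a boundary face lies the complement of `Ω`. -/
  boundary_side : ∀ F, minus F = none → ∀ x ∈ (face F).interior, ∃ r > 0,
    Metric.ball x r ∩ Ω = Metric.ball x r ∩ {y | inner ℝ (normal F) (y - x) < 0}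

namespace PolytopicMesh

variable {Ω : Set (E d)} (T : PolytopicMesh Ω)

/-- `F` is one of the faces of the element `K`. -/
def IsFaceOf (F : Fin T.numFace) (K : Fin T.numElem) : Prop :=
  T.plus F = K ∨ T.minus F = some K

/-- The diameter `h_K`. -/
def diam (K : Fin T.numElem) : ℝ := Metric.diam (T.elem K)

/-- The surface measure on the face `F`. -/
def faceMeasure (F : Fin T.numFace) : Measure (E d) :=
  (μHE[d - 1] : Measure (E d)).restrict (T.face F).closedInterior

/-- Polytopic regularity with constant `c`: each element `K` contains non-overlapping
`d`-simplices, one for each face `F` of `K` and sharing the face `F` with `K`, such that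
`h_K ≤ c |τ| / |F|`. -/
def PolytopicRegular (c : ℝ) : Prop :=
  ∀ K, ∃ τ : Fin T.numFace → Affine.Simplex ℝ (E d) d,
    (∀ F, T.IsFaceOf F K →
      Set.range (T.face F).points ⊆ Set.range (τ F).points ∧
      (τ F).interior ⊆ T.elem K ∧
      T.diam K ≤ c * (volume.real (τ F).closedInterior / (T.faceMeasure F).real Set.univ)) ∧
    ∀ F F', T.IsFaceOf F K → T.IsFaceOf F' K → F ≠ F' →
      Disjoint (τ F).interior (τ F').interior

/-- The scalar `w⁺ - w⁻` on `F`, or `w` if `F` is a boundary face. Since `n⁻ = -n⁺`, the jump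
of a scalar `q` is the vector `jump F q • normal F`, and the jump `v⁺ ⊗ n⁺ + v⁻ ⊗ n⁻`
of a vector field `v` has the entries `jump F (v_i) * (normal F)_j`. -/
def jump (F : Fin T.numFace) (w : E d → ℝ) (x : E d) : ℝ :=
  trace (T.elem (T.plus F)) w x -
    match T.minus F with
    | some K => trace (T.elem K) w x
    | none => 0

/-- The average on `F` of the broken function that is `w K` on the element `K`. -/
def avg (F : Fin T.numFace) (w : Fin T.numElem → E d → ℝ) (x : E d) : ℝ :=
  match T.minus F with
  | some K => (trace (T.elem (T.plus F)) (w (T.plus F)) x + trace (T.elem K) (w K) x) / 2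
  | none => trace (T.elem (T.plus F)) (w (T.plus F)) x

/-- `w` is a polynomial of total degree at most `k` on each element. -/
def IsPiecewisePoly (k : ℕ) (w : E d → ℝ) : Prop :=
  ∀ K, ∃ P : MvPolynomial (Fin d) ℝ, P.totalDegree ≤ k ∧
    ∀ x ∈ T.elem K, w x = MvPolynomial.eval (fun i => x i) P

end PolytopicMesh

/-! ### The discontinuous Galerkin method -/

/-- A mesh together with an elementwise constant viscosity, the polynomial degrees `ℓ` and `m`
for velocity and pressure, and the penalty constants `γ_v` and `γ_p`. -/
structure Scheme (Ω : Set (E d)) where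
  mesh : PolytopicMesh Ω
  mu : Fin mesh.numElem → ℝ
  mu_pos : ∀ K, 0 < mu K
  l : ℕ
  m : ℕ
  one_le_l : 1 ≤ l
  one_le_m : 1 ≤ m
  gammaV : ℝ
  gammaP : ℝ
  gammaV_pos : 0 < gammaV
  gammaP_pos : 0 < gammaP

namespace Scheme

variable {Ω : Set (E d)} (S : Scheme Ω)

/-- The continuous form `a(u, v) = ∫_Ω μ ∇u : ∇v`. -/
def a (u v : E d → Fin d → ℝ) : ℝ :=
  ∑ K, ∫ x in S.mesh.elem K, S.mu K * ∑ i, ∑ j,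
    weakDeriv Ω j (fun y => u y i) x * weakDeriv Ω j (fun y => v y i) x

/-- The continuous form `b(p, v) = -∫_Ω p ∇·v`. -/
def b (_ : Scheme Ω) (p : E d → ℝ) (v : E d → Fin d → ℝ) : ℝ :=
  -∫ x in Ω, p x * ∑ i, weakDeriv Ω i (fun y => v y i) x

/-- `x = (u, p)` is the weak solution in `V × Q` of the stationary Stokes problem with
right-hand side `f`. -/
def IsWeakSolution (f : E d → Fin d → ℝ) (x : Pair d) : Prop :=
  x.1 ∈ velocitySpace Ω ∧ x.2 ∈ pressureSpace Ω ∧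
    ∀ v ∈ velocitySpace Ω, ∀ q ∈ pressureSpace Ω,
      S.a x.1 v + S.b x.2 v - S.b q x.1 = ∫ y in Ω, ∑ i, f y i * v y i

/-- The discrete space `V_h^ℓ × Q_h^m`. -/
def discreteSpace : Set (Pair d) :=
  {x | (∀ i, MemLp (fun y => x.1 y i) 2 (volume.restrict Ω) ∧
        S.mesh.IsPiecewisePoly S.l (fun y => x.1 y i)) ∧
      x.2 ∈ pressureSpace Ω ∧ S.mesh.IsPiecewisePoly S.m x.2}

/-- The penalty function `σ_v`. -/
def sigmaV (F : Fin S.mesh.numFace) : ℝ :=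
  let s := fun K => (S.l : ℝ) ^ 2 * S.mu K / S.mesh.diam K
  match S.mesh.minus F with
  | some K => S.gammaV * max (s (S.mesh.plus F)) (s K)
  | none => S.gammaV * s (S.mesh.plus F)

/-- The penalty function `σ_p`, which lives on the interior faces. -/
def sigmaP (F : Fin S.mesh.numFace) : ℝ :=
  let s := fun K => S.mesh.diam K / (S.m : ℝ)
  match S.mesh.minus F with
  | some K => S.gammaP * min (s (S.mesh.plus F)) (s K)
  | none => 0

/-- The entry `(i, j)` of the broken gradient `∇_h v`, element by element. -/
def brokenGrad (v : E d → Fin d → ℝ) (i j : Fin d) (K : Fin S.mesh.numElem) : E d → ℝ :=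
  weakDeriv (S.mesh.elem K) j (fun y => v y i)

/-- The entry `(i, j)` of the jump `v⁺ ⊗ n⁺ + v⁻ ⊗ n⁻`. -/
def jumpTensor (F : Fin S.mesh.numFace) (v : E d → Fin d → ℝ) (i j : Fin d) (x : E d) : ℝ :=
  S.mesh.jump F (fun y => v y i) x * S.mesh.normal F j

/-- The entry `(i, j)` of the average of the viscous flux `μ ∇_h v`. -/
def avgFlux (F : Fin S.mesh.numFace) (v : E d → Fin d → ℝ) (i j : Fin d) (x : E d) : ℝ :=
  S.mesh.avg F (fun K y => S.mu K * S.brokenGrad v i j K y) x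

/-- The interior penalty form `a_h`. -/
def ah (u v : E d → Fin d → ℝ) : ℝ :=
  (∑ K, ∫ x in S.mesh.elem K, S.mu K * ∑ i, ∑ j,
      S.brokenGrad u i j K x * S.brokenGrad v i j K x)
    - (∑ F, ∫ x, (∑ i, ∑ j, S.avgFlux F u i j x * S.jumpTensor F v i j x) ∂S.mesh.faceMeasure F)
    - (∑ F, ∫ x, (∑ i, ∑ j, S.jumpTensor F u i j x * S.avgFlux F v i j x) ∂S.mesh.faceMeasure F)
    + ∑ F, ∫ x, S.sigmaV F * (∑ i, ∑ j, S.jumpTensor F u i j x * S.jumpTensor F v i j x)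
        ∂S.mesh.faceMeasure F

/-- The form `b_h(p, v) = -∫_Ω p ∇_h·v + ∑_F ∫_F {p I} : [v]`. -/
def bh (p : E d → ℝ) (v : E d → Fin d → ℝ) : ℝ :=
  -(∑ K, ∫ x in S.mesh.elem K, p x * ∑ i, S.brokenGrad v i i K x)
    + ∑ F, ∫ x, S.mesh.avg F (fun _ => p) x * (∑ i, S.jumpTensor F v i i x)
        ∂S.mesh.faceMeasure F

/-- The pressure stabilization `s_h`, a sum over the interior faces. -/
def sh (p q : E d → ℝ) : ℝ :=
  ∑ F with (S.mesh.minus F).isSome, ∫ x, S.sigmaP F *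
    (∑ i, (S.mesh.jump F p x * S.mesh.normal F i) * (S.mesh.jump F q x * S.mesh.normal F i))
      ∂S.mesh.faceMeasure F

/-- `B_h((u, p), (v, q)) = a_h(u, v) + b_h(p, v) - b_h(q, u) + s_h(p, q)`. -/
def Bh (x y : Pair d) : ℝ := S.ah x.1 y.1 + S.bh x.2 y.1 - S.bh y.2 x.1 + S.sh x.2 y.2

/-- The square of the DG norm of the velocity. -/
def velNormSq (v : E d → Fin d → ℝ) : ℝ :=
  (∑ K, ∫ x in S.mesh.elem K, S.mu K * ∑ i, ∑ j, S.brokenGrad v i j K x ^ 2)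
    + ∑ F, ∫ x, S.sigmaV F * (∑ i, ∑ j, S.jumpTensor F v i j x ^ 2) ∂S.mesh.faceMeasure F

/-- The square of the DG norm of the pressure. -/
def presNormSq (q : E d → ℝ) : ℝ := (∫ x in Ω, q x ^ 2) + S.sh q q

/-- The energy norm. -/
def energyNorm (x : Pair d) : ℝ := √(S.velNormSq x.1 + S.presNormSq x.2)

/-- `x = (u_h, p_h)` solves the discrete Stokes problem with right-hand side `f`. -/
def IsDiscreteSolution (f : E d → Fin d → ℝ) (x : Pair d) : Prop :=
  x ∈ S.discreteSpace ∧ ∀ y ∈ S.discreteSpace, S.Bh x y = ∫ z in Ω, ∑ i, f z i * y.1 z i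

/-- Stability (inf-sup condition) of `B_h` on the discrete space with constant `C`. -/
def IsStable (C : ℝ) : Prop :=
  ∀ x ∈ S.discreteSpace, ((C * S.energyNorm x : ℝ) : EReal) ≤
    ⨆ y ∈ S.discreteSpace, ((S.Bh x y / S.energyNorm y : ℝ) : EReal)

/-- Boundedness of `B_h` on `W × (V_h^ℓ × Q_h^m)` with constant `C`. -/
def IsBoundedOn (W : Submodule ℝ (Pair d)) (C : ℝ) : Prop :=
  ∀ x ∈ W, ∀ y ∈ S.discreteSpace, |S.Bh x y| ≤ C * S.energyNorm x * S.energyNorm y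

end Scheme

end StokesDG

end

/-!
# Quasi-optimality of a discontinuous Galerkin method for the Stokes problem

The error estimate is the classical combination of stability, Galerkin orthogonality, boundedness
and the triangle inequality. For a discrete pair `z`, the inf-sup condition bounds the energy norm
of `(uh, ph) - z` by the supremum of `Bh ((uh, ph) - z) y` over `y` of energy norm one, which equals
`Bh ((u, p) - z) y` and is controlled by the boundedness of the form (`energyNorm_le_of_isStable`).
The triangle inequality `energyNorm_sub_le` concludes. The substance is the consistency of the method,
`Bh_eq_of_isWeakSolution`, for traces which are defined as limits of averages over the
intersections of small balls with an element, and on polytopic elements, for which neither a trace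
theorem nor a divergence theorem is available beforehand.

*Local theory.* Near an interior point of a face an element is a half-ball. On an oblique cylinder
standing on the face, a function with a weak derivative along the axis is a function of the base
point plus the primitive of the derivative (`HasAxialWeakDeriv.exists_base_value`). By Lebesgue
differentiation the base value is almost everywhere the limit of averages
(`ae_tendsto_base_average`), hence the trace, and integrating along the axis gives the divergence
theorem in the direction of the axis. Two axes yield every coordinate direction
(`HasWeakGrad.local_ibp`).

*Integrability up to the boundary of a face.* Polytopic regularity places on each face of an
element a simplex contained in the element. The cylinders in the directions from the vertices of
the face to the apex of that simplex cover the face, with a height bounded below, so that traces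
are integrable on the whole face (`HasWeakGrad.ae_hasTrace_and_integrable`).

*Integration by parts on an element.* A partition of unity extends the local formula to test
functions which vanish near the relative boundaries of the faces
(`ibpDefect_eq_zero_of_forall_mem`). These boundaries lie in finitely many flats of codimension
two, which have no capacity in `H^1`: there are cutoffs whose gradients, multiplied by a function
in `L^2`, tend to zero in `L^1` (`exists_cutoff`). Hence the formula holds for every smooth test
function (`ibpDefect_eq_zero`).

*Consistency.* Testing with bump functions near an interior face shows that a field whose
elementwise divergence is its divergence has no normal jump (`ae_normal_jump_eq_zero`). For the
fields `w e_k` this says that functions in `H^1(Ω)` have no jumps; for the rows of the stress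
`μ ∇u - p I`, which the weak formulation shows to have divergence `-f`, it says that the normal
stress is continuous. Elementwise integration by parts against a discrete field
(`sum_setIntegral_elem_eq_sum_jump`) then leaves exactly the face terms of the discrete forms.
-/

set_option linter.unusedSectionVars false

namespace StokesDG

/-! ### Test functions in one variable and product sets -/

section Product

variable {X Z : Type*} [MeasurableSpace X] [MeasurableSpace Z]

/-- The rectangles generate the product σ-algebra, so they suffice to detect that a function
vanishes. -/
theorem ae_eq_zero_of_forall_setIntegral_prod_eq_zero {μ : Measure X} {ν : Measure Z}
    [SFinite μ] [SFinite ν] {W : X × Z → ℝ} (hW : Integrable W (μ.prod ν))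
    (h : ∀ A B, MeasurableSet A → MeasurableSet B → ∫ z in A ×ˢ B, W z ∂(μ.prod ν) = 0) :
    W =ᵐ[μ.prod ν] 0 := by
  suffices H : ∀ s, MeasurableSet s → ∫ z in s, W z ∂(μ.prod ν) = 0 from
    hW.ae_eq_zero_of_forall_setIntegral_eq_zero fun s hs _ => H s hs
  intro s hs
  have huniv : ∫ z, W z ∂(μ.prod ν) = 0 := by
    simpa using h Set.univ Set.univ .univ .univ
  induction s, hs using MeasurableSpace.induction_on_inter generateFrom_prod.symm
    isPiSystem_prod with
  | empty => simp
  | basic t ht =>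
    obtain ⟨A, hA, B, hB, rfl⟩ := ht
    exact h A B hA hB
  | compl t ht ih =>
    rw [setIntegral_compl ht hW, huniv, ih, sub_zero]
  | iUnion f hd hm ih =>
    rw [integral_iUnion hm hd hW.integrableOn]
    simp [ih]

/-- Integration by parts on `(0, δ)` for the primitive of an integrable function. -/
theorem integral_primitive_mul_deriv {h Θ : ℝ → ℝ} {δ : ℝ} (hδ : 0 < δ)
    (hh : IntegrableOn h (Set.Ioo 0 δ)) (hΘ : ContDiff ℝ 1 Θ) :
    ∫ t in Set.Ioo 0 δ, (∫ s in Set.Ioo 0 t, h s) * deriv Θ t =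
      (∫ t in Set.Ioo 0 δ, h t) * Θ δ - ∫ t in Set.Ioo 0 δ, h t * Θ t := by
  have hI : IntervalIntegrable h volume 0 δ := by
    rwa [intervalIntegrable_iff_integrableOn_Ioo_of_le hδ.le]
  have e : ∀ (f : ℝ → ℝ) (t : ℝ), 0 ≤ t → ∫ s in Set.Ioo 0 t, f s = ∫ s in (0 : ℝ)..t, f s := by
    intro f t ht
    rw [intervalIntegral.integral_of_le ht, integral_Ioc_eq_integral_Ioo]
  have hAC := hI.absolutelyContinuousOnInterval_intervalIntegral (c := 0) (by simp)
  have hΘAC := (hΘ.contDiffOn (s := Set.uIcc 0 δ)).absolutelyContinuousOnInterval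
  have key := hAC.integral_mul_deriv_eq_deriv_mul hΘAC
  have h1 : ∫ t in (0 : ℝ)..δ, deriv (fun x => ∫ v in (0 : ℝ)..x, h v) t * Θ t =
      ∫ t in (0 : ℝ)..δ, h t * Θ t := by
    refine intervalIntegral.integral_congr_ae ?_
    filter_upwards [hI.ae_hasDerivAt_integral] with t ht ht'
    rw [(ht (Set.uIoc_subset_uIcc ht') 0 (by simp)).deriv]
  rw [h1] at key
  simp only [intervalIntegral.integral_same, zero_mul, sub_zero] at key
  rw [e h δ hδ.le, e (fun t => h t * Θ t) δ hδ.le, ← key, ← e _ δ hδ.le]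
  refine setIntegral_congr_fun measurableSet_Ioo fun t ht => ?_
  simp only [e h t ht.1.le]

/-- A test function on `(0, δ)` with zero integral is the derivative of a test function. -/
theorem exists_test_deriv_eq {δ : ℝ} {β : ℝ → ℝ} (hβ : ContDiff ℝ ∞ β)
    (hc : HasCompactSupport β) (hs : tsupport β ⊆ Set.Ioo 0 δ) (h0 : ∫ t, β t = 0) :
    ∃ Θ : ℝ → ℝ, ContDiff ℝ ∞ Θ ∧ HasCompactSupport Θ ∧ tsupport Θ ⊆ Set.Ioo 0 δ ∧
      deriv Θ = β := by
  rcases (tsupport β).eq_empty_or_nonempty with he | hne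
  · rw [tsupport_eq_empty_iff] at he
    subst he
    refine ⟨0, contDiff_const, .zero, by simp [tsupport], ?_⟩
    ext t
    simp
  obtain ⟨a, haβ, ha⟩ := hc.isCompact.exists_isLeast hne
  obtain ⟨b, hbβ, hb⟩ := hc.isCompact.exists_isGreatest hne
  have hβa : ∀ t < a, β t = 0 := fun t ht => by
    by_contra h
    exact absurd (ha (subset_tsupport _ h)) (not_le.2 ht)
  have hβb : ∀ t > b, β t = 0 := fun t ht => by
    by_contra h
    exact absurd (hb (subset_tsupport _ h)) (not_le.2 ht)
  have hint : Integrable β := hβ.continuous.integrable_of_hasCompactSupport hc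
  set Θ : ℝ → ℝ := fun t => ∫ s in a..t, β s with hΘ
  have hd : ∀ t, HasDerivAt Θ (β t) t := fun t =>
    intervalIntegral.integral_hasDerivAt_right (hint.intervalIntegrable)
      hβ.continuous.stronglyMeasurable.stronglyMeasurableAtFilter hβ.continuous.continuousAt
  have hderiv : deriv Θ = β := funext fun t => (hd t).deriv
  have hsub : Function.support Θ ⊆ Set.Icc a b := by
    intro t ht
    by_contra hn
    apply ht
    rw [Set.mem_Icc, not_and_or, not_le, not_le] at hn
    rcases hn with hn | hn
    · simp only [hΘ]
      rw [intervalIntegral.integral_symm, intervalIntegral.integral_of_le hn.le,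
        integral_Ioc_eq_integral_Ioo,
        setIntegral_congr_fun measurableSet_Ioo (fun s hs => hβa s hs.2)]
      simp
    · simp only [hΘ]
      have hat : a ≤ t := (ha hbβ).trans hn.le
      rw [intervalIntegral.integral_of_le hat, ← integral_Icc_eq_integral_Ioc, ← h0]
      refine setIntegral_eq_integral_of_forall_compl_eq_zero fun s hs => ?_
      rw [Set.mem_Icc, not_and_or, not_le, not_le] at hs
      rcases hs with hs | hs
      · exact hβa s hs
      · exact hβb s (hn.trans hs)
  have hts : tsupport Θ ⊆ Set.Icc a b := closure_minimal hsub isClosed_Icc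
  refine ⟨Θ, ?_, isCompact_Icc.of_isClosed_subset (isClosed_tsupport _) hts,
    hts.trans ?_, hderiv⟩
  · rw [contDiff_infty_iff_deriv, hderiv]
    exact ⟨fun t => (hd t).differentiableAt, hβ⟩
  · exact fun t ht => ⟨(hs haβ).1.trans_le ht.1, ht.2.trans_lt (hs hbβ).2⟩

end Product

theorem Integrable.mul_of_continuous_compact {X : Type*} [TopologicalSpace X] [MeasurableSpace X]
    [OpensMeasurableSpace X] {μ : Measure X} {f g : X → ℝ}
    (hf : Integrable f μ) (hg : Continuous g) (hc : HasCompactSupport g) :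
    Integrable (fun x => f x * g x) μ := by
  obtain ⟨C, hC⟩ := hg.bounded_above_of_compact_support hc
  exact hf.mul_bdd hg.aestronglyMeasurable (ae_of_all _ hC)

theorem hasCompactSupport_prod_mul {Y : Type*} [TopologicalSpace Y] [R1Space Y] {α : Y → ℝ}
    {β : ℝ → ℝ} (hα : HasCompactSupport α)
    (hβ : HasCompactSupport β) : HasCompactSupport fun z : Y × ℝ => α z.1 * β z.2 := by
  refine HasCompactSupport.intro (hα.isCompact.prod hβ.isCompact) fun z hz => ?_
  rw [Set.mem_prod, not_and_or] at hz
  rcases hz with hz | hz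
  · rw [image_eq_zero_of_notMem_tsupport hz, zero_mul]
  · rw [image_eq_zero_of_notMem_tsupport hz, mul_zero]

/-! ### Weak derivatives along the axis of a cylinder -/

section Cylinder

variable {Y : Type*} [NormedAddCommGroup Y] [InnerProductSpace ℝ Y] [FiniteDimensional ℝ Y]
  [MeasurableSpace Y] [BorelSpace Y] {D : Set Y} {δ : ℝ} {w h : Y × ℝ → ℝ}

/-- Lebesgue measure on the cylinder `D × (0, δ)`. -/
noncomputable abbrev cyl (D : Set Y) (δ : ℝ) : Measure (Y × ℝ) :=
  (volume.restrict D).prod (volume.restrict (Set.Ioo 0 δ))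

/-- `h` is the weak derivative of `w` in the direction of the axis of the cylinder `D × (0, δ)`;
only products of test functions on `D` and on `(0, δ)` are used. -/
def HasAxialWeakDeriv (D : Set Y) (δ : ℝ) (w h : Y × ℝ → ℝ) : Prop :=
  ∀ (α : Y → ℝ) (β : ℝ → ℝ), ContDiff ℝ ∞ α → HasCompactSupport α → tsupport α ⊆ D →
    ContDiff ℝ ∞ β → HasCompactSupport β → tsupport β ⊆ Set.Ioo 0 δ →
    ∫ z, w z * (α z.1 * deriv β z.2) ∂cyl D δ = -∫ z, h z * (α z.1 * β z.2) ∂cyl D δ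

/-- The primitive of `h` along the axis of a cylinder, starting from the base. -/
noncomputable def axialPrimitive (h : Y × ℝ → ℝ) (z : Y × ℝ) : ℝ :=
  ∫ s in Set.Ioo 0 z.2, h (z.1, s)

/-- On a cylinder, tensor products of test functions suffice to detect that an integrable function
vanishes. -/
theorem ae_eq_zero_of_forall_product_test (hD : IsOpen D) {W : Y × ℝ → ℝ}
    (hW : Integrable W (cyl D δ))
    (h0 : ∀ (α : Y → ℝ) (β : ℝ → ℝ), ContDiff ℝ ∞ α → HasCompactSupport α → tsupport α ⊆ D →
      ContDiff ℝ ∞ β → HasCompactSupport β → tsupport β ⊆ Set.Ioo 0 δ →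
      ∫ z, W z * (α z.1 * β z.2) ∂cyl D δ = 0) :
    W =ᵐ[cyl D δ] 0 := by
  have hWβ : ∀ β : ℝ → ℝ, ContDiff ℝ ∞ β → HasCompactSupport β →
      Integrable (fun z => W z * β z.2) (cyl D δ) := by
    intro β hβ hβc
    obtain ⟨C, hC⟩ := hβ.continuous.bounded_above_of_compact_support hβc
    exact hW.mul_bdd (hβ.continuous.comp continuous_snd).aestronglyMeasurable
      (ae_of_all _ fun z => hC z.2)
  -- For a fixed `β`, the integral of `W β` over almost every vertical line vanishes.
  have step1 : ∀ β : ℝ → ℝ, ContDiff ℝ ∞ β → HasCompactSupport β → tsupport β ⊆ Set.Ioo 0 δ →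
      ∀ᵐ y ∂volume.restrict D, ∫ t in Set.Ioo 0 δ, W (y, t) * β t = 0 := by
    intro β hβ hβc hβs
    have hi := (hWβ β hβ hβc).integral_prod_left
    have := hD.ae_eq_zero_of_integral_contDiff_smul_eq_zero
      (μ := volume.restrict D) (f := fun y => ∫ t in Set.Ioo 0 δ, W (y, t) * β t)
      (hi.locallyIntegrable.locallyIntegrableOn _) fun α hα hαc hαs => ?_
    · filter_upwards [this, ae_restrict_mem hD.measurableSet] with y hy hyD using hy hyD
    · refine Eq.trans ?_ (h0 α β hα hαc hαs hβ hβc hβs)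
      rw [integral_prod]
      · refine integral_congr_ae (ae_of_all _ fun y => ?_)
        simp only [smul_eq_mul]
        rw [← integral_const_mul]
        exact integral_congr_ae (ae_of_all _ fun t => by ring)
      · exact Integrable.mul_of_continuous_compact hW
          ((hα.continuous.comp continuous_fst).mul (hβ.continuous.comp continuous_snd))
          (hasCompactSupport_prod_mul hαc hβc)
  refine ae_eq_zero_of_forall_setIntegral_prod_eq_zero hW fun A B hA hB => ?_
  have hWA : Integrable W (((volume.restrict D).restrict A).prod
      (volume.restrict (Set.Ioo 0 δ))) :=
    hW.mono_measure (Measure.prod_mono Measure.restrict_le_self le_rfl)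
  have hWAB : Integrable W (((volume.restrict D).restrict A).prod
      ((volume.restrict (Set.Ioo 0 δ)).restrict B)) :=
    hW.mono_measure (Measure.prod_mono Measure.restrict_le_self Measure.restrict_le_self)
  have step2 : ∀ᵐ t ∂volume.restrict (Set.Ioo 0 δ), ∫ y in A, W (y, t) ∂volume.restrict D = 0 := by
    have hi := hWA.integral_prod_right
    have := (isOpen_Ioo (a := (0 : ℝ)) (b := δ)).ae_eq_zero_of_integral_contDiff_smul_eq_zero
      (μ := volume.restrict (Set.Ioo 0 δ)) (f := fun t => ∫ y in A, W (y, t) ∂volume.restrict D)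
      (hi.locallyIntegrable.locallyIntegrableOn _) fun β hβ hβc hβs => ?_
    · filter_upwards [this, ae_restrict_mem measurableSet_Ioo] with y hy hyD using hy hyD
    · have : ∫ y in A, (∫ t in Set.Ioo 0 δ, W (y, t) * β t) ∂volume.restrict D = 0 := by
        rw [setIntegral_congr_ae (g := fun _ => 0) hA]
        · simp
        · filter_upwards [step1 β hβ hβc hβs] with y hy _ using hy
      rw [integral_integral_swap] at this
      · refine Eq.trans ?_ this
        refine integral_congr_ae (ae_of_all _ fun y => ?_)
        simp only [smul_eq_mul]
        rw [integral_mul_const, mul_comm]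
      · exact (hWβ β hβ hβc).mono_measure (Measure.prod_mono Measure.restrict_le_self le_rfl)
  rw [← Measure.prod_restrict, integral_prod_symm _ hWAB]
  rw [setIntegral_congr_ae (g := fun _ => 0) hB]
  · simp
  · filter_upwards [step2] with y hy _ using hy

theorem measurable_axialPrimitive (hh : Measurable h) : Measurable (axialPrimitive h) := by
  have : axialPrimitive h = fun z => ∫ s, (if 0 < s ∧ s < z.2 then h (z.1, s) else 0) := by
    ext z
    rw [axialPrimitive, ← integral_indicator measurableSet_Ioo]
    simp only [Set.indicator, Set.mem_Ioo]
  rw [this]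
  refine (StronglyMeasurable.integral_prod_right
    (f := fun (z : Y × ℝ) s => if 0 < s ∧ s < z.2 then h (z.1, s) else 0) ?_).measurable
  refine Measurable.stronglyMeasurable (Measurable.ite ?_ (by fun_prop) measurable_const)
  exact (measurableSet_lt measurable_const measurable_snd).inter
    (measurableSet_lt measurable_snd (by fun_prop))

theorem ae_norm_axialPrimitive_le (hhi : Integrable h (cyl D δ)) :
    ∀ᵐ y ∂volume.restrict D, ∀ t < δ, |axialPrimitive h (y, t)| ≤
      ∫ s in Set.Ioo 0 δ, |h (y, s)| := by
  filter_upwards [hhi.prod_right_ae] with y hy t ht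
  calc |axialPrimitive h (y, t)| ≤ ∫ s in Set.Ioo 0 t, |h (y, s)| :=
        norm_integral_le_integral_norm fun s => h (y, s)
    _ ≤ ∫ s in Set.Ioo 0 δ, |h (y, s)| :=
        setIntegral_mono_set hy.abs (ae_of_all _ fun _ => abs_nonneg _)
          (Set.Ioo_subset_Ioo_right ht.le).eventuallyLE

theorem integrable_axialPrimitive (hh : Measurable h) (hhi : Integrable h (cyl D δ)) :
    Integrable (axialPrimitive h) (cyl D δ) := by
  have hb : Integrable (fun z : Y × ℝ => ∫ s in Set.Ioo 0 δ, |h (z.1, s)|) (cyl D δ) :=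
    hhi.abs.integral_prod_left.comp_fst _
  refine hb.mono' (measurable_axialPrimitive hh).aestronglyMeasurable ?_
  have h1 : ∀ᵐ z ∂cyl D δ, ∀ t < δ, |axialPrimitive h (z.1, t)| ≤
      ∫ s in Set.Ioo 0 δ, |h (z.1, s)| :=
    Measure.quasiMeasurePreserving_fst.ae (ae_norm_axialPrimitive_le hhi)
  have h2 : ∀ᵐ z ∂cyl D δ, z.2 ∈ Set.Ioo 0 δ :=
    Measure.quasiMeasurePreserving_snd.ae (ae_restrict_mem measurableSet_Ioo)
  filter_upwards [h1, h2] with z hz hz2 using hz z.2 hz2.2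

/-- A function with an integrable weak derivative `h` along the axis of the cylinder `D × (0, δ)` is
the sum of its value on the base and of the primitive of `h`. -/
theorem HasAxialWeakDeriv.exists_base_value (hw : HasAxialWeakDeriv D δ w h) (hD : IsOpen D)
    (hδ : 0 < δ) (hh : Measurable h) (hwi : Integrable w (cyl D δ))
    (hhi : Integrable h (cyl D δ)) :
    ∃ G : Y → ℝ, Integrable G (volume.restrict D) ∧
      ∀ᵐ z ∂cyl D δ, w z = G z.1 + axialPrimitive h z := by
  have hPi := integrable_axialPrimitive hh hhi
  set W : Y × ℝ → ℝ := fun z => w z - axialPrimitive h z with hWdef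
  have hWi : Integrable W (cyl D δ) := hwi.sub hPi
  have hmul : ∀ {f : Y × ℝ → ℝ}, Integrable f (cyl D δ) → ∀ {α : Y → ℝ} {β : ℝ → ℝ},
      ContDiff ℝ ∞ α → HasCompactSupport α → ContDiff ℝ ∞ β → HasCompactSupport β →
      Integrable (fun z => f z * (α z.1 * β z.2)) (cyl D δ) := by
    intro f hf α β hα hαc hβ hβc
    exact Integrable.mul_of_continuous_compact hf
      ((hα.continuous.comp continuous_fst).mul (hβ.continuous.comp continuous_snd))
      (hasCompactSupport_prod_mul hαc hβc)
  -- The difference `W` has zero weak derivative along the axis.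
  have hW0 : ∀ (α : Y → ℝ) (Θ : ℝ → ℝ), ContDiff ℝ ∞ α → HasCompactSupport α → tsupport α ⊆ D →
      ContDiff ℝ ∞ Θ → HasCompactSupport Θ → tsupport Θ ⊆ Set.Ioo 0 δ →
      ∫ z, W z * (α z.1 * deriv Θ z.2) ∂cyl D δ = 0 := by
    intro α Θ hα hαc hαs hΘ hΘc hΘs
    have hΘ' : ContDiff ℝ ∞ (deriv Θ) := (contDiff_infty_iff_deriv.1 hΘ).2
    have hΘδ : Θ δ = 0 := image_eq_zero_of_notMem_tsupport fun h => lt_irrefl _ (hΘs h).2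
    have e1 : ∫ z, axialPrimitive h z * (α z.1 * deriv Θ z.2) ∂cyl D δ =
        -∫ z, h z * (α z.1 * Θ z.2) ∂cyl D δ := by
      rw [integral_prod _ (hmul hPi hα hαc hΘ' hΘc.deriv), integral_prod _ (hmul hhi hα hαc hΘ hΘc),
        ← integral_neg]
      refine integral_congr_ae ?_
      filter_upwards [hhi.prod_right_ae] with y hy
      have := integral_primitive_mul_deriv (h := fun s => h (y, s)) hδ hy
        (hΘ.of_le (mod_cast le_top))
      rw [hΘδ, mul_zero, zero_sub] at this
      calc ∫ t in Set.Ioo 0 δ, axialPrimitive h (y, t) * (α y * deriv Θ t)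
          = α y * ∫ t in Set.Ioo 0 δ, (∫ s in Set.Ioo 0 t, h (y, s)) * deriv Θ t := by
            rw [← integral_const_mul]
            exact integral_congr_ae (ae_of_all _ fun t => by simp only [axialPrimitive]; ring)
        _ = -∫ t in Set.Ioo 0 δ, h (y, t) * (α y * Θ t) := by
            rw [this, mul_neg, ← integral_const_mul]
            exact congrArg _ (integral_congr_ae (ae_of_all _ fun t => by ring))
    simp only [hWdef, sub_mul]
    rw [integral_sub (hmul hwi hα hαc hΘ' hΘc.deriv) (hmul hPi hα hαc hΘ' hΘc.deriv), e1,
      hw α Θ hα hαc hαs hΘ hΘc hΘs, sub_self]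
  -- The base value is the average of `W` against a fixed bump `r` of integral one: subtracting a
  -- multiple of `r` from a test function turns it into a derivative.
  let ρ : ContDiffBump (δ / 2) := ⟨δ / 8, δ / 4, by positivity, by linarith⟩
  set r : ℝ → ℝ := ρ.normed volume with hr
  have hrd : ContDiff ℝ ∞ r := ρ.contDiff_normed
  have hrc : HasCompactSupport r := ρ.hasCompactSupport_normed
  have hrs : tsupport r ⊆ Set.Ioo 0 δ := by
    rw [hr, ρ.tsupport_normed_eq, Real.closedBall_eq_Icc]
    intro t ht
    have h1 : δ / 2 - δ / 4 ≤ t := ht.1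
    have h2 : t ≤ δ / 2 + δ / 4 := ht.2
    constructor <;> linarith
  have hr1 : ∫ t, r t = 1 := ρ.integral_normed
  have hrW : Integrable (fun z => W z * r z.2) (cyl D δ) := by
    obtain ⟨C, hC⟩ := hrd.continuous.bounded_above_of_compact_support hrc
    exact hWi.mul_bdd (hrd.continuous.comp continuous_snd).aestronglyMeasurable
      (ae_of_all _ fun z => hC z.2)
  set G : Y → ℝ := fun y => ∫ t in Set.Ioo 0 δ, W (y, t) * r t with hG
  have hGi : Integrable G (volume.restrict D) := hrW.integral_prod_left
  have hGi' : Integrable (fun z : Y × ℝ => G z.1) (cyl D δ) := hGi.comp_fst _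
  refine ⟨G, hGi, ?_⟩
  have hzero := ae_eq_zero_of_forall_product_test hD (hWi.sub hGi') ?_
  · filter_upwards [hzero] with z hz
    simp only [Pi.sub_apply, Pi.zero_apply, hWdef] at hz
    linarith
  · intro α β hα hαc hαs hβ hβc hβs
    set c := ∫ t, β t with hc
    have hint : ∀ {f : ℝ → ℝ}, ContDiff ℝ ∞ f → HasCompactSupport f → Integrable f :=
      fun hf hfc => hf.continuous.integrable_of_hasCompactSupport hfc
    have hcI : ∫ t in Set.Ioo 0 δ, β t = c :=
      setIntegral_eq_integral_of_forall_compl_eq_zero fun t ht =>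
        image_eq_zero_of_notMem_tsupport fun h => ht (hβs h)
    obtain ⟨Θ, hΘ, hΘc, hΘs, hΘd⟩ := exists_test_deriv_eq (δ := δ) (β := fun t => β t - c * r t)
      (hβ.sub (contDiff_const.mul hrd)) (hβc.sub hrc.mul_left)
      ((tsupport_sub _ _).trans (Set.union_subset hβs ((tsupport_mul_subset_right).trans hrs)))
      (by rw [integral_sub (hint hβ hβc) ((hint hrd hrc).const_mul _), integral_const_mul, hr1]
          simp [hc])
    have h1 := hW0 α Θ hα hαc hαs hΘ hΘc hΘs
    rw [hΘd] at h1
    have h2 : ∫ z, W z * (α z.1 * β z.2) ∂cyl D δ = c * ∫ z, W z * (α z.1 * r z.2) ∂cyl D δ := by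
      rw [← integral_const_mul, ← sub_eq_zero, ← integral_sub (hmul hWi hα hαc hβ hβc)
        ((hmul hWi hα hαc hrd hrc).const_mul _), ← h1]
      exact integral_congr_ae (ae_of_all _ fun z => by ring)
    have h3 : ∫ z, G z.1 * (α z.1 * β z.2) ∂cyl D δ = c * ∫ z, W z * (α z.1 * r z.2) ∂cyl D δ := by
      have : ∫ z, (G z.1 * α z.1) * β z.2 ∂cyl D δ =
          (∫ y in D, G y * α y) * ∫ t in Set.Ioo 0 δ, β t :=
        integral_prod_mul (fun y => G y * α y) β
      rw [integral_prod _ (hmul hWi hα hαc hrd hrc), mul_comm c, ← hcI]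
      simp only [mul_assoc] at this
      rw [this]
      congr 1
      refine integral_congr_ae (ae_of_all _ fun y => ?_)
      simp only [hG]
      rw [← integral_mul_const]
      exact integral_congr_ae (ae_of_all _ fun t => by ring)
    simp only [Pi.sub_apply, sub_mul]
    rw [integral_sub (hmul hWi hα hαc hβ hβc) (hmul hGi' hα hαc hβ hβc), h2, h3, sub_self]

end Cylinder

/-! ### Averages over cylinders standing on the base -/

section Cylinder

variable {Y : Type*} [NormedAddCommGroup Y] [InnerProductSpace ℝ Y] [FiniteDimensional ℝ Y]
  [MeasurableSpace Y] [BorelSpace Y] {D : Set Y} {δ : ℝ} {w h : Y × ℝ → ℝ} {G : Y → ℝ}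

/-- The divergence theorem along the axis of a cylinder. -/
theorem integral_axial_by_parts (hδ : 0 < δ) (hh : Measurable h)
    (hhi : Integrable h (cyl D δ)) (hG : Integrable G (volume.restrict D))
    (hw : ∀ᵐ z ∂cyl D δ, w z = G z.1 + axialPrimitive h z) {ψ : Y × ℝ → ℝ}
    (hψ : ContDiff ℝ 1 ψ) (hψc : HasCompactSupport ψ)
    (hψs : ∀ y t, 0 ≤ t → ψ (y, t) ≠ 0 → y ∈ D ∧ t < δ) :
    ∫ z, (h z * ψ z + w z * fderiv ℝ ψ z (0, 1)) ∂cyl D δ = -∫ y in D, G y * ψ (y, 0) := by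
  have hψ' : Continuous fun z => fderiv ℝ ψ z (0, 1) :=
    (hψ.continuous_fderiv (by simp)).clm_apply continuous_const
  have hψc' : HasCompactSupport fun z => fderiv ℝ ψ z (0, 1) := hψc.fderiv_apply ℝ (0, 1)
  have i1 := Integrable.mul_of_continuous_compact hhi hψ.continuous hψc
  have hG' : Integrable (fun z : Y × ℝ => G z.1) (cyl D δ) := hG.comp_fst _
  have i2 := Integrable.mul_of_continuous_compact hG' hψ' hψc'
  have i3 := Integrable.mul_of_continuous_compact (integrable_axialPrimitive hh hhi) hψ' hψc'
  have e : ∫ z, (h z * ψ z + w z * fderiv ℝ ψ z (0, 1)) ∂cyl D δ =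
      ∫ z, (h z * ψ z + (G z.1 * fderiv ℝ ψ z (0, 1) +
        axialPrimitive h z * fderiv ℝ ψ z (0, 1))) ∂cyl D δ := by
    refine integral_congr_ae ?_
    filter_upwards [hw] with z hz
    rw [hz]
    ring
  have i23 : Integrable (fun z : Y × ℝ => G z.1 * fderiv ℝ ψ z (0, 1) +
      axialPrimitive h z * fderiv ℝ ψ z (0, 1)) (cyl D δ) := i2.add i3
  have i123 := i1.add i23
  refine (e.trans (integral_prod _ i123)).trans ?_
  rw [← integral_neg]
  refine integral_congr_ae ?_
  filter_upwards [hhi.prod_right_ae, i1.prod_right_ae, i2.prod_right_ae, i3.prod_right_ae,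
    i23.prod_right_ae] with y hy y1 y2 y3 y23
  have hψy : ContDiff ℝ 1 fun t => ψ (y, t) := hψ.comp (contDiff_const.prodMk contDiff_id)
  have hd : ∀ t, deriv (fun t => ψ (y, t)) t = fderiv ℝ ψ (y, t) (0, 1) := by
    intro t
    have h1 : HasDerivAt (fun t : ℝ => (y, t)) ((0 : Y), (1 : ℝ)) t :=
      (hasDerivAt_const t y).prodMk (hasDerivAt_id t)
    exact ((hψ.differentiable (by simp) (y, t)).hasFDerivAt.comp_hasDerivAt t h1).deriv
  have hψδ : ψ (y, δ) = 0 := by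
    by_contra hne
    exact lt_irrefl _ (hψs y δ hδ.le hne).2
  have k1 := integral_primitive_mul_deriv hδ hy hψy
  have k2 : ∫ t in Set.Ioo 0 δ, fderiv ℝ ψ (y, t) (0, 1) = -ψ (y, 0) := by
    have := intervalIntegral.integral_eq_sub_of_hasDerivAt (a := 0) (b := δ)
      (fun t _ => (hψy.differentiable (by simp) t).hasDerivAt)
      ((hψy.continuous_deriv le_rfl).intervalIntegrable _ _)
    rw [intervalIntegral.integral_of_le hδ.le, integral_Ioc_eq_integral_Ioo, hψδ] at this
    simp only [hd] at this
    rw [this, zero_sub]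
  rw [integral_add y1 y23, integral_add y2 y3, integral_const_mul, k2]
  simp only [hd, hψδ, mul_zero, zero_sub] at k1
  simp only [axialPrimitive]
  rw [k1]
  ring

/-- At almost every point of the base, the base value is the limit of the averages of the function
over the small cylinders standing on that point. -/
theorem ae_tendsto_base_average (hD : IsOpen D) (hδ : 0 < δ)
    (hhi : Integrable h (cyl D δ)) (hG : Integrable G (volume.restrict D))
    (hw : ∀ᵐ z ∂cyl D δ, w z = G z.1 + axialPrimitive h z) :
    ∀ᵐ y ∂volume.restrict D, Tendsto (fun r => (volume.real (Metric.closedBall y r) * r)⁻¹ *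
      ∫ z, |w z - G y| ∂cyl (Metric.closedBall y r) r) (𝓝[>] 0) (𝓝 0) := by
  set ε : ℕ → ℝ := fun n => min δ (1 / ((n : ℝ) + 1)) with hε
  have hε0 : ∀ n, 0 < ε n := fun n => lt_min hδ (by positivity)
  -- The oscillation along the axis over the height `ε n`.
  set H : ℕ → Y → ℝ := fun n y => ∫ s in Set.Ioo 0 (ε n), |h (y, s)| with hH
  have hHi : ∀ n, Integrable (H n) (volume.restrict D) := fun n =>
    ((hhi.mono_measure (Measure.prod_mono le_rfl (Measure.restrict_mono
      (Set.Ioo_subset_Ioo_right (min_le_left _ _)) le_rfl)) :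
        Integrable h (cyl D (ε n)))).abs.integral_prod_left
  have hGD : Integrable (D.indicator G) :=
    (integrable_indicator_iff hD.measurableSet).2 hG
  have hHD : ∀ n, Integrable (D.indicator (H n)) := fun n =>
    (integrable_indicator_iff hD.measurableSet).2 (hHi n)
  have a1 := ae_restrict_of_ae (s := D) (IsUnifLocDoublingMeasure.ae_tendsto_average_norm_sub
    (μ := (volume : Measure Y)) hGD.locallyIntegrable 1)
  have a2 := ae_restrict_of_ae (s := D) (ae_all_iff.2 fun n =>
    IsUnifLocDoublingMeasure.ae_tendsto_average (μ := (volume : Measure Y))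
      (hHD n).locallyIntegrable 1)
  filter_upwards [a1, a2, hhi.prod_right_ae, ae_restrict_mem hD.measurableSet]
    with y h1 h2 h3 hyD
  have hmem : ∀ᶠ r : ℝ in 𝓝[>] 0, y ∈ Metric.closedBall y (1 * r) := by
    filter_upwards [self_mem_nhdsWithin] with r hr
    simpa using (show (0 : ℝ) < r from hr).le
  replace h1 := h1 (fun _ => y) (fun r => r) tendsto_id hmem
  replace h2 := fun n => h2 n (fun _ => y) (fun r => r) tendsto_id hmem
  have hHy : Tendsto (fun n => H n y) atTop (𝓝 0) := by
    have hs : Tendsto (fun n => volume.restrict (Set.Ioo 0 δ) (Set.Ioo 0 (ε n))) atTop (𝓝 0) := by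
      refine tendsto_of_tendsto_of_tendsto_of_le_of_le tendsto_const_nhds
        (h := fun n : ℕ => ENNReal.ofReal (1 / ((n : ℝ) + 1))) ?_ (fun _ => zero_le) fun n => ?_
      · simpa [Function.comp_def] using (ENNReal.continuous_ofReal.tendsto 0).comp
          tendsto_one_div_add_atTop_nhds_zero_nat
      · refine (Measure.restrict_apply_le _ _).trans ?_
        rw [Real.volume_Ioo, sub_zero]
        exact ENNReal.ofReal_le_ofReal (min_le_right _ _)
    have h3' : Integrable (fun s => |h (y, s)|) (volume.restrict (Set.Ioo 0 δ)) := h3.abs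
    have := h3'.tendsto_setIntegral_nhds_zero hs
    refine this.congr fun n => ?_
    rw [Measure.restrict_restrict measurableSet_Ioo, Set.inter_eq_left.2
      (Set.Ioo_subset_Ioo_right (min_le_left _ _))]
  rw [Metric.tendsto_nhds]
  intro e he
  obtain ⟨n, hn⟩ := (hHy.eventually (gt_mem_nhds (half_pos he))).exists
  have b1 := h1.eventually (gt_mem_nhds (half_pos he))
  have b2 := (h2 n).eventually (gt_mem_nhds (show D.indicator (H n) y < e / 2 by
    rwa [Set.indicator_of_mem hyD]))
  obtain ⟨ρ, hρ, hρD⟩ := Metric.nhds_basis_closedBall.mem_iff.1 (hD.mem_nhds hyD)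
  filter_upwards [b1, b2, self_mem_nhdsWithin, Ioo_mem_nhdsGT hρ, Ioo_mem_nhdsGT (hε0 n)]
    with r c1 c2 hr hrρ hrε
  have hr0 : 0 < r := hr
  set B := Metric.closedBall y r with hB
  have hBD : B ⊆ D := (Metric.closedBall_subset_closedBall hrρ.2.le).trans hρD
  have hBm : MeasurableSet B := Metric.isClosed_closedBall.measurableSet
  have hrδ : r ≤ δ := hrε.2.le.trans (min_le_left _ _)
  have hle : cyl B r ≤ cyl D δ := Measure.prod_mono (Measure.restrict_mono hBD le_rfl)
    (Measure.restrict_mono (Set.Ioo_subset_Ioo_right hrδ) le_rfl)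
  have hGB : Integrable G (volume.restrict B) := hG.mono_measure (Measure.restrict_mono hBD le_rfl)
  have hHB : Integrable (H n) (volume.restrict B) :=
    (hHi n).mono_measure (Measure.restrict_mono hBD le_rfl)
  have hBfin : volume B ≠ ⊤ := measure_closedBall_lt_top.ne
  have hBpos : 0 < volume.real B :=
    ENNReal.toReal_pos (Metric.measure_closedBall_pos volume y hr0).ne' hBfin
  have : IsFiniteMeasure (volume.restrict B) := ⟨by simpa using hBfin.lt_top⟩
  have hFi : Integrable (fun x => |G x - G y| + H n x) (volume.restrict B) :=
    (hGB.sub (integrable_const _)).abs.add hHB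
  have hmain : ∫ z, |w z - G y| ∂cyl B r ≤ r * ∫ x in B, (|G x - G y| + H n x) := by
    have e1 : ∫ z : Y × ℝ, (|G z.1 - G y| + H n z.1) * 1 ∂cyl B r =
        (∫ x in B, (|G x - G y| + H n x)) * ∫ _ in Set.Ioo 0 r, (1 : ℝ) :=
      integral_prod_mul (fun x => |G x - G y| + H n x) fun _ => (1 : ℝ)
    have e2 : ∫ _ in Set.Ioo 0 r, (1 : ℝ) = r := by simp [hr0.le]
    rw [e2, mul_comm] at e1
    simp only [mul_one] at e1
    rw [← e1]
    refine integral_mono_of_nonneg (ae_of_all _ fun _ => abs_nonneg _) (hFi.comp_fst _) ?_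
    have h31 : ∀ᵐ z ∂cyl B r, Integrable (fun s => h (z.1, s)) (volume.restrict (Set.Ioo 0 δ)) :=
      (Measure.quasiMeasurePreserving_fst.ae hhi.prod_right_ae :
        ∀ᵐ z ∂cyl D δ, _).filter_mono (ae_mono hle)
    have h32 : ∀ᵐ z ∂cyl B r, z.2 ∈ Set.Ioo 0 r :=
      Measure.quasiMeasurePreserving_snd.ae (ae_restrict_mem measurableSet_Ioo)
    filter_upwards [hw.filter_mono (ae_mono hle), h31, h32] with z hz hz1 hz2
    rw [hz, show G z.1 + axialPrimitive h z - G y = (G z.1 - G y) + axialPrimitive h z by ring]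
    refine (abs_add_le _ _).trans (add_le_add le_rfl ?_)
    calc |axialPrimitive h z| ≤ ∫ s in Set.Ioo 0 z.2, |h (z.1, s)| :=
          norm_integral_le_integral_norm fun s => h (z.1, s)
      _ ≤ H n z.1 := by
          refine setIntegral_mono_set ?_ (ae_of_all _ fun _ => abs_nonneg _)
            (Set.Ioo_subset_Ioo_right (hz2.2.le.trans hrε.2.le)).eventuallyLE
          exact IntegrableOn.mono_set (t := Set.Ioo 0 δ) hz1.abs
            (Set.Ioo_subset_Ioo_right (min_le_left _ _))
  have hGB' : Integrable (fun x => |G x - G y|) (volume.restrict B) :=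
    (hGB.sub (integrable_const _)).abs
  rw [integral_add hGB' hHB] at hmain
  rw [setAverage_eq, smul_eq_mul, setIntegral_congr_fun (g := fun x => |G x - G y|) hBm
    (fun x hx => by
      simp only [Set.indicator_of_mem (hBD hx), Set.indicator_of_mem hyD, Real.norm_eq_abs])] at c1
  rw [setAverage_eq, smul_eq_mul, setIntegral_congr_fun (g := H n) hBm
    (fun x hx => Set.indicator_of_mem (hBD hx) _)] at c2
  have hnn : 0 ≤ (volume.real B * r)⁻¹ * ∫ z, |w z - G y| ∂cyl B r :=
    mul_nonneg (by positivity) (integral_nonneg fun _ => abs_nonneg _)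
  rw [Real.dist_eq, sub_zero, abs_of_nonneg hnn]
  calc (volume.real B * r)⁻¹ * ∫ z, |w z - G y| ∂cyl B r
      ≤ (volume.real B * r)⁻¹ * (r * ((∫ x in B, |G x - G y|) + ∫ x in B, H n x)) := by
        gcongr
    _ = (volume.real B)⁻¹ * (∫ x in B, |G x - G y|) + (volume.real B)⁻¹ * ∫ x in B, H n x := by
        field_simp
    _ < e := by linarith

end Cylinder

/-! ### Oblique coordinates -/

section Chart

variable {V : Type*} [NormedAddCommGroup V] [InnerProductSpace ℝ V]

/-- The hyperplane of vectors orthogonal to `N`. -/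
noncomputable abbrev perp (N : V) : Submodule ℝ V := (ℝ ∙ N)ᗮ

theorem inner_perp (N : V) (y : perp N) : inner ℝ N (y : V) = 0 :=
  Submodule.mem_orthogonal_singleton_iff_inner_right.1 y.2

variable [FiniteDimensional ℝ V] {N x₀ b : V}

/-- Oblique coordinates: the point with coordinates `(y, t)` is `x₀ + y + t b`, where `y` is
orthogonal to the unit vector `N`, and `⟪N, b⟫ = -1`, so that `t > 0` is the half-space which `N`
points out of. -/
noncomputable def obliqueChart (x₀ : V) (hb : inner ℝ N b = -1) :
    perp N × ℝ ≃ₜ V where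
  toFun z := x₀ + z.1 + z.2 • b
  invFun x := ((perp N).orthogonalProjectionOnto (x - x₀ + inner ℝ N (x - x₀) • b),
    -inner ℝ N (x - x₀))
  left_inv z := by
    have h1 : inner ℝ N (x₀ + z.1 + z.2 • b - x₀) = -z.2 := by
      rw [show x₀ + (z.1 : V) + z.2 • b - x₀ = z.1 + z.2 • b by abel, inner_add_right, inner_perp,
        inner_smul_right, hb]
      ring
    have h2 : x₀ + (z.1 : V) + z.2 • b - x₀ + (-z.2) • b = z.1 := by
      rw [neg_smul]
      abel
    ext1
    · simp only [h1, h2]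
      exact Submodule.orthogonalProjectionOnto_mem_subspace_eq_self z.1
    · simp only [h1, neg_neg]
  right_inv x := by
    have h : x - x₀ + inner ℝ N (x - x₀) • b ∈ perp N := by
      rw [Submodule.mem_orthogonal_singleton_iff_inner_right, inner_add_right, inner_smul_right, hb]
      ring
    have h2 := Submodule.orthogonalProjectionOnto_mem_subspace_eq_self (K := perp N) ⟨_, h⟩
    simp only at h2
    simp only [h2]
    rw [neg_smul]
    abel
  continuous_toFun := by fun_prop
  continuous_invFun := by fun_prop

variable {hb : inner ℝ N b = -1}

theorem obliqueChart_apply (z : perp N × ℝ) :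
    obliqueChart x₀ hb z = x₀ + z.1 + z.2 • b := rfl

theorem inner_obliqueChart (z : perp N × ℝ) : inner ℝ N (obliqueChart x₀ hb z - x₀) = -z.2 := by
  rw [obliqueChart_apply, show x₀ + (z.1 : V) + z.2 • b - x₀ = z.1 + z.2 • b by abel,
    inner_add_right, inner_perp, inner_smul_right, hb]
  ring

theorem contDiff_obliqueChart : ContDiff ℝ ∞ (obliqueChart x₀ hb) := by
  change ContDiff ℝ ∞ fun z : perp N × ℝ => x₀ + (z.1 : V) + z.2 • b
  have : ContDiff ℝ ∞ fun z : perp N × ℝ => (z.1 : V) :=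
    (perp N).subtypeL.contDiff.comp contDiff_fst
  fun_prop

theorem contDiff_obliqueChart_symm : ContDiff ℝ ∞ (obliqueChart x₀ hb).symm := by
  change ContDiff ℝ ∞ fun x : V =>
    ((perp N).orthogonalProjectionOnto (x - x₀ + inner ℝ N (x - x₀) • b), -inner ℝ N (x - x₀))
  have h : ContDiff ℝ ∞ fun x : V => inner ℝ N (x - x₀) :=
    contDiff_const.inner ℝ (contDiff_id.sub contDiff_const)
  exact ((perp N).orthogonalProjectionOnto.contDiff.comp (by fun_prop)).prodMk h.neg

theorem hasFDerivAt_obliqueChart_axis (z : perp N × ℝ) :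
    fderiv ℝ (obliqueChart x₀ hb) z (0, 1) = b := by
  have h1 : HasDerivAt (fun t : ℝ => (z.1, t)) ((0 : perp N), (1 : ℝ)) z.2 :=
    (hasDerivAt_const _ _).prodMk (hasDerivAt_id _)
  have h2 := ((contDiff_obliqueChart (x₀ := x₀) (hb := hb)).differentiable
    (by simp) z).hasFDerivAt.comp_hasDerivAt z.2 h1
  have h3 : HasDerivAt (fun t : ℝ => x₀ + (z.1 : V) + t • b) ((1 : ℝ) • b) z.2 :=
    ((hasDerivAt_id z.2).smul_const b).const_add _
  rw [one_smul] at h3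
  exact h2.unique h3

variable [MeasurableSpace V] [BorelSpace V]

theorem measurePreserving_obliqueChart (hN : ‖N‖ = 1) :
    MeasurePreserving (obliqueChart x₀ hb) (volume.prod volume) volume := by
  have hNb : b + N ∈ perp N := by
    rw [Submodule.mem_orthogonal_singleton_iff_inner_right, inner_add_right, hb,
      real_inner_self_eq_norm_sq, hN]
    norm_num
  set c : perp N := ⟨b + N, hNb⟩ with hc
  -- A shear, followed by an isometry.
  have m1 : MeasurePreserving (fun z : ℝ × perp N => (z.1, z.1 • c + z.2))
      (volume.prod volume) (volume.prod volume) :=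
    (MeasurePreserving.id volume).skew_product (g := fun t y => t • c + y)
      (by simp only [Function.uncurry_def]; fun_prop)
      (ae_of_all _ fun t => map_add_left_eq_self _ _)
  have m2 : MeasurePreserving (fun z : ℝ × perp N =>
      (LinearIsometryEquiv.toSpanUnitSingleton N hN (-z.1), z.2))
      (volume.prod volume) (volume.prod volume) :=
    ((LinearIsometryEquiv.measurePreserving _).comp
      (Measure.measurePreserving_neg volume)).prod (MeasurePreserving.id volume)
  have m3 := ((ℝ ∙ N).measurePreserving_measurableEquivProd x₀).symm
  rw [InnerProductSpace.euclideanHausdorffMeasure_eq_volume] at m3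
  have := (m3.comp (m2.comp m1)).comp (Measure.measurePreserving_swap
    (μ := (volume : Measure (perp N))) (ν := (volume : Measure ℝ)))
  refine (funext fun z => ?_ : _ = (obliqueChart x₀ hb : perp N × ℝ → V)) ▸ this
  simp only [obliqueChart_apply, Function.comp_apply, Prod.swap,
    Submodule.measurableEquivProd_symm_apply, LinearIsometryEquiv.toSpanUnitSingleton_apply,
    Submodule.coe_add, Submodule.coe_smul, hc, vadd_eq_add, smul_add, neg_smul]
  abel

theorem measurableEmbedding_obliqueChart : MeasurableEmbedding (obliqueChart x₀ hb) :=
  (obliqueChart x₀ hb).measurableEmbedding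

theorem map_cyl_obliqueChart (hN : ‖N‖ = 1) {D : Set (perp N)} {δ : ℝ} :
    Measure.map (obliqueChart x₀ hb) (cyl D δ) =
      volume.restrict (obliqueChart x₀ hb '' (D ×ˢ Set.Ioo 0 δ)) := by
  rw [cyl, Measure.prod_restrict, ← (measurePreserving_obliqueChart
    (x₀ := x₀) (hb := hb) hN).map_eq,
    measurableEmbedding_obliqueChart.restrict_map,
    Set.preimage_image_eq _ (obliqueChart x₀ hb).injective]

theorem integral_cyl_obliqueChart (hN : ‖N‖ = 1) {D : Set (perp N)} {δ : ℝ} (f : V → ℝ) :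
    ∫ z, f (obliqueChart x₀ hb z) ∂cyl D δ =
      ∫ x in obliqueChart x₀ hb '' (D ×ˢ Set.Ioo 0 δ), f x := by
  rw [← map_cyl_obliqueChart hN, measurableEmbedding_obliqueChart.integral_map]

theorem integrable_cyl_obliqueChart (hN : ‖N‖ = 1) {D : Set (perp N)} {δ : ℝ} {f : V → ℝ} :
    Integrable (fun z => f (obliqueChart x₀ hb z)) (cyl D δ) ↔
      IntegrableOn f (obliqueChart x₀ hb '' (D ×ˢ Set.Ioo 0 δ)) := by
  rw [IntegrableOn, ← map_cyl_obliqueChart hN, measurableEmbedding_obliqueChart.integrable_map_iff]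
  rfl

end Chart

/-! ### Weak gradients and averages over half-balls -/

section WeakGradient

variable {d : ℕ}

/-- `w ∈ H^1(U)` with weak gradient `g`. -/
structure HasWeakGrad (U : Set (E d)) (w : E d → ℝ) (g : Fin d → E d → ℝ) : Prop where
  memLp : MemLp w 2 (volume.restrict U)
  memLp_grad : ∀ j, MemLp (g j) 2 (volume.restrict U)
  hasWeakDeriv : ∀ j, HasWeakDeriv U j w (g j)

variable {U : Set (E d)} {w : E d → ℝ} {g : Fin d → E d → ℝ}

theorem integrableOn_of_memLp_two (hU : volume U ≠ ⊤) (hw : MemLp w 2 (volume.restrict U)) :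
    IntegrableOn w U := by
  have : IsFiniteMeasure (volume.restrict U) := ⟨by simpa using hU.lt_top⟩
  exact hw.integrable (by norm_num)

theorem HasWeakGrad.integrableOn (hw : HasWeakGrad U w g) (hU : volume U ≠ ⊤) :
    IntegrableOn w U :=
  integrableOn_of_memLp_two hU hw.memLp

theorem HasWeakGrad.integrableOn_dir (hw : HasWeakGrad U w g) (hU : volume U ≠ ⊤) (b : E d) :
    IntegrableOn (fun x => ∑ j, b j * g j x) U :=
  integrable_finsetSum _ fun j _ =>
    (integrableOn_of_memLp_two hU (hw.memLp_grad j)).const_mul (b j)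

theorem fderiv_eq_sum (φ : E d → ℝ) (x b : E d) :
    fderiv ℝ φ x b = ∑ j, b j * fderiv ℝ φ x (EuclideanSpace.single j 1) := by
  have hb : b = ∑ j, b j • EuclideanSpace.single j (1 : ℝ) := by
    conv_lhs => rw [← (EuclideanSpace.basisFun (Fin d) ℝ).sum_repr b]
    simp
  conv_lhs => rw [hb, map_sum]
  simp

theorem continuous_fderiv_dir {V : Type*} [NormedAddCommGroup V] [NormedSpace ℝ V] {φ : V → ℝ}
    (hφ : ContDiff ℝ ∞ φ) (b : V) : Continuous fun x => fderiv ℝ φ x b :=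
  (hφ.continuous_fderiv (by simp)).clm_apply continuous_const

/-- The weak derivative in an arbitrary direction. -/
theorem HasWeakGrad.integral_dir (hw : HasWeakGrad U w g) (hU : volume U ≠ ⊤) (b : E d)
    {φ : E d → ℝ} (hφ : ContDiff ℝ ∞ φ) (hφc : HasCompactSupport φ) (hφs : tsupport φ ⊆ U) :
    ∫ x in U, w x * fderiv ℝ φ x b = -∫ x in U, (∑ j, b j * g j x) * φ x := by
  have hd : ∀ j, Integrable (fun x => w x * fderiv ℝ φ x (EuclideanSpace.single j 1))
      (volume.restrict U) := fun j =>
    Integrable.mul_of_continuous_compact (hw.integrableOn hU) (continuous_fderiv_dir hφ _)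
      (hφc.fderiv_apply ℝ _)
  have hg : ∀ j, Integrable (fun x => g j x * φ x) (volume.restrict U) := fun j =>
    Integrable.mul_of_continuous_compact (integrableOn_of_memLp_two hU (hw.memLp_grad j))
      hφ.continuous hφc
  calc ∫ x in U, w x * fderiv ℝ φ x b
      = ∫ x in U, ∑ j, b j * (w x * fderiv ℝ φ x (EuclideanSpace.single j 1)) := by
        refine integral_congr_ae (ae_of_all _ fun x => ?_)
        simp only
        rw [fderiv_eq_sum, Finset.mul_sum]
        exact Finset.sum_congr rfl fun j _ => by ring
    _ = ∑ j, b j * ∫ x in U, w x * fderiv ℝ φ x (EuclideanSpace.single j 1) := by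
        rw [integral_finsetSum _ fun j _ => (hd j).const_mul _]
        simp only [integral_const_mul]
    _ = ∑ j, -∫ x in U, b j * (g j x * φ x) := by
        refine Finset.sum_congr rfl fun j _ => ?_
        rw [(hw.hasWeakDeriv j).2.2 φ hφ hφc hφs, mul_neg, integral_const_mul]
    _ = -∫ x in U, (∑ j, b j * g j x) * φ x := by
        rw [Finset.sum_neg_distrib, ← integral_finsetSum _ fun j _ => (hg j).const_mul _]
        congr 1
        refine integral_congr_ae (ae_of_all _ fun x => ?_)
        simp only
        rw [Finset.sum_mul]
        exact Finset.sum_congr rfl fun j _ => by ring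

theorem setIntegral_mul_eq_of_tsupport {φ f : E d → ℝ} {S : Set (E d)} (hU : IsOpen U)
    (hS : S ⊆ U) (h : U ∩ tsupport φ ⊆ S) : ∫ x in U, f x * φ x = ∫ x in S, f x * φ x :=
  setIntegral_eq_of_subset_of_forall_sdiff_eq_zero hU.measurableSet hS fun x hx => by
    rw [image_eq_zero_of_notMem_tsupport fun h' => hx.2 (h ⟨hx.1, h'⟩), mul_zero]

theorem fderiv_eq_zero_of_notMem_tsupport {φ : E d → ℝ} {x : E d} (hx : x ∉ tsupport φ) :
    fderiv ℝ φ x = 0 :=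
  image_eq_zero_of_notMem_tsupport fun h => hx (tsupport_fderiv_subset ℝ h)

theorem setIntegral_mul_fderiv_eq_of_tsupport {φ f : E d → ℝ} {S : Set (E d)} {b : E d}
    (hU : IsOpen U) (hS : S ⊆ U) (h : U ∩ tsupport φ ⊆ S) :
    ∫ x in U, f x * fderiv ℝ φ x b = ∫ x in S, f x * fderiv ℝ φ x b :=
  setIntegral_eq_of_subset_of_forall_sdiff_eq_zero hU.measurableSet hS fun x hx => by
    rw [fderiv_eq_zero_of_notMem_tsupport fun h' => hx.2 (h ⟨hx.1, h'⟩)]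
    simp

variable {N x₀ b : E d}

/-- On a cylinder contained in `U`, a function in `H^1(U)` has a weak derivative along the axis. -/
theorem HasWeakGrad.hasAxialWeakDeriv (hw : HasWeakGrad U w g) (hUo : IsOpen U) (hU : volume U ≠ ⊤)
    (hN : ‖N‖ = 1) (hb : inner ℝ N b = -1) {D : Set (perp N)} {δ : ℝ}
    (hDU : obliqueChart x₀ hb '' (D ×ˢ Set.Ioo 0 δ) ⊆ U) :
    HasAxialWeakDeriv D δ (fun z => w (obliqueChart x₀ hb z))
      (fun z => ∑ j, b j * g j (obliqueChart x₀ hb z)) := by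
  intro α β hα hαc hαs hβ hβc hβs
  set Φ := obliqueChart x₀ hb with hΦ
  set f : perp N × ℝ → ℝ := fun z => α z.1 * β z.2 with hf
  have hfd : ContDiff ℝ ∞ f := (hα.comp contDiff_fst).mul (hβ.comp contDiff_snd)
  set φ : E d → ℝ := f ∘ Φ.symm with hφ
  have hφd : ContDiff ℝ ∞ φ := hfd.comp contDiff_obliqueChart_symm
  have hφc : HasCompactSupport φ :=
    (hasCompactSupport_prod_mul hαc hβc).comp_homeomorph Φ.symm
  have hφs : tsupport φ ⊆ Φ '' (D ×ˢ Set.Ioo 0 δ) := by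
    have h1 : IsCompact (Φ '' (tsupport α ×ˢ tsupport β)) :=
      (hαc.isCompact.prod hβc.isCompact).image Φ.continuous
    refine (closure_minimal ?_ h1.isClosed).trans (Set.image_mono (Set.prod_mono hαs hβs))
    intro x hx
    refine ⟨Φ.symm x, ⟨?_, ?_⟩, Φ.apply_symm_apply x⟩
    · exact subset_tsupport _ (left_ne_zero_of_mul hx)
    · exact subset_tsupport _ (right_ne_zero_of_mul hx)
  have hφz : ∀ z, φ (Φ z) = α z.1 * β z.2 := fun z => by simp [hφ, hf]
  have hφd' : ∀ z, fderiv ℝ φ (Φ z) b = α z.1 * deriv β z.2 := by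
    intro z
    have h1 : HasDerivAt (fun t : ℝ => (z.1, t)) ((0 : perp N), (1 : ℝ)) z.2 :=
      (hasDerivAt_const _ _).prodMk (hasDerivAt_id _)
    have h2 : HasFDerivAt Φ (fderiv ℝ Φ z) z :=
      (contDiff_obliqueChart.differentiable (by simp) z).hasFDerivAt
    have h3 : HasFDerivAt φ (fderiv ℝ φ (Φ z)) (Φ z) :=
      (hφd.differentiable (by simp) _).hasFDerivAt
    have h4 := (h3.comp z h2).comp_hasDerivAt z.2 h1
    rw [ContinuousLinearMap.comp_apply, hasFDerivAt_obliqueChart_axis] at h4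
    have h5 : HasDerivAt (fun t => α z.1 * β t) (α z.1 * deriv β z.2) z.2 :=
      ((hβ.differentiable (by simp) z.2).hasDerivAt).const_mul _
    refine h4.unique (h5.congr_of_eventuallyEq (Eventually.of_forall fun t => ?_))
    exact hφz (z.1, t)
  have key := hw.integral_dir hU b hφd hφc (hφs.trans hDU)
  have hsub : U ∩ tsupport φ ⊆ Φ '' (D ×ˢ Set.Ioo 0 δ) := Set.inter_subset_right.trans hφs
  rw [setIntegral_mul_fderiv_eq_of_tsupport hUo hDU hsub,
    setIntegral_mul_eq_of_tsupport hUo hDU hsub, ← integral_cyl_obliqueChart hN,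
    ← integral_cyl_obliqueChart hN] at key
  simp only [← hΦ, hφd', hφz] at key
  exact key

/-- Convergence of the averages over small cylinders implies convergence of the averages over
half-balls. -/
theorem hasTrace_of_tendsto_cylinder (hN : ‖N‖ = 1) (hb : inner ℝ N b = -1) (hU : volume U ≠ ⊤)
    (hw : IntegrableOn w U) {D : Set (perp N)} {δ : ℝ} (hD : IsOpen D) (hδ : 0 < δ)
    (hDU : obliqueChart x₀ hb '' (D ×ˢ Set.Ioo 0 δ) ⊆ U) {y : perp N} (hy : y ∈ D) {c : ℝ}
    (hlim : Tendsto (fun r => (volume.real (Metric.closedBall y r) * r)⁻¹ *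
      ∫ z, |w (obliqueChart x₀ hb z) - c| ∂cyl (Metric.closedBall y r) r) (𝓝[>] 0) (𝓝 0))
    {ρ : ℝ} (hρ : 0 < ρ) (hhalf : Metric.ball (x₀ + y) ρ ∩ U =
      Metric.ball (x₀ + y) ρ ∩ {x | inner ℝ N (x - (x₀ + y)) < 0}) :
    HasTrace U w (x₀ + y) c := by
  set Φ := obliqueChart x₀ hb with hΦ
  set A : ℝ := 1 + ‖b‖ with hA
  have hA0 : 0 < A := by positivity
  set m := Module.finrank ℝ (perp N) with hm
  -- The ratio of the volumes of the two cylinders between which the half-ball lies.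
  set κ : ℝ := (2 * A * A) ^ (m + 1) with hκ
  -- The half-ball of radius `r` lies between the cylinders of sizes `r / (2 A)` and `A r`.
  have hin : ∀ z : perp N × ℝ, ‖Φ z - (x₀ + y)‖ ≤ ‖z.1 - y‖ + |z.2| * ‖b‖ := by
    intro z
    have : Φ z - (x₀ + y) = ((z.1 - y : perp N) : E d) + z.2 • b := by
      rw [hΦ, obliqueChart_apply, Submodule.coe_sub]
      abel
    rw [this]
    refine (norm_add_le _ _).trans ?_
    rw [norm_smul, Real.norm_eq_abs]
    rfl
  have hout1 : ∀ z : perp N × ℝ, inner ℝ N (Φ z - (x₀ + y)) = -z.2 := by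
    intro z
    rw [show Φ z - (x₀ + y) = (Φ z - x₀) - y by abel, inner_sub_right, inner_perp,
      inner_obliqueChart, sub_zero]
  have hout2 : ∀ z : perp N × ℝ, |z.2| ≤ ‖Φ z - (x₀ + y)‖ := by
    intro z
    have := abs_real_inner_le_norm N (Φ z - (x₀ + y))
    rwa [hout1, abs_neg, hN, one_mul] at this
  have hout3 : ∀ z : perp N × ℝ, ‖z.1 - y‖ ≤ A * ‖Φ z - (x₀ + y)‖ := by
    intro z
    have h1 : ((z.1 - y : perp N) : E d) = (Φ z - (x₀ + y)) - z.2 • b := by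
      rw [hΦ, obliqueChart_apply, Submodule.coe_sub]
      abel
    calc ‖z.1 - y‖ = ‖(Φ z - (x₀ + y)) - z.2 • b‖ := by rw [← h1]; rfl
      _ ≤ ‖Φ z - (x₀ + y)‖ + |z.2| * ‖b‖ := by
        refine (norm_sub_le _ _).trans ?_
        rw [norm_smul, Real.norm_eq_abs]
      _ ≤ A * ‖Φ z - (x₀ + y)‖ := by
        have := mul_le_mul_of_nonneg_right (hout2 z) (norm_nonneg b)
        rw [hA]
        linarith
  have hlim' : Tendsto (fun r => κ * ((volume.real (Metric.closedBall y (A * r)) * (A * r))⁻¹ *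
      ∫ z, |w (Φ z) - c| ∂cyl (Metric.closedBall y (A * r)) (A * r))) (𝓝[>] 0) (𝓝 0) := by
    have hAr : Tendsto (fun r : ℝ => A * r) (𝓝[>] 0) (𝓝[>] 0) := by
      refine tendsto_nhdsWithin_iff.2 ⟨?_, ?_⟩
      · refine tendsto_nhdsWithin_of_tendsto_nhds ?_
        have : Continuous fun r : ℝ => A * r := by fun_prop
        simpa using this.tendsto 0
      · filter_upwards [self_mem_nhdsWithin] with r hr using mul_pos hA0 hr
    simpa using (hlim.comp hAr).const_mul κ
  obtain ⟨η, hη, hηD⟩ := Metric.nhds_basis_closedBall.mem_iff.1 (hD.mem_nhds hy)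
  rw [HasTrace, tendsto_iff_norm_sub_tendsto_zero]
  refine squeeze_zero' (Eventually.of_forall fun r => norm_nonneg _) ?_ hlim'
  filter_upwards [self_mem_nhdsWithin, Ioo_mem_nhdsGT hρ, Ioo_mem_nhdsGT (div_pos hη hA0),
    Ioo_mem_nhdsGT (div_pos hδ hA0)] with r hr hrρ hrη hrδ
  have hr0 : 0 < r := hr
  have hAη : A * r ≤ η := by
    have := hrη.2.le
    rwa [le_div_iff₀ hA0, mul_comm] at this
  have hAδ : A * r ≤ δ := by
    have := hrδ.2.le
    rwa [le_div_iff₀ hA0, mul_comm] at this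
  set S := Metric.ball (x₀ + (y : E d)) r ∩ U with hS
  have hSeq : S = Metric.ball (x₀ + (y : E d)) r ∩ {x | inner ℝ N (x - (x₀ + y)) < 0} := by
    have hbb : Metric.ball (x₀ + (y : E d)) r ∩ Metric.ball (x₀ + (y : E d)) ρ =
        Metric.ball (x₀ + (y : E d)) r :=
      Set.inter_eq_left.2 (Metric.ball_subset_ball hrρ.2.le)
    rw [hS, ← hbb, Set.inter_assoc, hhalf, ← Set.inter_assoc]
  have hSsub : S ⊆ Φ '' (Metric.closedBall y (A * r) ×ˢ Set.Ioo 0 (A * r)) := by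
    intro x hx
    rw [hSeq] at hx
    have hxr : ‖x - (x₀ + y)‖ < r := by simpa [dist_eq_norm] using hx.1
    refine ⟨Φ.symm x, ?_, Φ.apply_symm_apply x⟩
    have e1 := hout1 (Φ.symm x)
    have e2 := hout2 (Φ.symm x)
    have e3 := hout3 (Φ.symm x)
    rw [Φ.apply_symm_apply] at e1 e2 e3
    have hx2 : inner ℝ N (x - (x₀ + y)) < 0 := hx.2
    refine ⟨?_, ?_, ?_⟩
    · rw [mem_closedBall_iff_norm]
      exact e3.trans (mul_le_mul_of_nonneg_left hxr.le hA0.le)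
    · linarith
    · have h1A : r ≤ A * r := by
        have := mul_nonneg (norm_nonneg b) hr0.le
        rw [hA]
        linarith
      exact ((le_abs_self _).trans e2).trans_lt (hxr.trans_le h1A)
  set s := r / (2 * A) with hs
  have hs0 : 0 < s := by positivity
  have hsub2 : Φ '' (Metric.closedBall y s ×ˢ Set.Ioo 0 s) ⊆ S := by
    rintro _ ⟨z, ⟨hz1, hz2⟩, rfl⟩
    rw [mem_closedBall_iff_norm] at hz1
    rw [hSeq]
    constructor
    · rw [mem_ball_iff_norm]
      calc ‖Φ z - (x₀ + y)‖ ≤ ‖z.1 - y‖ + |z.2| * ‖b‖ := hin z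
        _ ≤ s + s * ‖b‖ := by
          gcongr
          rw [abs_of_pos hz2.1]
          exact hz2.2.le
        _ = s * A := by rw [hA]; ring
        _ = r / 2 := by rw [hs]; field_simp
        _ < r := by linarith
    · change inner ℝ N (Φ z - (x₀ + y)) < 0
      rw [hout1]
      linarith [hz2.1]
  have hSfin : volume S ≠ ⊤ := measure_ne_top_of_subset Set.inter_subset_right hU
  have hvol : ∀ ρ : ℝ, 0 < ρ → volume.real (Φ '' (Metric.closedBall y ρ ×ˢ Set.Ioo 0 ρ)) =
      volume.real (Metric.closedBall y ρ) * ρ := by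
    intro ρ hρ
    have h1 := integral_cyl_obliqueChart (x₀ := x₀) (hb := hb) hN (D := Metric.closedBall y ρ)
      (δ := ρ) fun _ => (1 : ℝ)
    have h2 : (cyl (Metric.closedBall y ρ) ρ).real Set.univ =
        volume.real (Metric.closedBall y ρ) * ρ := by
      rw [cyl, ← Set.univ_prod_univ, measureReal_prod_prod]
      simp [hρ.le]
    simpa [h2] using h1.symm
  have hballs : ∀ ρ : ℝ, 0 < ρ → volume.real (Metric.closedBall y ρ) =
      ρ ^ m * volume.real (Metric.ball (0 : perp N) 1) := by
    intro ρ hρ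
    exact Measure.addHaar_real_closedBall _ _ hρ.le
  have hB1 : 0 < volume.real (Metric.ball (0 : perp N) 1) :=
    ENNReal.toReal_pos (Metric.measure_ball_pos volume _ one_pos).ne' measure_ball_lt_top.ne
  have hSvol : volume.real (Metric.closedBall y (A * r)) * (A * r) ≤ κ * volume.real S := by
    have h1 : volume.real (Metric.closedBall y s) * s ≤ volume.real S := by
      rw [← hvol s hs0]
      exact measureReal_mono hsub2 hSfin
    have h2 : volume.real (Metric.closedBall y (A * r)) * (A * r) =
        κ * (volume.real (Metric.closedBall y s) * s) := by
      rw [hballs _ (by positivity), hballs _ hs0, hκ, hs]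
      have : A * r = (2 * A * A) * (r / (2 * A)) := by field_simp
      rw [this, mul_pow]
      ring
    rw [h2]
    gcongr
  have hbig : 0 < volume.real (Metric.closedBall y (A * r)) * (A * r) := by
    rw [hballs _ (by positivity)]
    positivity
  have hκ0 : 0 < κ := by positivity
  have hSpos : 0 < volume.real S := pos_of_mul_pos_right (hbig.trans_le hSvol) hκ0.le
  have : IsFiniteMeasure (volume.restrict S) := ⟨by simpa using hSfin.lt_top⟩
  have hwS : IntegrableOn w S := hw.mono_set Set.inter_subset_right
  have hconst : IntegrableOn (fun _ => c) S := integrable_const _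
  have hwc : IntegrableOn (fun x => w x - c) S := hwS.sub hconst
  have hQU : Φ '' (Metric.closedBall y (A * r) ×ˢ Set.Ioo 0 (A * r)) ⊆ U :=
    (Set.image_mono (Set.prod_mono ((Metric.closedBall_subset_closedBall hAη).trans hηD)
      (Set.Ioo_subset_Ioo_right hAδ))).trans hDU
  have hQfin : volume (Φ '' (Metric.closedBall y (A * r) ×ˢ Set.Ioo 0 (A * r))) ≠ ⊤ :=
    measure_ne_top_of_subset hQU hU
  have hQ : IntegrableOn (fun x => |w x - c|)
      (Φ '' (Metric.closedBall y (A * r) ×ˢ Set.Ioo 0 (A * r))) :=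
    ((hw.mono_set hQU).sub (integrableOn_const hQfin)).abs
  have hav : (⨍ x in S, w x) - c = ⨍ x in S, (w x - c) := by
    rw [setAverage_eq, setAverage_eq, integral_sub hwS hconst, smul_sub]
    simp [hSpos.ne']
  rw [hav, setAverage_eq, norm_smul, norm_inv, Real.norm_of_nonneg hSpos.le]
  calc (volume.real S)⁻¹ * ‖∫ x in S, (w x - c)‖
      ≤ (volume.real S)⁻¹ * ∫ z, |w (Φ z) - c| ∂cyl (Metric.closedBall y (A * r)) (A * r) := by
        gcongr
        refine (norm_integral_le_integral_norm _).trans ?_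
        rw [integral_cyl_obliqueChart hN fun x => |w x - c|]
        exact setIntegral_mono_set hQ (ae_of_all _ fun _ => abs_nonneg _) hSsub.eventuallyLE
    _ ≤ (κ * (volume.real (Metric.closedBall y (A * r)) * (A * r))⁻¹) *
        ∫ z, |w (Φ z) - c| ∂cyl (Metric.closedBall y (A * r)) (A * r) := by
        gcongr
        rw [inv_le_iff_one_le_mul₀ hSpos]
        · rw [mul_right_comm, ← div_eq_mul_inv, one_le_div hbig]
          exact hSvol
    _ = _ := by rw [mul_assoc]

end WeakGradient

/-! ### The divergence theorem near a flat piece of the boundary -/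

section BaseTrace

variable {d : ℕ} {U : Set (E d)} {w : E d → ℝ} {g : Fin d → E d → ℝ} {N x₀ b : E d}

/-- A function in `H^1(U)` has an integrable trace on the base of each cylinder contained in `U`,
and the divergence theorem along the axis holds with this trace. -/
theorem HasWeakGrad.exists_base_trace (hw : HasWeakGrad U w g) (hUo : IsOpen U)
    (hU : volume U ≠ ⊤) (hN : ‖N‖ = 1) (hb : inner ℝ N b = -1) {D : Set (perp N)} {δ : ℝ}
    (hD : IsOpen D) (hδ : 0 < δ) (hDU : obliqueChart x₀ hb '' (D ×ˢ Set.Ioo 0 δ) ⊆ U) :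
    ∃ G : perp N → ℝ, Integrable G (volume.restrict D) ∧
      (∀ᵐ y : perp N ∂volume.restrict D, ∀ ρ > 0, Metric.ball (x₀ + (y : E d)) ρ ∩ U =
        Metric.ball (x₀ + (y : E d)) ρ ∩ {x | inner ℝ N (x - (x₀ + (y : E d))) < 0} →
          HasTrace U w (x₀ + y) (G y)) ∧
      ∀ ψ : E d → ℝ, ContDiff ℝ ∞ ψ → HasCompactSupport ψ →
        (∀ y t, 0 ≤ t → ψ (obliqueChart x₀ hb (y, t)) ≠ 0 → y ∈ D ∧ t < δ) →
        U ∩ tsupport ψ ⊆ obliqueChart x₀ hb '' (D ×ˢ Set.Ioo 0 δ) →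
        ∫ x in U, ((∑ j, b j * g j x) * ψ x + w x * fderiv ℝ ψ x b) =
          -∫ y in D, G y * ψ (x₀ + y) := by
  set Φ := obliqueChart x₀ hb with hΦ
  have hwi : Integrable (fun z => w (Φ z)) (cyl D δ) :=
    (integrable_cyl_obliqueChart hN).2 ((hw.integrableOn hU).mono_set hDU)
  have hhi : Integrable (fun z => ∑ j, b j * g j (Φ z)) (cyl D δ) :=
    (integrable_cyl_obliqueChart (f := fun x => ∑ j, b j * g j x) hN).2
      ((hw.integrableOn_dir hU b).mono_set hDU)
  set h := hhi.1.aemeasurable.mk _ with hh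
  have hhm : Measurable h := hhi.1.aemeasurable.measurable_mk
  have hheq : (fun z => ∑ j, b j * g j (Φ z)) =ᵐ[cyl D δ] h := hhi.1.aemeasurable.ae_eq_mk
  have hhi' : Integrable h (cyl D δ) := hhi.congr hheq
  have hax : HasAxialWeakDeriv D δ (fun z => w (Φ z)) h := by
    intro α β h1 h2 h3 h4 h5 h6
    rw [hw.hasAxialWeakDeriv hUo hU hN hb hDU α β h1 h2 h3 h4 h5 h6]
    congr 1
    refine integral_congr_ae ?_
    filter_upwards [hheq] with z hz
    rw [← hz]
  obtain ⟨G, hG, hGw⟩ := hax.exists_base_value hD hδ hhm hwi hhi'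
  refine ⟨G, hG, ?_, ?_⟩
  · filter_upwards [ae_tendsto_base_average hD hδ hhi' hG hGw, ae_restrict_mem hD.measurableSet]
      with y hy hyD ρ hρ hhalf
    exact hasTrace_of_tendsto_cylinder hN hb hU (hw.integrableOn hU) hD hδ hDU hyD hy hρ hhalf
  · intro ψ hψ hψc hψs hψU
    have hψΦ : ContDiff ℝ ∞ (ψ ∘ Φ) := hψ.comp contDiff_obliqueChart
    have key := integral_axial_by_parts hδ hhm hhi' hG hGw (ψ := ψ ∘ Φ)
      (hψΦ.of_le (mod_cast le_top)) (hψc.comp_homeomorph Φ) hψs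
    have hd : ∀ z, fderiv ℝ (ψ ∘ Φ) z (0, 1) = fderiv ℝ ψ (Φ z) b := by
      intro z
      rw [fderiv_comp _ (hψ.differentiable (by simp) _)
        (contDiff_obliqueChart.differentiable (by simp) _), ContinuousLinearMap.comp_apply,
        hasFDerivAt_obliqueChart_axis]
    have h0 : ∀ y : perp N, Φ (y, 0) = x₀ + y := fun y => by
      rw [hΦ, obliqueChart_apply]
      simp
    simp only [Function.comp_apply, h0, hd] at key
    rw [← key]
    have e1 : ∫ z, (h z * ψ (Φ z) + w (Φ z) * fderiv ℝ ψ (Φ z) b) ∂cyl D δ =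
        ∫ z, ((∑ j, b j * g j (Φ z)) * ψ (Φ z) + w (Φ z) * fderiv ℝ ψ (Φ z) b) ∂cyl D δ := by
      refine integral_congr_ae ?_
      filter_upwards [hheq] with z hz
      rw [← hz]
    rw [e1, integral_cyl_obliqueChart hN
      fun x => (∑ j, b j * g j x) * ψ x + w x * fderiv ℝ ψ x b]
    refine setIntegral_eq_of_subset_of_forall_sdiff_eq_zero hUo.measurableSet hDU fun x hx => ?_
    have hx' : x ∉ tsupport ψ := fun h' => hx.2 (hψU ⟨hx.1, h'⟩)
    rw [image_eq_zero_of_notMem_tsupport hx', fderiv_eq_zero_of_notMem_tsupport hx']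
    simp

theorem trace_eq {x : E d} {c : ℝ} (h : HasTrace U w x c) : trace U w x = c :=
  h.limUnder_eq

/-- The divergence theorem near a flat piece of the boundary, for a direction `b` transversal to
the boundary. -/
theorem HasWeakGrad.local_transversal (hw : HasWeakGrad U w g) (hUo : IsOpen U)
    (hU : volume U ≠ ⊤) (hN : ‖N‖ = 1) (hb : inner ℝ N b = -1) (hb3 : ‖b‖ ≤ 3) {r : ℝ}
    (hr : 0 < r) (hhalf : Metric.ball x₀ (7 * r) ∩ U =
      Metric.ball x₀ (7 * r) ∩ {x | inner ℝ N (x - x₀) < 0}) :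
    (∀ᵐ y : perp N ∂volume.restrict (Metric.ball 0 (4 * r)),
      HasTrace U w (x₀ + y) (trace U w (x₀ + y))) ∧
    IntegrableOn (fun y : perp N => trace U w (x₀ + y)) (Metric.ball 0 (4 * r)) ∧
    ∀ ψ : E d → ℝ, ContDiff ℝ ∞ ψ → tsupport ψ ⊆ Metric.ball x₀ r →
      ∫ x in U, ((∑ j, b j * g j x) * ψ x + w x * fderiv ℝ ψ x b) =
        -∫ y in Metric.ball (0 : perp N) (4 * r), trace U w (x₀ + y) * ψ (x₀ + y) := by
  -- As `‖b‖ ≤ 3`, the cylinder of height `r` on the disc of radius `4 r` lies in the ball of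
  -- radius `7 r`.
  have hnorm : ∀ (y : perp N) (t : ℝ), ‖(y : E d)‖ < 4 * r → |t| < r →
      ‖(y : E d) + t • b‖ < 7 * r := by
    intro y t hy ht
    calc ‖(y : E d) + t • b‖ ≤ ‖(y : E d)‖ + |t| * ‖b‖ := by
          refine (norm_add_le _ _).trans ?_
          rw [norm_smul, Real.norm_eq_abs]
      _ < 4 * r + r * 3 := add_lt_add_of_lt_of_le hy (mul_le_mul ht.le hb3 (norm_nonneg _) hr.le)
      _ = 7 * r := by ring
  have hDU : obliqueChart x₀ hb '' (Metric.ball (0 : perp N) (4 * r) ×ˢ Set.Ioo 0 r) ⊆ U := by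
    rintro _ ⟨⟨y, t⟩, ⟨hy, ht⟩, rfl⟩
    have : obliqueChart x₀ hb (y, t) ∈ Metric.ball x₀ (7 * r) ∩ {x | inner ℝ N (x - x₀) < 0} := by
      refine ⟨?_, ?_⟩
      · rw [mem_ball_iff_norm, obliqueChart_apply, add_assoc, add_sub_cancel_left]
        exact hnorm y t (by simpa using hy) (by rw [abs_of_pos ht.1]; exact ht.2)
      · change inner ℝ N (obliqueChart x₀ hb (y, t) - x₀) < 0
        rw [inner_obliqueChart]
        linarith [ht.1]
    rw [← hhalf] at this
    exact this.2
  obtain ⟨G, hG, hGt, hGi⟩ := hw.exists_base_trace hUo hU hN hb Metric.isOpen_ball hr hDU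
  have htr : ∀ᵐ y : perp N ∂volume.restrict (Metric.ball 0 (4 * r)),
      HasTrace U w (x₀ + y) (G y) := by
    filter_upwards [hGt, ae_restrict_mem Metric.isOpen_ball.measurableSet] with y hy hyD
    have hyD' : ‖(y : E d)‖ < 4 * r := by simpa using hyD
    refine hy r hr ?_
    have hsub : Metric.ball (x₀ + (y : E d)) r ⊆ Metric.ball x₀ (7 * r) := by
      intro x hx
      rw [mem_ball_iff_norm] at hx ⊢
      calc ‖x - x₀‖ = ‖(x - (x₀ + y)) + y‖ := by congr 1; abel
        _ ≤ ‖x - (x₀ + y)‖ + ‖(y : E d)‖ := norm_add_le _ _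
        _ < 7 * r := by linarith
    have hin : ∀ x : E d, inner ℝ N (x - (x₀ + y)) = inner ℝ N (x - x₀) := by
      intro x
      rw [← sub_sub, inner_sub_right, inner_perp, sub_zero]
    simp only [hin]
    rw [← Set.inter_eq_left.2 hsub, Set.inter_assoc, hhalf, Set.inter_assoc]
  have hGtr : G =ᵐ[volume.restrict (Metric.ball 0 (4 * r))]
      fun y : perp N => trace U w (x₀ + y) := by
    filter_upwards [htr] with y hy using (trace_eq hy).symm
  refine ⟨?_, hG.congr hGtr, fun ψ hψ hψs => ?_⟩
  · filter_upwards [htr] with y hy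
    rwa [trace_eq hy]
  · have hψc : HasCompactSupport ψ :=
      Metric.isBounded_ball.isCompact_closure.of_isClosed_subset (isClosed_tsupport _)
        (hψs.trans subset_closure)
    have hcoord : ∀ (y : perp N) (t : ℝ), obliqueChart x₀ hb (y, t) ∈ Metric.ball x₀ r →
        ‖(y : E d)‖ < 4 * r ∧ |t| < r := by
      intro y t h
      rw [mem_ball_iff_norm] at h
      have h1 : |t| ≤ ‖obliqueChart x₀ hb (y, t) - x₀‖ := by
        have := abs_real_inner_le_norm N (obliqueChart x₀ hb (y, t) - x₀)
        rwa [inner_obliqueChart, abs_neg, hN, one_mul] at this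
      refine ⟨?_, h1.trans_lt h⟩
      have h2 : (y : E d) = (obliqueChart x₀ hb (y, t) - x₀) - t • b := by
        rw [obliqueChart_apply]
        abel
      calc ‖(y : E d)‖ ≤ ‖obliqueChart x₀ hb (y, t) - x₀‖ + |t| * ‖b‖ := by
            conv_lhs => rw [h2]
            refine (norm_sub_le _ _).trans ?_
            rw [norm_smul, Real.norm_eq_abs]
        _ < r + r * 3 := add_lt_add_of_lt_of_le h
            (mul_le_mul (h1.trans h.le) hb3 (norm_nonneg _) hr.le)
        _ = 4 * r := by ring
    rw [hGi ψ hψ hψc ?_ ?_]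
    · congr 1
      refine integral_congr_ae ?_
      filter_upwards [hGtr] with y hy
      rw [hy]
    · intro y t ht hne
      obtain ⟨h1, h2⟩ := hcoord y t (hψs (subset_tsupport _ hne))
      exact ⟨by simpa using h1, (le_abs_self t).trans_lt h2⟩
    · rintro x ⟨hxU, hxψ⟩
      have hx : x ∈ Metric.ball x₀ (7 * r) ∩ U :=
        ⟨Metric.ball_subset_ball (by linarith) (hψs hxψ), hxU⟩
      rw [hhalf] at hx
      refine ⟨(obliqueChart x₀ hb).symm x, ?_, Homeomorph.apply_symm_apply _ x⟩
      have hx0 := hx.2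
      set z := (obliqueChart x₀ hb).symm x with hz
      have hxz : x = obliqueChart x₀ hb z := (Homeomorph.apply_symm_apply _ x).symm
      obtain ⟨h1, h2⟩ := hcoord z.1 z.2 (hxz ▸ hψs hxψ)
      have hx0' : inner ℝ N (x - x₀) < 0 := hx0
      rw [hxz, inner_obliqueChart] at hx0'
      exact ⟨by simpa using h1, by linarith, (le_abs_self _).trans_lt h2⟩

/-- The divergence theorem near a flat piece of the boundary with outward normal `N`, in each
coordinate direction. -/
theorem HasWeakGrad.local_ibp (hw : HasWeakGrad U w g) (hUo : IsOpen U)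
    (hU : volume U ≠ ⊤) (hN : ‖N‖ = 1) {r : ℝ}
    (hr : 0 < r) (hhalf : Metric.ball x₀ (7 * r) ∩ U =
      Metric.ball x₀ (7 * r) ∩ {x | inner ℝ N (x - x₀) < 0}) {ψ : E d → ℝ}
    (hψ : ContDiff ℝ ∞ ψ) (hψs : tsupport ψ ⊆ Metric.ball x₀ r) (j : Fin d) :
    ∫ x in U, (g j x * ψ x + w x * fderiv ℝ ψ x (EuclideanSpace.single j 1)) =
      N j * ∫ y in Metric.ball (0 : perp N) (4 * r), trace U w (x₀ + y) * ψ (x₀ + y) := by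
  have hψc : HasCompactSupport ψ :=
    Metric.isBounded_ball.isCompact_closure.of_isClosed_subset (isClosed_tsupport _)
      (hψs.trans subset_closure)
  set I := ∫ y in Metric.ball (0 : perp N) (4 * r), trace U w (x₀ + y) * ψ (x₀ + y) with hI
  set e : E d := EuclideanSpace.single j 1 with he
  set F : E d → E d → ℝ := fun v x => (∑ i, v i * g i x) * ψ x + w x * fderiv ℝ ψ x v with hF
  have hNj : inner ℝ N e = N j := by simp [he, EuclideanSpace.inner_single_right]
  have hNj1 : |N j| ≤ 1 := by
    have := abs_real_inner_le_norm N e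
    rwa [hNj, hN, one_mul, he, PiLp.norm_single, norm_one] at this
  have hFi : ∀ v, IntegrableOn (F v) U := fun v =>
    (Integrable.mul_of_continuous_compact (hw.integrableOn_dir hU v) hψ.continuous hψc).add
      (Integrable.mul_of_continuous_compact (hw.integrableOn hU) (continuous_fderiv_dir hψ v)
        (hψc.fderiv_apply ℝ v))
  have hlin : ∀ (a : ℝ) (v v' : E d) (x : E d), F (v + a • v') x = F v x + a * F v' x := by
    intro a v v' x
    have h1 : ∑ i, (v + a • v') i * g i x = ∑ i, v i * g i x + a * ∑ i, v' i * g i x := by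
      rw [Finset.mul_sum, ← Finset.sum_add_distrib]
      refine Finset.sum_congr rfl fun i _ => ?_
      simp only [PiLp.add_apply, PiLp.smul_apply, smul_eq_mul]
      ring
    simp only [hF]
    rw [h1, map_add, map_smul, smul_eq_mul]
    ring
  have hilin : ∀ (a : ℝ) (v v' : E d), ∫ x in U, F (v + a • v') x =
      (∫ x in U, F v x) + a * ∫ x in U, F v' x := by
    intro a v v'
    simp only [hlin]
    rw [integral_add (hFi v) ((hFi v').const_mul a), integral_const_mul]
  -- Two transversal directions, the second one normal, whose span contains `e`.
  have hpos : 0 < N j + 2 := by linarith [(abs_le.1 hNj1).1]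
  set b₁ : E d := -((N j + 2)⁻¹ • (e + (2 : ℝ) • N)) with hb₁
  have hNN : inner ℝ N N = (1 : ℝ) := by rw [real_inner_self_eq_norm_sq, hN]; norm_num
  have hb1 : inner ℝ N b₁ = -1 := by
    rw [hb₁, inner_neg_right, inner_smul_right, inner_add_right, inner_smul_right, hNj, hNN]
    field_simp
  have hb13 : ‖b₁‖ ≤ 3 := by
    have h2 : (N j + 2)⁻¹ ≤ 1 := inv_le_one_of_one_le₀ (by linarith [(abs_le.1 hNj1).1])
    rw [hb₁, norm_neg, norm_smul, Real.norm_of_nonneg (inv_nonneg.2 hpos.le)]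
    calc (N j + 2)⁻¹ * ‖e + (2 : ℝ) • N‖ ≤ 1 * ‖e + (2 : ℝ) • N‖ := by gcongr
      _ ≤ ‖e‖ + ‖(2 : ℝ) • N‖ := by rw [one_mul]; exact norm_add_le _ _
      _ = 3 := by
        rw [norm_smul, hN, he, PiLp.norm_single, norm_one]
        norm_num
  have hb2 : inner ℝ N (-N) = (-1 : ℝ) := by rw [inner_neg_right, hNN]
  have k1 := (hw.local_transversal hUo hU hN hb1 hb13 hr hhalf).2.2 ψ hψ hψs
  have k2 := (hw.local_transversal hUo hU hN hb2 (by rw [norm_neg, hN]; norm_num) hr hhalf).2.2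
    ψ hψ hψs
  have k0 : ∫ x in U, F 0 x = 0 := by simp [hF]
  have hdec : e = (0 + (2 : ℝ) • (-N)) + (-(N j + 2)) • b₁ := by
    have : (-(N j + 2)) • b₁ = e + (2 : ℝ) • N := by
      rw [hb₁, smul_neg, neg_smul, neg_neg, smul_smul, mul_inv_cancel₀ hpos.ne', one_smul]
    rw [this]
    module
  have hFe : ∀ x, F e x = g j x * ψ x + w x * fderiv ℝ ψ x e := by
    intro x
    simp [hF, he, PiLp.single_apply]
  calc ∫ x in U, (g j x * ψ x + w x * fderiv ℝ ψ x e) = ∫ x in U, F e x := by simp only [hFe]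
    _ = 0 + 2 * (-I) + (-(N j + 2)) * (-I) := by
      conv_lhs => rw [hdec]
      rw [hilin, hilin, k0]
      simp only [hF]
      rw [k1, k2]
    _ = N j * I := by ring

end BaseTrace

theorem volume_setOf_inner_eq {Y : Type*} [NormedAddCommGroup Y] [InnerProductSpace ℝ Y]
    [FiniteDimensional ℝ Y] [MeasurableSpace Y] [BorelSpace Y] {c : Y} (hc : c ≠ 0) (k : ℝ) :
    volume {y : Y | inner ℝ c y = k} = 0 := by
  rcases Set.eq_empty_or_nonempty {y : Y | inner ℝ c y = k} with h | ⟨y₀, hy₀⟩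
  · rw [h, measure_empty]
  · have hsub : {y : Y | inner ℝ c y = k} ⊆ (AffineSubspace.mk' y₀ (perp c) : Set Y) := by
      intro y hy
      rw [SetLike.mem_coe, AffineSubspace.mem_mk', vsub_eq_sub,
        Submodule.mem_orthogonal_singleton_iff_inner_right, inner_sub_right,
        show inner ℝ c y = k from hy, show inner ℝ c y₀ = k from hy₀, sub_self]
    refine measure_mono_null hsub (Measure.addHaar_affineSubspace _ _ fun htop => hc ?_)
    have h1 : c + y₀ ∈ AffineSubspace.mk' y₀ (perp c) := htop ▸ AffineSubspace.mem_top ℝ Y _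
    rw [AffineSubspace.mem_mk', vsub_eq_sub, add_sub_cancel_right,
      Submodule.mem_orthogonal_singleton_iff_inner_right] at h1
    exact inner_self_eq_zero.1 h1

/-! ### The hyperplane of a face -/

section Face

variable {d : ℕ} {F : Affine.Simplex ℝ (E d) (d - 1)} {N : E d}

/-- The isometric embedding of the hyperplane through `x₀` orthogonal to `N`. -/
noncomputable def planeEmb (N x₀ : E d) (y : perp N) : E d := x₀ + y

theorem isometry_planeEmb (N x₀ : E d) : Isometry (planeEmb N x₀) :=
  (IsometryEquiv.addLeft x₀).isometry.comp isometry_subtype_coe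

theorem measurableEmbedding_planeEmb (N x₀ : E d) : MeasurableEmbedding (planeEmb N x₀) :=
  (isometry_planeEmb N x₀).isClosedEmbedding.measurableEmbedding

theorem finrank_perp (hd : 1 ≤ d) (hN : ‖N‖ = 1) : Module.finrank ℝ (perp N) = d - 1 := by
  have : Fact (Module.finrank ℝ (E d) = (d - 1) + 1) :=
    ⟨by rw [finrank_euclideanSpace_fin]; omega⟩
  exact Submodule.finrank_orthogonal_span_singleton (by rintro rfl; simp at hN)

/-- The vertices of a face, seen from its first vertex, form an affine basis of the hyperplane
orthogonal to the normal. -/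
theorem exists_faceBasis (hd : 1 ≤ d) (hN : ‖N‖ = 1)
    (hNF : ∀ a b, inner ℝ N (F.points a - F.points b) = 0) :
    ∃ B : AffineBasis (Fin (d - 1 + 1)) ℝ (perp N),
      ∀ i, F.points i = planeEmb N (F.points 0) (B i) := by
  set q : Fin (d - 1 + 1) → perp N := fun i => ⟨F.points i - F.points 0,
    Submodule.mem_orthogonal_singleton_iff_inner_right.2 (hNF i 0)⟩ with hq
  set e : perp N →ᵃ[ℝ] E d := AffineMap.const ℝ _ (F.points 0) + (perp N).subtype.toAffineMap
    with he
  have heq : ∀ y, e y = F.points 0 + y := fun y => rfl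
  have hinj : Function.Injective e := by
    intro y y' h
    rw [heq, heq] at h
    exact Subtype.ext (add_left_cancel h)
  have hcomp : e ∘ q = F.points := by
    ext1 i
    rw [Function.comp_apply, heq]
    simp [hq]
  have hind : AffineIndependent ℝ q := by
    rw [← e.affineIndependent_iff hinj, hcomp]
    exact F.independent
  have hspan : affineSpan ℝ (Set.range q) = ⊤ := by
    rw [hind.affineSpan_eq_top_iff_card_eq_finrank_add_one, Fintype.card_fin, finrank_perp hd hN]
  refine ⟨⟨q, hind, hspan⟩, fun i => ?_⟩
  change F.points i = F.points 0 + (F.points i - F.points 0)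
  abel

variable {B : AffineBasis (Fin (d - 1 + 1)) ℝ (perp N)}

theorem affineCombination_face (hB : ∀ i, F.points i = planeEmb N (F.points 0) (B i))
    {w : Fin (d - 1 + 1) → ℝ} (hw : ∑ i, w i = 1) :
    Finset.univ.affineCombination ℝ F.points w =
      planeEmb N (F.points 0) (Finset.univ.affineCombination ℝ B w) := by
  rw [Finset.affineCombination_eq_linear_combination _ _ _ hw,
    Finset.affineCombination_eq_linear_combination _ _ _ hw, planeEmb]
  have : ∀ i, w i • F.points i = w i • F.points 0 + w i • (B i : E d) := fun i => by
    rw [← smul_add]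
    exact congrArg _ (hB i)
  rw [Finset.sum_congr rfl fun i _ => this i, Finset.sum_add_distrib, ← Finset.sum_smul, hw,
    one_smul]
  simp

theorem planeEmb_eq_sum (hB : ∀ i, F.points i = planeEmb N (F.points 0) (B i)) (y : perp N) :
    planeEmb N (F.points 0) y = ∑ i, B.coord i y • F.points i := by
  have hw : ∑ i, B.coord i y = 1 := B.sum_coord_apply_eq_one y
  rw [← Finset.affineCombination_eq_linear_combination _ _ _ hw, affineCombination_face hB hw,
    B.affineCombination_coord_eq_self]

theorem mem_setInterior_iff (hB : ∀ i, F.points i = planeEmb N (F.points 0) (B i)) {I : Set ℝ}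
    {x : E d} : x ∈ F.setInterior I ↔
      ∃ y, x = planeEmb N (F.points 0) y ∧ ∀ i, B.coord i y ∈ I := by
  constructor
  · rintro ⟨w, hw, hwI, rfl⟩
    refine ⟨_, affineCombination_face hB hw, fun i => ?_⟩
    rw [B.coord_apply_combination_of_mem (Finset.mem_univ i) hw]
    exact hwI i
  · rintro ⟨y, rfl, hy⟩
    refine ⟨fun i => B.coord i y, B.sum_coord_apply_eq_one y, hy, ?_⟩
    rw [affineCombination_face hB (B.sum_coord_apply_eq_one y), B.affineCombination_coord_eq_self]

theorem planeEmb_mem_setInterior_iff (hB : ∀ i, F.points i = planeEmb N (F.points 0) (B i))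
    {I : Set ℝ} {y : perp N} :
    planeEmb N (F.points 0) y ∈ F.setInterior I ↔ ∀ i, B.coord i y ∈ I := by
  rw [mem_setInterior_iff hB]
  constructor
  · rintro ⟨y', h, h'⟩
    rwa [(isometry_planeEmb N _).injective h]
  · exact fun h => ⟨y, rfl, h⟩

theorem isOpen_preimage_interior (hB : ∀ i, F.points i = planeEmb N (F.points 0) (B i)) :
    IsOpen (planeEmb N (F.points 0) ⁻¹' F.interior) := by
  have : planeEmb N (F.points 0) ⁻¹' F.interior = ⋂ i, B.coord i ⁻¹' Set.Ioo 0 1 := by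
    ext y
    rw [Set.mem_preimage, Affine.Simplex.interior, planeEmb_mem_setInterior_iff hB]
    simp
  rw [this]
  exact isOpen_iInter_of_finite fun i =>
    isOpen_Ioo.preimage (AffineMap.continuous_of_finiteDimensional (B.coord i))

/-- The point of the hyperplane of a face lies in the relative boundary of the face only if one of
its barycentric coordinates vanishes. -/
theorem exists_coord_eq_zero (hd : 2 ≤ d) (hB : ∀ i, F.points i = planeEmb N (F.points 0) (B i))
    {y : perp N} (h1 : planeEmb N (F.points 0) y ∈ F.closedInterior)
    (h2 : planeEmb N (F.points 0) y ∉ F.interior) : ∃ i, B.coord i y = 0 := by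
  rw [Affine.Simplex.closedInterior, planeEmb_mem_setInterior_iff hB] at h1
  rw [Affine.Simplex.interior, planeEmb_mem_setInterior_iff hB] at h2
  by_contra! hne
  have hpos : ∀ i, 0 < B.coord i y := fun i => lt_of_le_of_ne (h1 i).1 (hne i).symm
  refine h2 fun i => ⟨hpos i, ?_⟩
  have : Nontrivial (Fin (d - 1 + 1)) := Fin.nontrivial_iff_two_le.2 (by omega)
  obtain ⟨j, hj⟩ := exists_ne i
  have hsum := B.sum_coord_apply_eq_one y
  have : B.coord i y + B.coord j y ≤ ∑ k, B.coord k y := by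
    rw [← Finset.sum_pair (f := fun k => B.coord k y) hj.symm]
    exact Finset.sum_le_sum_of_subset_of_nonneg (Finset.subset_univ _) fun k _ _ => (hpos k).le
  linarith [hpos j]

/-- A barycentric coordinate is a non-constant affine function. -/
theorem exists_coord_eq_inner (hd : 2 ≤ d) (B : AffineBasis (Fin (d - 1 + 1)) ℝ (perp N))
    (i : Fin (d - 1 + 1)) :
    ∃ (c : perp N) (k : ℝ), c ≠ 0 ∧ ∀ y, B.coord i y = inner ℝ c y + k := by
  set L : perp N →L[ℝ] ℝ := LinearMap.toContinuousLinearMap (B.coord i).linear with hL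
  set c := (InnerProductSpace.toDual ℝ (perp N)).symm L with hc
  have hcy : ∀ y, B.coord i y = inner ℝ c y + B.coord i 0 := by
    intro y
    rw [hc, InnerProductSpace.toDual_symm_apply, hL]
    have := (B.coord i).map_vadd 0 y
    simpa using this
  refine ⟨c, B.coord i 0, fun h0 => ?_, hcy⟩
  have : Nontrivial (Fin (d - 1 + 1)) := Fin.nontrivial_iff_two_le.2 (by omega)
  obtain ⟨j, hj⟩ := exists_ne i
  have h1 := hcy (B i)
  have h2 := hcy (B j)
  rw [B.coord_apply_eq, h0, inner_zero_left] at h1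
  rw [B.coord_apply_ne hj.symm, h0, inner_zero_left] at h2
  linarith

/-- The surface measure on a face is Lebesgue measure in its hyperplane. -/
theorem restrict_euclideanHausdorffMeasure_face (hd : 1 ≤ d) (hN : ‖N‖ = 1)
    (hB : ∀ i, F.points i = planeEmb N (F.points 0) (B i)) :
    (μHE[d - 1] : Measure (E d)).restrict F.closedInterior =
      (volume.restrict (planeEmb N (F.points 0) ⁻¹' F.closedInterior)).map
        (planeEmb N (F.points 0)) := by
  have hsub : F.closedInterior ⊆ Set.range (planeEmb N (F.points 0)) := by
    intro x hx
    obtain ⟨y, hy, -⟩ := (mem_setInterior_iff hB).1 hx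
    exact ⟨y, hy.symm⟩
  have h1 : (volume : Measure (perp N)).map (planeEmb N (F.points 0)) =
      (μHE[d - 1] : Measure (E d)).restrict (Set.range (planeEmb N (F.points 0))) := by
    have h := InnerProductSpace.euclideanHausdorffMeasure_eq_volume (V := perp N)
    rw [finrank_perp hd hN] at h
    rw [← (isometry_planeEmb N (F.points 0)).map_euclideanHausdorffMeasure, h]
  rw [← (measurableEmbedding_planeEmb N (F.points 0)).restrict_map, h1,
    Measure.restrict_restrict_of_subset hsub]

end Face

/-! ### Faces and their relative boundaries -/

section Simplex

variable {d : ℕ} {F : Affine.Simplex ℝ (E d) (d - 1)} {N : E d}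

theorem nonempty_interior_simplex {n : ℕ} (hn : 1 ≤ n) (F : Affine.Simplex ℝ (E d) n) :
    F.interior.Nonempty := by
  have hn' : (1 : ℝ) ≤ n := mod_cast hn
  refine ⟨_, fun _ => ((n : ℝ) + 1)⁻¹, ?_, fun i => ⟨by positivity, ?_⟩, rfl⟩
  · rw [Finset.sum_const, Finset.card_univ, Fintype.card_fin, nsmul_eq_mul]
    push_cast
    field_simp
  · exact inv_lt_one_of_one_lt₀ (by linarith)

theorem inner_planeEmb_sub (x₀ : E d) (y y' : perp N) :
    inner ℝ N (planeEmb N x₀ y - planeEmb N x₀ y') = 0 := by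
  rw [planeEmb, planeEmb, add_sub_add_left_eq_sub, inner_sub_right, inner_perp, inner_perp,
    sub_zero]

theorem exists_planeEmb_eq {x x₀ : E d} (h : inner ℝ N (x - x₀) = 0) :
    ∃ y, x = planeEmb N x₀ y :=
  ⟨⟨x - x₀, Submodule.mem_orthogonal_singleton_iff_inner_right.2 h⟩, by simp [planeEmb]⟩

/-- The interior of a face is relatively open in the hyperplane of the face. -/
theorem exists_ball_subset_interior (hd : 1 ≤ d) (hN : ‖N‖ = 1)
    (hNF : ∀ a b, inner ℝ N (F.points a - F.points b) = 0) {x : E d} (hx : x ∈ F.interior) :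
    ∃ r > 0, ∀ x' ∈ Metric.ball x r, inner ℝ N (x' - x) = 0 → x' ∈ F.interior := by
  obtain ⟨B, hB⟩ := exists_faceBasis hd hN hNF
  obtain ⟨y, rfl, -⟩ := (mem_setInterior_iff hB).1 hx
  obtain ⟨r, hr, hsub⟩ := Metric.isOpen_iff.1 (isOpen_preimage_interior hB) y hx
  refine ⟨r, hr, fun x' hx' h => ?_⟩
  have h2 : inner ℝ N (x' - F.points 0) = 0 := by
    have h3 : inner ℝ N (planeEmb N (F.points 0) y - F.points 0) = 0 := by
      rw [planeEmb, add_sub_cancel_left, inner_perp]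
    rw [← sub_add_sub_cancel x' (planeEmb N (F.points 0) y), inner_add_right, h, h3, add_zero]
  obtain ⟨y', rfl⟩ := exists_planeEmb_eq h2
  rw [Metric.mem_ball, (isometry_planeEmb N _).dist_eq] at hx'
  exact hsub hx'

/-- The points of the hyperplane of a face at which a given barycentric coordinate vanishes lie in a
flat of codimension two. -/
theorem exists_flat_of_coord (hd : 2 ≤ d) (x₀ : E d) (B : AffineBasis (Fin (d - 1 + 1)) ℝ (perp N))
    (i : Fin (d - 1 + 1)) :
    ∃ (n : E d) (s : ℝ), ‖n‖ = 1 ∧ inner ℝ N n = 0 ∧ ∀ y, B.coord i y = 0 →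
      inner ℝ N (planeEmb N x₀ y) = inner ℝ N x₀ ∧ inner ℝ n (planeEmb N x₀ y) = s := by
  obtain ⟨c, k, hc, hck⟩ := exists_coord_eq_inner hd B i
  have hc' : ‖(c : E d)‖ ≠ 0 := by simpa using hc
  refine ⟨‖(c : E d)‖⁻¹ • (c : E d), ‖(c : E d)‖⁻¹ * (inner ℝ (c : E d) x₀ - k), ?_, ?_,
    fun y hy => ⟨?_, ?_⟩⟩
  · rw [norm_smul, norm_inv, norm_norm, inv_mul_cancel₀ hc']
  · rw [inner_smul_right, inner_perp, mul_zero]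
  · rw [planeEmb, inner_add_right, inner_perp, add_zero]
  · rw [hck] at hy
    rw [planeEmb, real_inner_smul_left, inner_add_right, ← Submodule.coe_inner]
    congr 1
    linarith

/-- A flat of codimension two has no surface measure. -/
theorem euclideanHausdorffMeasure_face_flat (hd : 1 ≤ d) (hN : ‖N‖ = 1)
    (hNF : ∀ a b, inner ℝ N (F.points a - F.points b) = 0) {n₁ n₂ : E d} (h1 : ‖n₁‖ = 1)
    (h2 : ‖n₂‖ = 1) (h12 : inner ℝ n₁ n₂ = 0) (s₁ s₂ : ℝ) :
    ∀ᵐ x ∂(μHE[d - 1] : Measure (E d)).restrict F.closedInterior,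
      ¬ (inner ℝ n₁ x = s₁ ∧ inner ℝ n₂ x = s₂) := by
  obtain ⟨B, hB⟩ := exists_faceBasis hd hN hNF
  rw [restrict_euclideanHausdorffMeasure_face hd hN hB,
    (measurableEmbedding_planeEmb N _).ae_map_iff]
  refine ae_restrict_of_ae ?_
  have hNN : inner ℝ N N = (1 : ℝ) := by rw [real_inner_self_eq_norm_sq, hN]; norm_num
  -- One of the two normals is not parallel to `N`.
  have key : ∀ (n : E d) (s : ℝ), n - (inner ℝ N n : ℝ) • N ≠ 0 →
      ∀ᵐ y : perp N, ¬ inner ℝ n (planeEmb N (F.points 0) y) = s := by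
    intro n s hn
    set c : perp N := ⟨n - (inner ℝ N n : ℝ) • N, by
      rw [Submodule.mem_orthogonal_singleton_iff_inner_right, inner_sub_right, inner_smul_right,
        hNN, mul_one, sub_self]⟩ with hc
    have hc0 : c ≠ 0 := fun h => hn (congrArg Subtype.val h)
    have h0 := volume_setOf_inner_eq hc0 (s - inner ℝ n (F.points 0))
    rw [measure_eq_zero_iff_ae_notMem] at h0
    filter_upwards [h0] with y hy h
    apply hy
    change inner ℝ (c : E d) (y : E d) = _
    rw [hc, inner_sub_left, real_inner_smul_left, inner_perp, mul_zero, sub_zero]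
    rw [planeEmb, inner_add_right] at h
    linarith
  by_cases hn1 : n₁ - (inner ℝ N n₁ : ℝ) • N = 0
  · have hn2 : n₂ - (inner ℝ N n₂ : ℝ) • N ≠ 0 := by
      intro hn2
      rw [sub_eq_zero] at hn1 hn2
      have e1 : inner ℝ N n₁ ≠ (0 : ℝ) := fun h => by
        rw [hn1, h, zero_smul, norm_zero] at h1
        exact zero_ne_one h1
      have e2 : inner ℝ N n₂ ≠ (0 : ℝ) := fun h => by
        rw [hn2, h, zero_smul, norm_zero] at h2
        exact zero_ne_one h2
      rw [hn1, hn2, inner_smul_right, real_inner_smul_left, hNN] at h12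
      simp [e1, e2] at h12
    filter_upwards [key n₂ s₂ hn2] with y hy h using hy h.2
  · filter_upwards [key n₁ s₁ hn1] with y hy h using hy h.1

/-- The integral over a face of a function supported near an interior point. -/
theorem integral_disc_eq_integral_face (hd : 1 ≤ d) (hN : ‖N‖ = 1)
    (hNF : ∀ a b, inner ℝ N (F.points a - F.points b) = 0) {x₀ : E d} (hx₀ : x₀ ∈ F.interior)
    {r R : ℝ} (h2 : ∀ x' ∈ Metric.ball x₀ r, inner ℝ N (x' - x₀) = 0 → x' ∈ F.interior)
    (hR : r ≤ R) {f : E d → ℝ} (hf : ∀ x, x ∉ Metric.ball x₀ r → f x = 0) :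
    ∫ y in Metric.ball (0 : perp N) R, f (x₀ + y) =
      ∫ x, f x ∂(μHE[d - 1] : Measure (E d)).restrict F.closedInterior := by
  obtain ⟨B, hB⟩ := exists_faceBasis hd hN hNF
  obtain ⟨y₀, hy₀⟩ : ∃ y₀, x₀ = planeEmb N (F.points 0) y₀ := by
    obtain ⟨y₀, h, -⟩ := (mem_setInterior_iff hB).1 hx₀
    exact ⟨y₀, h⟩
  have e1 : ∫ y in Metric.ball (0 : perp N) R, f (x₀ + y) = ∫ y : perp N, f (x₀ + y) := by
    refine setIntegral_eq_integral_of_forall_compl_eq_zero fun y hy => hf _ fun h => hy ?_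
    rw [mem_ball_iff_norm, add_sub_cancel_left] at h
    rw [mem_ball_zero_iff]
    exact lt_of_lt_of_le h hR
  have e2 : ∀ y : perp N, x₀ + (y : E d) = planeEmb N (F.points 0) (y₀ + y) := by
    intro y
    rw [hy₀, planeEmb, planeEmb, Submodule.coe_add, add_assoc]
  have e3 : ∫ y in planeEmb N (F.points 0) ⁻¹' F.closedInterior, f (planeEmb N (F.points 0) y) =
      ∫ y : perp N, f (planeEmb N (F.points 0) y) := by
    refine setIntegral_eq_integral_of_forall_compl_eq_zero fun y hy => hf _ fun h => hy ?_
    have h0 : inner ℝ N (planeEmb N (F.points 0) y - x₀) = 0 := by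
      rw [hy₀]
      exact inner_planeEmb_sub _ _ _
    have h3 : planeEmb N (F.points 0) y ∈ F.interior := h2 _ h h0
    exact Set.mem_preimage.2 (F.interior_subset_closedInterior h3)
  have e4 : ∫ y : perp N, f (planeEmb N (F.points 0) (y₀ + y)) =
      ∫ y : perp N, f (planeEmb N (F.points 0) y) :=
    integral_add_left_eq_self (fun y => f (planeEmb N (F.points 0) y)) y₀
  have e5 : ∫ x, f x ∂(μHE[d - 1] : Measure (E d)).restrict F.closedInterior =
      ∫ y in planeEmb N (F.points 0) ⁻¹' F.closedInterior, f (planeEmb N (F.points 0) y) := by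
    rw [restrict_euclideanHausdorffMeasure_face hd hN hB]
    exact (measurableEmbedding_planeEmb N (F.points 0)).integral_map f
  rw [e1, e5, e3, ← e4]
  exact integral_congr_ae (ae_of_all _ fun y => congrArg f (e2 y))

end Simplex

/-! ### Elements near their faces -/

section Mesh

variable {d : ℕ} {Ω : Set (E d)} (T : PolytopicMesh Ω)

/-- The unit normal on the face `F` which points out of the element `K`. -/
noncomputable def outward (K : Fin T.numElem) (F : Fin T.numFace) : E d :=
  if T.plus F = K then T.normal F else -T.normal F

variable {T} {K : Fin T.numElem} {F : Fin T.numFace}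

theorem norm_outward : ‖outward T K F‖ = 1 := by
  rw [outward]
  split_ifs
  · exact T.norm_normal F
  · rw [norm_neg, T.norm_normal F]

theorem outward_orthogonal (a b) :
    inner ℝ (outward T K F) ((T.face F).points a - (T.face F).points b) = 0 := by
  rw [outward]
  split_ifs
  · exact T.normal_orthogonal F a b
  · rw [inner_neg_left, T.normal_orthogonal F a b, neg_zero]

/-- Near an interior point of one of its faces, an element is a half-ball with the outward normal of
that face. -/
theorem exists_ball_inter_elem (hF : T.IsFaceOf F K) {x : E d} (hx : x ∈ (T.face F).interior) :
    ∃ r > 0, Metric.ball x r ∩ T.elem K =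
      Metric.ball x r ∩ {y | inner ℝ (outward T K F) (y - x) < 0} := by
  rw [outward]
  split_ifs with h
  · subst h
    exact T.plus_side F x hx
  · obtain ⟨-, r, hr, h'⟩ := T.minus_side F K (hF.resolve_left h) x hx
    refine ⟨r, hr, ?_⟩
    simpa only [inner_neg_left, neg_lt_zero] using h'

theorem half_ball_mono {U H : Set (E d)} {x : E d} {r s : ℝ} (hrs : s ≤ r)
    (h : Metric.ball x r ∩ U = Metric.ball x r ∩ H) :
    Metric.ball x s ∩ U = Metric.ball x s ∩ H := by
  rw [← Set.inter_eq_left.2 (Metric.ball_subset_ball hrs), Set.inter_assoc, h, Set.inter_assoc]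

/-- The two sides of an interior face are different elements: a half-ball is not its reflection. -/
theorem plus_ne_of_minus_eq (hd : 2 ≤ d) (h : T.minus F = some K) : T.plus F ≠ K := by
  rintro rfl
  obtain ⟨x, hx⟩ := nonempty_interior_simplex (by omega) (T.face F)
  obtain ⟨r, hr, h1⟩ := T.plus_side F x hx
  obtain ⟨-, r', hr', h2⟩ := T.minus_side F _ h x hx
  have h1' := half_ball_mono (min_le_left r r') h1
  rw [half_ball_mono (min_le_right r r') h2] at h1'
  set s := min r r' / 2 with hs
  have hs0 : 0 < s := half_pos (lt_min hr hr')
  have hmem : x + s • T.normal F ∈ Metric.ball x (min r r') ∩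
      {y | 0 < inner ℝ (T.normal F) (y - x)} := by
    refine ⟨?_, ?_⟩
    · rw [mem_ball_iff_norm, add_sub_cancel_left, norm_smul, T.norm_normal, mul_one,
        Real.norm_of_nonneg hs0.le]
      exact half_lt_self (lt_min hr hr')
    · change 0 < inner ℝ (T.normal F) (x + s • T.normal F - x)
      rw [add_sub_cancel_left, inner_smul_right, real_inner_self_eq_norm_sq, T.norm_normal]
      simpa using hs0
  have hpos : 0 < inner ℝ (T.normal F) (x + s • T.normal F - x) := hmem.2
  rw [h1'] at hmem
  exact lt_asymm hpos hmem.2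

/-- The relative boundary of a face has no surface measure. -/
theorem ae_mem_interior (hd : 2 ≤ d) : ∀ᵐ x ∂T.faceMeasure F, x ∈ (T.face F).interior := by
  have hN := T.norm_normal F
  obtain ⟨B, hB⟩ := exists_faceBasis (by omega) hN (T.normal_orthogonal F)
  have hflat : ∀ᵐ x ∂T.faceMeasure F, ∀ i, ¬ ∃ y, x = planeEmb _ ((T.face F).points 0) y ∧
      B.coord i y = 0 := by
    refine ae_all_iff.2 fun i => ?_
    obtain ⟨n, s, hn, hNn, hy⟩ := exists_flat_of_coord hd ((T.face F).points 0) B i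
    filter_upwards [euclideanHausdorffMeasure_face_flat (by omega) hN (T.normal_orthogonal F) hN hn
      hNn (inner ℝ (T.normal F) ((T.face F).points 0)) s] with x hx h
    obtain ⟨y, rfl, hy0⟩ := h
    exact hx (hy y hy0)
  filter_upwards [hflat, ae_restrict_mem (T.face F).isClosed_closedInterior.measurableSet]
    with x hx hxF
  by_contra hne
  obtain ⟨y, rfl, -⟩ := (mem_setInterior_iff hB).1 hxF
  obtain ⟨i, hi⟩ := exists_coord_eq_zero hd hB hxF hne
  exact hx i ⟨y, rfl, hi⟩

theorem elem_measure_ne_top (hΩ : Bornology.IsBounded Ω) : volume (T.elem K) ≠ ⊤ :=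
  (hΩ.subset (T.elem_subset K)).measure_lt_top.ne

/-- The divergence theorem near an interior point of a face. -/
theorem exists_local_ibp (hd : 2 ≤ d) (hΩ : Bornology.IsBounded Ω) (hF : T.IsFaceOf F K)
    {x₀ : E d} (hx₀ : x₀ ∈ (T.face F).interior) :
    ∃ r > 0, ∀ (w : E d → ℝ) (g : Fin d → E d → ℝ), HasWeakGrad (T.elem K) w g →
      ∀ ψ : E d → ℝ, ContDiff ℝ ∞ ψ → tsupport ψ ⊆ Metric.ball x₀ r → ∀ j,
        ∫ x in T.elem K, (g j x * ψ x + w x * fderiv ℝ ψ x (EuclideanSpace.single j 1)) =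
          outward T K F j * ∫ x, trace (T.elem K) w x * ψ x ∂T.faceMeasure F := by
  set N := outward T K F with hNdef
  have hN : ‖N‖ = 1 := norm_outward
  have hNF := outward_orthogonal (T := T) (K := K) (F := F)
  obtain ⟨B, hB⟩ := exists_faceBasis (by omega) hN hNF
  obtain ⟨r₁, hr₁, h1⟩ := exists_ball_inter_elem hF hx₀
  obtain ⟨r₂, hr₂, h2⟩ := exists_ball_subset_interior (by omega) hN hNF hx₀
  set r := min (r₁ / 7) r₂ with hr
  have hr0 : 0 < r := lt_min (by positivity) hr₂
  have h7 : 7 * r ≤ r₁ := by linarith [min_le_left (r₁ / 7) r₂]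
  refine ⟨r, hr0, fun w g hw ψ hψ hψs j => ?_⟩
  rw [hw.local_ibp (T.isOpen_elem K) (elem_measure_ne_top hΩ) hN hr0 (half_ball_mono h7 h1) hψ hψs]
  congr 1
  refine integral_disc_eq_integral_face (f := fun x => trace (T.elem K) w x * ψ x) (by omega)
    hN hNF hx₀
    (fun x' hx' => h2 x' (Metric.ball_subset_ball (min_le_right _ _) hx')) (by linarith)
    (fun x hx => ?_)
  rw [image_eq_zero_of_notMem_tsupport fun h => hx (hψs h), mul_zero]

end Mesh

/-! ### Traces on the faces of a polytopic-regular mesh -/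

section Traces

variable {d : ℕ}

/-- A `d`-simplex `τ` with face `F` contains the segments which start at a point of `F` and run
parallel to the edge from the vertex `F i` to the apex, as long as the `i`-th barycentric coordinate
allows. -/
theorem exists_apex (hd : 2 ≤ d) {F : Affine.Simplex ℝ (E d) (d - 1)} {N : E d}
    {B : AffineBasis (Fin (d - 1 + 1)) ℝ (perp N)}
    (hB : ∀ i, F.points i = planeEmb N (F.points 0) (B i)) (τ : Affine.Simplex ℝ (E d) d)
    (hτ : Set.range F.points ⊆ Set.range τ.points) :
    ∃ a : E d, ∀ (y : perp N) (i : Fin (d - 1 + 1)) (t : ℝ), (∀ k, B.coord k y ∈ Set.Ioo 0 1) →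
      0 < t → t < B.coord i y →
        planeEmb N (F.points 0) y + t • (a - F.points i) ∈ τ.interior := by
  have hf : ∀ k, ∃ j, τ.points j = F.points k := fun k => hτ ⟨k, rfl⟩
  choose f hf using hf
  have hfinj : Function.Injective f := by
    intro k k' h
    apply F.independent.injective
    rw [← hf k, ← hf k', h]
  have hns : ¬ Function.Surjective f := by
    intro hs
    have := Fintype.card_le_of_surjective f hs
    simp only [Fintype.card_fin] at this
    omega
  obtain ⟨j₀, hj₀⟩ : ∃ j₀, ∀ k, f k ≠ j₀ := by
    by_contra! h
    exact hns h
  set φ : Option (Fin (d - 1 + 1)) → Fin (d + 1) := fun o => o.elim j₀ f with hφ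
  have hφinj : Function.Injective φ := by
    rintro (_ | k) (_ | k') h
    · rfl
    · exact absurd h.symm (hj₀ k')
    · exact absurd h (hj₀ k)
    · exact congrArg some (hfinj h)
  have hφbij : Function.Bijective φ := by
    rw [Fintype.bijective_iff_injective_and_card]
    refine ⟨hφinj, ?_⟩
    rw [Fintype.card_option, Fintype.card_fin, Fintype.card_fin]
    omega
  set e := Equiv.ofBijective φ hφbij with he
  refine ⟨τ.points j₀, fun y i t hy ht hti => ?_⟩
  set W' : Option (Fin (d - 1 + 1)) → ℝ :=
    fun o => o.elim t fun k => B.coord k y - if k = i then t else 0 with hW'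
  have hsum' : ∑ o, W' o = 1 := by
    rw [Fintype.sum_option]
    simp only [hW', Option.elim]
    rw [Finset.sum_sub_distrib, B.sum_coord_apply_eq_one]
    simp
  have hsum : ∑ j, W' (e.symm j) = 1 := by rw [Equiv.sum_comp e.symm W', hsum']
  refine ⟨fun j => W' (e.symm j), hsum, fun j => ?_, ?_⟩
  · change W' (e.symm j) ∈ Set.Ioo (0 : ℝ) 1
    generalize e.symm j = o
    rcases o with _ | k
    · exact ⟨ht, hti.trans (hy i).2⟩
    · simp only [hW', Option.elim]
      split_ifs with h
      · subst h
        exact ⟨by linarith, by linarith [(hy k).2]⟩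
      · rw [sub_zero]
        exact hy k
  · rw [Finset.affineCombination_eq_linear_combination _ _ _ hsum]
    have h1 : ∑ j, W' (e.symm j) • τ.points j = ∑ o, W' o • τ.points (e o) := by
      rw [← Equiv.sum_comp e.symm fun o => W' o • τ.points (e o)]
      simp
    rw [h1, Fintype.sum_option]
    have h2 : ∀ k, τ.points (e (some k)) = F.points k := hf
    have h3 : e none = j₀ := rfl
    simp only [h2, h3, hW', Option.elim, sub_smul, Finset.sum_sub_distrib, ite_smul, zero_smul]
    rw [← planeEmb_eq_sum hB]
    simp only [Finset.sum_ite_eq', Finset.mem_univ, if_true]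
    rw [smul_sub]
    abel

variable {Ω : Set (E d)} {T : PolytopicMesh Ω} {K : Fin T.numElem} {F : Fin T.numFace}

/-- On each face of a polytopic-regular mesh, the traces of an `H^1` function exist almost
everywhere and are integrable. The face is covered by the regions on which the `i`-th barycentric
coordinate is not small; there, the cylinder in the direction from the `i`-th vertex to the apex of
the simplex provided by the regularity of the mesh stays in the element. -/
theorem HasWeakGrad.ae_hasTrace_and_integrable (hd : 2 ≤ d) (hΩ : Bornology.IsBounded Ω) {c : ℝ}
    (hreg : T.PolytopicRegular c) (hF : T.IsFaceOf F K) {w : E d → ℝ} {g : Fin d → E d → ℝ}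
    (hw : HasWeakGrad (T.elem K) w g) :
    (∀ᵐ x ∂T.faceMeasure F, HasTrace (T.elem K) w x (trace (T.elem K) w x)) ∧
      Integrable (trace (T.elem K) w) (T.faceMeasure F) := by
  obtain ⟨N, hNdef⟩ : ∃ N, N = outward T K F := ⟨_, rfl⟩
  have hN : ‖N‖ = 1 := hNdef ▸ norm_outward
  have hNF : ∀ a b, inner ℝ N ((T.face F).points a - (T.face F).points b) = 0 :=
    hNdef ▸ outward_orthogonal
  obtain ⟨B, hB⟩ := exists_faceBasis (by omega) hN hNF
  obtain ⟨p₀, hp₀⟩ : ∃ p₀, p₀ = (T.face F).points 0 := ⟨_, rfl⟩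
  obtain ⟨τ, hτ, -⟩ := hreg K
  obtain ⟨hτF, hτK, -⟩ := hτ F hF
  obtain ⟨a, ha⟩ := exists_apex hd hB (τ F) hτF
  have hA : ∀ y : perp N, planeEmb N p₀ y ∈ (T.face F).interior ↔
      ∀ k, B.coord k y ∈ Set.Ioo 0 1 := fun y => by
    rw [hp₀, Affine.Simplex.interior, planeEmb_mem_setInterior_iff hB]
  have hball : ∀ y : perp N, planeEmb N p₀ y ∈ (T.face F).interior → ∃ r > 0,
      Metric.ball (planeEmb N p₀ y) r ∩ T.elem K =
        Metric.ball (planeEmb N p₀ y) r ∩ {x | inner ℝ N (x - planeEmb N p₀ y) < 0} := by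
    intro y hy
    have := exists_ball_inter_elem hF hy
    rwa [← hNdef] at this
  rw [← hp₀] at ha
  -- The height of the apex over the face.
  set s := -inner ℝ N (a - p₀) with hs
  have hsi : ∀ i, inner ℝ N (a - (T.face F).points i) = -s := by
    intro i
    rw [hs, neg_neg, ← sub_add_sub_cancel a p₀, inner_add_right, hp₀, hNF, add_zero]
  have hspos : 0 < s := by
    obtain ⟨x, hx⟩ := nonempty_interior_simplex (by omega) (T.face F)
    obtain ⟨y, rfl, hy⟩ := (mem_setInterior_iff hB).1 hx
    rw [← hp₀] at hx
    obtain ⟨r, hr, hrK⟩ := hball y hx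
    have hy0 := (hy 0).1
    set v := a - (T.face F).points 0 with hv
    set t := min (B.coord 0 y / 2) (r / (2 * (‖v‖ + 1))) with ht
    have ht0 : 0 < t := lt_min (by positivity) (by positivity)
    have ht1 : t ≤ B.coord 0 y / 2 := min_le_left _ _
    have hmem := hτK (ha y 0 t hy ht0 (by linarith))
    have hmem2 : planeEmb N p₀ y + t • v ∈ Metric.ball (planeEmb N p₀ y) r := by
      rw [mem_ball_iff_norm, add_sub_cancel_left, norm_smul, Real.norm_of_nonneg ht0.le]
      have h1 : t * ‖v‖ ≤ r / (2 * (‖v‖ + 1)) * ‖v‖ :=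
        mul_le_mul_of_nonneg_right (min_le_right _ _) (norm_nonneg _)
      have h2 : r / (2 * (‖v‖ + 1)) * ‖v‖ < r := by
        rw [div_mul_eq_mul_div, div_lt_iff₀ (by positivity)]
        nlinarith [norm_nonneg v]
      linarith
    have h3 : planeEmb N p₀ y + t • v ∈ Metric.ball (planeEmb N p₀ y) r ∩ T.elem K :=
      ⟨hmem2, hmem⟩
    rw [hrK] at h3
    have h4 : inner ℝ N (planeEmb N p₀ y + t • v - planeEmb N p₀ y) < 0 := h3.2
    rw [add_sub_cancel_left, inner_smul_right, hv, hsi] at h4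
    nlinarith
  set M : ℝ := ((d - 1 + 1 : ℕ) : ℝ) with hM
  have hM0 : 0 < M := by positivity
  set κ : ℝ := 1 / (2 * M) with hκ
  have hκ0 : 0 < κ := by positivity
  set D : Fin (d - 1 + 1) → Set (perp N) := fun i =>
    planeEmb N p₀ ⁻¹' (T.face F).interior ∩ B.coord i ⁻¹' Set.Ioi κ with hD
  have hDo : ∀ i, IsOpen (D i) := fun i =>
    (hp₀ ▸ isOpen_preimage_interior hB).inter
      (isOpen_Ioi.preimage (AffineMap.continuous_of_finiteDimensional (B.coord i)))
  have hcover : planeEmb N p₀ ⁻¹' (T.face F).interior ⊆ ⋃ i, D i := by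
    intro y hy
    by_contra hne
    simp only [hD, Set.mem_iUnion, not_exists] at hne
    have hle : ∀ i, B.coord i y ≤ κ := fun i => not_lt.1 fun h => hne i ⟨hy, h⟩
    have h1 := B.sum_coord_apply_eq_one y
    have h2 : ∑ i, B.coord i y ≤ ∑ _i : Fin (d - 1 + 1), κ := Finset.sum_le_sum fun i _ => hle i
    rw [h1, Finset.sum_const, Finset.card_univ, Fintype.card_fin, nsmul_eq_mul, ← hM, hκ] at h2
    have h3 : M * (1 / (2 * M)) = 1 / 2 := by field_simp
    linarith
  have hlocal : ∀ i, (∀ᵐ y : perp N ∂volume.restrict (D i), HasTrace (T.elem K) w (planeEmb N p₀ y)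
      (trace (T.elem K) w (planeEmb N p₀ y))) ∧
      IntegrableOn (fun y => trace (T.elem K) w (planeEmb N p₀ y)) (D i) := by
    intro i
    set b := s⁻¹ • (a - (T.face F).points i) with hb'
    have hb : inner ℝ N b = -1 := by
      rw [hb', inner_smul_right, hsi]
      field_simp
    have hδ : 0 < s * κ := by positivity
    have hDU : obliqueChart p₀ hb '' (D i ×ˢ Set.Ioo 0 (s * κ)) ⊆ T.elem K := by
      rintro _ ⟨⟨y, t⟩, ⟨hy, ht⟩, rfl⟩
      have h1 : t * s⁻¹ < κ := by
        rw [← div_eq_mul_inv, div_lt_iff₀ hspos, mul_comm]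
        exact ht.2
      have h2 := hτK (ha y i (t * s⁻¹) ((hA y).1 hy.1) (mul_pos ht.1 (inv_pos.2 hspos))
        (h1.trans hy.2))
      rwa [← smul_smul] at h2
    obtain ⟨G, hG, hGt, -⟩ := hw.exists_base_trace (T.isOpen_elem K) (elem_measure_ne_top hΩ) hN hb
      (hDo i) hδ hDU
    have htr : ∀ᵐ y : perp N ∂volume.restrict (D i),
        HasTrace (T.elem K) w (planeEmb N p₀ y) (G y) := by
      filter_upwards [hGt, ae_restrict_mem (hDo i).measurableSet] with y hy hyD
      obtain ⟨r, hr, hrK⟩ := hball y hyD.1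
      exact hy r hr hrK
    refine ⟨?_, hG.congr ?_⟩
    · filter_upwards [htr] with y hy
      rwa [trace_eq hy]
    · filter_upwards [htr] with y hy using (trace_eq hy).symm
  have hunion : ∀ᵐ y : perp N ∂volume.restrict (⋃ i, D i),
      HasTrace (T.elem K) w (planeEmb N p₀ y) (trace (T.elem K) w (planeEmb N p₀ y)) :=
    (ae_restrict_iUnion_iff _ _).2 fun i => (hlocal i).1
  have hmeas : T.faceMeasure F =
      (volume.restrict (planeEmb N p₀ ⁻¹' (T.face F).closedInterior)).map (planeEmb N p₀) := by
    rw [hp₀]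
    exact restrict_euclideanHausdorffMeasure_face (by omega) hN hB
  have hint := ae_mem_interior (T := T) (F := F) hd
  rw [hmeas, (measurableEmbedding_planeEmb N p₀).ae_map_iff] at hint
  have hle : (volume : Measure (perp N)).restrict
      (planeEmb N p₀ ⁻¹' (T.face F).closedInterior) ≤ volume.restrict (⋃ i, D i) := by
    refine Measure.restrict_mono_ae ?_
    have hS : MeasurableSet (planeEmb N p₀ ⁻¹' (T.face F).closedInterior) :=
      (T.face F).isClosed_closedInterior.measurableSet.preimage
        (measurableEmbedding_planeEmb N p₀).measurable
    filter_upwards [(ae_restrict_iff' hS).1 hint] with y hy hyS using hcover (hy hyS)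
  rw [hmeas, (measurableEmbedding_planeEmb N p₀).ae_map_iff,
    (measurableEmbedding_planeEmb N p₀).integrable_map_iff]
  refine ⟨hunion.filter_mono (ae_mono hle), ?_⟩
  have : IntegrableOn (fun y => trace (T.elem K) w (planeEmb N p₀ y)) (⋃ i, D i) :=
    integrableOn_finite_iUnion.2 fun i => (hlocal i).2
  exact Integrable.mono_measure this hle

end Traces

/-! ### Cutoffs around flats of codimension two -/

section Cutoff

variable {d : ℕ} {n₁ n₂ : E d}

/-- The part in a ball of the `t`-neighbourhood of a flat of codimension two has volume `O(t²)`. -/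
theorem exists_volume_tube_le (hd : 2 ≤ d) (h1 : ‖n₁‖ = 1) (h2 : ‖n₂‖ = 1)
    (h12 : inner ℝ n₁ n₂ = 0) (s₁ s₂ R : ℝ) (hR : 0 < R) :
    ∃ C : ℝ, 0 ≤ C ∧ ∀ t > 0, volume.real ({x : E d | |inner ℝ n₁ x - s₁| ≤ t ∧
      |inner ℝ n₂ x - s₂| ≤ t} ∩ Metric.closedBall 0 R) ≤ C * t ^ 2 := by
  set i₀ : Fin d := ⟨0, by omega⟩ with hi₀
  set i₁ : Fin d := ⟨1, by omega⟩ with hi₁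
  have hi : i₁ ≠ i₀ := by simp [hi₀, hi₁]
  set v : Fin d → E d := fun i => if i = i₀ then n₁ else n₂ with hv
  have hv0 : v i₀ = n₁ := by simp [hv]
  have hv1 : v i₁ = n₂ := by simp [hv, hi]
  have horth : Orthonormal ℝ (Set.domRestrict {i₀, i₁} v) := by
    constructor
    · rintro ⟨i, rfl | rfl⟩
      · change ‖v i₀‖ = 1
        rwa [hv0]
      · change ‖v i₁‖ = 1
        rwa [hv1]
    · rintro ⟨i, rfl | rfl⟩ ⟨j, rfl | rfl⟩ hij
      · exact absurd rfl hij
      · change inner ℝ (v i₀) (v i₁) = 0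
        rwa [hv0, hv1]
      · change inner ℝ (v i₁) (v i₀) = 0
        rwa [hv0, hv1, real_inner_comm]
      · exact absurd rfl hij
  obtain ⟨b, hb⟩ := horth.exists_orthonormalBasis_extension_of_card_eq
    (by rw [finrank_euclideanSpace_fin, Fintype.card_fin])
  have hb0 : b i₀ = n₁ := by rw [hb i₀ (by simp), hv0]
  have hb1 : b i₁ = n₂ := by rw [hb i₁ (by simp), hv1]
  set k := (Finset.univ.filter fun i : Fin d => ¬ (i = i₀ ∨ i = i₁)).card with hk
  refine ⟨4 * (2 * R) ^ k, by positivity, fun t ht => ?_⟩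
  set ℓ : Fin d → ℝ := fun i => if i = i₀ ∨ i = i₁ then t else R with hℓ
  set m : Fin d → ℝ := fun i => if i = i₀ then s₁ else if i = i₁ then s₂ else 0 with hm
  have hmp : MeasurePreserving (fun x : E d => (WithLp.ofLp (b.repr x) : Fin d → ℝ)) :=
    (PiLp.volume_preserving_ofLp (Fin d)).comp b.measurePreserving_repr
  set Q : Set (Fin d → ℝ) := Set.Icc (fun i => m i - ℓ i) (fun i => m i + ℓ i) with hQ
  have hℓ0 : ∀ i, 0 ≤ ℓ i := fun i => by
    simp only [hℓ]
    split_ifs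
    · exact ht.le
    · exact hR.le
  have hsub : {x : E d | |inner ℝ n₁ x - s₁| ≤ t ∧ |inner ℝ n₂ x - s₂| ≤ t} ∩
      Metric.closedBall 0 R ⊆ (fun x : E d => (WithLp.ofLp (b.repr x) : Fin d → ℝ)) ⁻¹' Q := by
    rintro x ⟨⟨hx1, hx2⟩, hxR⟩
    suffices h : ∀ i, |(b.repr x).ofLp i - m i| ≤ ℓ i by
      refine Set.mem_preimage.2 ⟨fun i => ?_, fun i => ?_⟩ <;> have := abs_le.1 (h i)
      · change m i - ℓ i ≤ (b.repr x).ofLp i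
        linarith
      · change (b.repr x).ofLp i ≤ m i + ℓ i
        linarith
    intro i
    rw [b.repr_apply_apply]
    by_cases hi0 : i = i₀
    · rw [hi0, hb0]
      simpa [hm, hℓ] using hx1
    by_cases hi1 : i = i₁
    · rw [hi1, hb1]
      simpa [hm, hℓ, hi] using hx2
    · simp only [hm, hℓ, hi0, hi1, or_self, if_false, sub_zero]
      refine (abs_real_inner_le_norm _ _).trans ?_
      rw [b.orthonormal.1 i, one_mul]
      simpa using hxR
  have hQv : volume.real Q = 4 * (2 * R) ^ k * t ^ 2 := by
    rw [measureReal_def, hQ, Real.volume_Icc_pi_toReal fun i => by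
      change m i - ℓ i ≤ m i + ℓ i
      linarith [hℓ0 i]]
    have h3 : ∀ i, m i + ℓ i - (m i - ℓ i) = if i = i₀ ∨ i = i₁ then 2 * t else 2 * R := by
      intro i
      simp only [hℓ]
      split_ifs <;> ring
    simp only [h3]
    rw [Finset.prod_ite, Finset.prod_const, Finset.prod_const, ← hk]
    have h4 : (Finset.univ.filter fun i : Fin d => i = i₀ ∨ i = i₁) = {i₀, i₁} := by
      ext i
      simp
    rw [h4, Finset.card_pair hi.symm]
    ring
  have hQm : MeasurableSet Q := measurableSet_Icc
  have hQfin : volume ((fun x : E d => (WithLp.ofLp (b.repr x) : Fin d → ℝ)) ⁻¹' Q) ≠ ⊤ := by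
    rw [hmp.measure_preimage hQm.nullMeasurableSet]
    exact isCompact_Icc.measure_lt_top.ne
  calc volume.real _ ≤ volume.real
        ((fun x : E d => (WithLp.ofLp (b.repr x) : Fin d → ℝ)) ⁻¹' Q) := measureReal_mono hsub hQfin
    _ = volume.real Q := by
      rw [measureReal_def, hmp.measure_preimage hQm.nullMeasurableSet, measureReal_def]
    _ = _ := hQv

/-- Smooth cutoffs around a flat of codimension two. Their gradients, of size `n` on a set of
measure `O(n⁻²)`, tend to zero weakly against every square-integrable function, so such a flat is
invisible to `H^1`. -/
theorem exists_cutoff (hd : 2 ≤ d) (h1 : ‖n₁‖ = 1) (h2 : ‖n₂‖ = 1)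
    (h12 : inner ℝ n₁ n₂ = 0) (s₁ s₂ : ℝ) :
    ∃ η : ℕ → E d → ℝ, (∀ n, ContDiff ℝ ∞ (η n)) ∧ (∀ n x, |η n x| ≤ 1) ∧
      (∀ n x, inner ℝ n₁ x = s₁ → inner ℝ n₂ x = s₂ → x ∉ tsupport (η n)) ∧
      (∀ x, ¬ (inner ℝ n₁ x = s₁ ∧ inner ℝ n₂ x = s₂) → Tendsto (fun n => η n x) atTop (𝓝 1)) ∧
      ∀ (U : Set (E d)) (f : E d → ℝ), Bornology.IsBounded U → MemLp f 2 (volume.restrict U) →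
        ∀ v : E d, Tendsto (fun n => ∫ x in U, |f x * fderiv ℝ (η n) x v|) atTop (𝓝 0) := by
  let β : ContDiffBump (0 : ℝ) := ⟨1, 2, by norm_num, by norm_num⟩
  have hβd : ContDiff ℝ ∞ β := β.contDiff
  have hβ0 : ∀ t : ℝ, 2 ≤ |t| → β t = 0 := fun t ht =>
    β.zero_of_le_dist (by simpa [Real.dist_eq] using ht)
  have hβ1 : ∀ t : ℝ, |t| ≤ 1 → β t = 1 := fun t ht =>
    β.one_of_mem_closedBall (by simpa [Real.dist_eq] using ht)
  have hβn : ∀ t, 0 ≤ β t := fun t => β.nonneg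
  have hβl : ∀ t, β t ≤ 1 := fun t => β.le_one
  have hβ'c : Continuous (deriv β) := hβd.continuous_deriv (by simp)
  obtain ⟨C, hC⟩ := hβ'c.bounded_above_of_compact_support β.hasCompactSupport.deriv
  have hC0 : 0 ≤ C := (norm_nonneg _).trans (hC 0)
  set ℓ : ℕ → (E d) → ℝ → E d → ℝ := fun n m s x => ((n : ℝ) + 1) * (inner ℝ m x - s) with hℓ
  have hℓd : ∀ n m s, ContDiff ℝ ∞ (ℓ n m s) := fun n m s =>
    contDiff_const.mul ((contDiff_const.inner ℝ contDiff_id).sub contDiff_const)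
  set η : ℕ → E d → ℝ := fun n x => 1 - β (ℓ n n₁ s₁ x) * β (ℓ n n₂ s₂ x) with hη
  have hηd : ∀ n, ContDiff ℝ ∞ (η n) := fun n =>
    contDiff_const.sub ((hβd.comp (hℓd n n₁ s₁)).mul (hβd.comp (hℓd n n₂ s₂)))
  -- The gradient of the cutoff lives near the flat and is at most of size `n`.
  have hd' : ∀ n m s x, HasFDerivAt (ℓ n m s) (((n : ℝ) + 1) • innerSL ℝ m) x := by
    intro n m s x
    exact (((innerSL ℝ m).hasFDerivAt).sub_const s).const_mul ((n : ℝ) + 1)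
  have hgrad : ∀ n x v, fderiv ℝ (η n) x v =
      -((n : ℝ) + 1) * (deriv β (ℓ n n₁ s₁ x) * inner ℝ n₁ v * β (ℓ n n₂ s₂ x) +
        β (ℓ n n₁ s₁ x) * (deriv β (ℓ n n₂ s₂ x) * inner ℝ n₂ v)) := by
    intro n x v
    have hβdiff : ∀ t, HasDerivAt β (deriv β t) t := fun t =>
      (hβd.differentiable (by simp) t).hasDerivAt
    have e1 := (hβdiff (ℓ n n₁ s₁ x)).comp_hasFDerivAt x (hd' n n₁ s₁ x)
    have e2 := (hβdiff (ℓ n n₂ s₂ x)).comp_hasFDerivAt x (hd' n n₂ s₂ x)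
    have e3 := ((e1.mul e2).const_sub 1).fderiv
    have : fderiv ℝ (η n) x = _ := e3
    rw [this]
    simp
    ring
  set S : ℕ → Set (E d) := fun n =>
    {x | |inner ℝ n₁ x - s₁| ≤ 2 / ((n : ℝ) + 1) ∧ |inner ℝ n₂ x - s₂| ≤ 2 / ((n : ℝ) + 1)} with hS
  have habs : ∀ n m s x, |ℓ n m s x| = ((n : ℝ) + 1) * |inner ℝ m x - s| := by
    intro n m s x
    rw [hℓ, abs_mul, abs_of_pos (by positivity)]
  have hout : ∀ n x, x ∉ S n → ∀ v, fderiv ℝ (η n) x v = 0 := by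
    intro n x hx v
    have hz : ∀ t : ℝ, 2 < |t| → β t = 0 ∧ deriv β t = 0 := by
      intro t ht
      refine ⟨hβ0 t ht.le, ?_⟩
      have hev : (β : ℝ → ℝ) =ᶠ[𝓝 t] fun _ => 0 := by
        filter_upwards [(isOpen_lt continuous_const continuous_abs).mem_nhds ht] with u hu
        exact hβ0 u (le_of_lt hu)
      rw [hev.deriv_eq]
      simp
    have hlt : ∀ m s, ¬ |inner ℝ m x - s| ≤ 2 / ((n : ℝ) + 1) → 2 < |ℓ n m s x| := by
      intro m s h
      rw [habs]
      rw [not_le, div_lt_iff₀ (by positivity)] at h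
      linarith
    rw [hgrad]
    simp only [hS, Set.mem_ofPred_eq, not_and_or] at hx
    rcases hx with hx | hx
    · obtain ⟨z1, z2⟩ := hz _ (hlt _ _ hx)
      simp [z1, z2]
    · obtain ⟨z1, z2⟩ := hz _ (hlt _ _ hx)
      simp [z1, z2]
  have hbound : ∀ n x v, |fderiv ℝ (η n) x v| ≤ ((n : ℝ) + 1) * (2 * C * ‖v‖) := by
    intro n x v
    have hin : ∀ m : E d, ‖m‖ = 1 → |inner ℝ m v| ≤ ‖v‖ := fun m hm => by
      simpa [hm] using abs_real_inner_le_norm m v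
    have hβa : ∀ t, |β t| ≤ 1 := fun t => by
      rw [abs_of_nonneg (hβn t)]
      exact hβl t
    rw [hgrad, abs_mul, abs_neg, abs_of_pos (show (0 : ℝ) < (n : ℝ) + 1 by positivity)]
    refine mul_le_mul_of_nonneg_left ?_ (by positivity)
    refine (abs_add_le _ _).trans ?_
    rw [abs_mul, abs_mul, abs_mul, abs_mul]
    have a1 : |deriv β (ℓ n n₁ s₁ x)| * |inner ℝ n₁ v| * |β (ℓ n n₂ s₂ x)| ≤ C * ‖v‖ * 1 := by
      gcongr
      · exact hC _
      · exact hin _ h1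
      · exact hβa _
    have a2 : |β (ℓ n n₁ s₁ x)| * (|deriv β (ℓ n n₂ s₂ x)| * |inner ℝ n₂ v|) ≤ 1 * (C * ‖v‖) := by
      gcongr
      · exact hβa _
      · exact hC _
      · exact hin _ h2
    linarith
  refine ⟨η, hηd, fun n x => ?_, fun n x hx1 hx2 => ?_, fun x hx => ?_, fun U f hU hf v => ?_⟩
  · have p1 := mul_nonneg (hβn (ℓ n n₁ s₁ x)) (hβn (ℓ n n₂ s₂ x))
    have p2 := mul_le_one₀ (hβl (ℓ n n₁ s₁ x)) (hβn (ℓ n n₂ s₂ x)) (hβl (ℓ n n₂ s₂ x))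
    rw [abs_le]
    constructor <;> simp only [hη] <;> linarith
  · rw [notMem_tsupport_iff_eventuallyEq]
    have hnear : ∀ m s, inner ℝ m x = s → ∀ᶠ z in 𝓝 x, |ℓ n m s z| < 1 := by
      intro m s hms
      refine ((hℓd n m s).continuous.abs.continuousAt).eventually_lt continuousAt_const ?_
      rw [habs, hms]
      simp
    filter_upwards [hnear n₁ s₁ hx1, hnear n₂ s₂ hx2] with z hz1 hz2
    simp [hη, hβ1 _ hz1.le, hβ1 _ hz2.le]
  · have hfar : ∀ m s, inner ℝ m x ≠ s → ∀ᶠ n : ℕ in atTop, β (ℓ n m s x) = 0 := by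
      intro m s hne
      have hpos : 0 < |inner ℝ m x - s| := abs_pos.2 (sub_ne_zero.2 hne)
      have ht : Tendsto (fun n : ℕ => ((n : ℝ) + 1) * |inner ℝ m x - s|) atTop atTop :=
        (tendsto_atTop_add_const_right _ _ tendsto_natCast_atTop_atTop).atTop_mul_const hpos
      filter_upwards [ht.eventually_ge_atTop 2] with n hn
      exact hβ0 _ (by rwa [habs])
    refine tendsto_const_nhds.congr' ?_
    rw [not_and_or] at hx
    rcases hx with hx | hx
    · filter_upwards [hfar _ _ hx] with n hn
      simp [hη, hn]
    · filter_upwards [hfar _ _ hx] with n hn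
      simp [hη, hn]
  · obtain ⟨R₀, hR₀⟩ := hU.subset_closedBall 0
    set R := max R₀ 1 with hR
    have hUR : U ⊆ Metric.closedBall 0 R :=
      hR₀.trans (Metric.closedBall_subset_closedBall (le_max_left _ _))
    obtain ⟨C', hC'0, hC'⟩ := exists_volume_tube_le hd h1 h2 h12 s₁ s₂ R
      (zero_lt_one.trans_le (le_max_right _ _))
    have hSm : ∀ n, MeasurableSet (S n) := fun n => by
      have hm : ∀ (m : E d) s, IsClosed {x : E d | |inner ℝ m x - s| ≤ 2 / ((n : ℝ) + 1)} :=
        fun m s => isClosed_le (by fun_prop) continuous_const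
      exact ((hm n₁ s₁).inter (hm n₂ s₂)).measurableSet
    set μ := (volume : Measure (E d)).restrict U with hμ
    have hμfin : IsFiniteMeasure μ := ⟨by simpa [hμ] using hU.measure_lt_top⟩
    have hμS : ∀ n, μ.real (S n) ≤ C' * (2 / ((n : ℝ) + 1)) ^ 2 := by
      intro n
      refine le_trans ?_ (hC' (2 / ((n : ℝ) + 1)) (by positivity))
      rw [hμ, measureReal_restrict_apply (hSm n)]
      refine measureReal_mono (Set.inter_subset_inter_right _ hUR) ?_
      exact measure_ne_top_of_subset Set.inter_subset_right measure_closedBall_lt_top.ne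
    have hf2 : Integrable (fun x => f x ^ 2) μ := hf.integrable_sq
    have hlim : Tendsto (fun n => ∫ x in S n, f x ^ 2 ∂μ) atTop (𝓝 0) := by
      refine hf2.tendsto_setIntegral_nhds_zero ?_
      have : Tendsto (fun n => μ.real (S n)) atTop (𝓝 0) := by
        refine squeeze_zero (fun _ => measureReal_nonneg) hμS ?_
        have h3 : Tendsto (fun n : ℕ => 2 / ((n : ℝ) + 1)) atTop (𝓝 0) := by
          have := tendsto_one_div_add_atTop_nhds_zero_nat (𝕜 := ℝ)
          simpa [div_eq_mul_inv] using this.const_mul 2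
        simpa using (h3.pow 2).const_mul C'
      simp only [measureReal_def] at this
      exact (ENNReal.tendsto_toReal_zero_iff fun _ => measure_ne_top _ _).1 this
    -- Cauchy-Schwarz on the support of the gradient.
    have hCS : ∀ n, ∫ x in U, |f x * fderiv ℝ (η n) x v| ≤
        (4 * C * ‖v‖ * √C') * √(∫ x in S n, f x ^ 2 ∂μ) := by
      intro n
      set c : ℝ := ((n : ℝ) + 1) * (2 * C * ‖v‖) with hc
      have hfa : Integrable (fun x => |f x|) μ := (hf.integrable one_le_two).abs
      have hH : ∫ x in S n, |f x| ∂μ ≤ √(∫ x in S n, f x ^ 2 ∂μ) * √(μ.real (S n)) := by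
        have h3 := integral_mul_le_Lp_mul_Lq_of_nonneg (μ := μ.restrict (S n))
          Real.HolderConjugate.two_two (f := fun x => |f x|) (g := fun _ => (1 : ℝ))
          (ae_of_all _ fun _ => abs_nonneg _) (ae_of_all _ fun _ => zero_le_one)
          (by simpa using! (hf.restrict (S n)).abs) (by simpa using memLp_const (1 : ℝ))
        simpa [Real.sqrt_eq_rpow] using h3
      calc ∫ x in U, |f x * fderiv ℝ (η n) x v|
          ≤ ∫ x, (S n).indicator (fun x => |f x| * c) x ∂μ := by
            refine integral_mono_of_nonneg (ae_of_all _ fun _ => abs_nonneg _)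
              ((hfa.mul_const c).indicator (hSm n)) (ae_of_all _ fun x => ?_)
            by_cases hx : x ∈ S n
            · simp only [Set.indicator_of_mem hx, abs_mul]
              exact mul_le_mul_of_nonneg_left (hbound n x v) (abs_nonneg _)
            · simp [Set.indicator_of_notMem hx, hout n x hx v]
        _ = (∫ x in S n, |f x| ∂μ) * c := by
            rw [integral_indicator (hSm n), integral_mul_const]
        _ ≤ (√(∫ x in S n, f x ^ 2 ∂μ) * (√C' * (2 / ((n : ℝ) + 1)))) * c := by
            refine mul_le_mul_of_nonneg_right (hH.trans ?_) (by positivity)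
            refine mul_le_mul_of_nonneg_left ?_ (Real.sqrt_nonneg _)
            refine (Real.sqrt_le_sqrt (hμS n)).trans_eq ?_
            rw [Real.sqrt_mul hC'0, Real.sqrt_sq (by positivity)]
        _ = _ := by
            rw [hc]
            field_simp
            ring
    refine squeeze_zero (fun n => integral_nonneg fun _ => abs_nonneg _) hCS ?_
    have := (Real.continuous_sqrt.tendsto 0).comp hlim
    simpa using this.const_mul (4 * C * ‖v‖ * √C')

end Cutoff

/-! ### Integration by parts on an element -/

section GlobalIbp

variable {d : ℕ} {Ω : Set (E d)} {T : PolytopicMesh Ω} {K : Fin T.numElem} {F : Fin T.numFace}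

theorem isFiniteMeasure_faceMeasure (hd : 1 ≤ d) : IsFiniteMeasure (T.faceMeasure F) := by
  refine ⟨?_⟩
  have hN := T.norm_normal F
  obtain ⟨B, hB⟩ := exists_faceBasis hd hN (T.normal_orthogonal F)
  have hcl := (T.face F).isClosed_closedInterior
  rw [PolytopicMesh.faceMeasure, restrict_euclideanHausdorffMeasure_face hd hN hB,
    (measurableEmbedding_planeEmb _ _).map_apply]
  refine (measure_mono (Set.subset_univ _)).trans_lt ?_
  rw [Measure.restrict_apply_univ]
  have hcomp : IsCompact (planeEmb (T.normal F) ((T.face F).points 0) ⁻¹'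
      (T.face F).closedInterior) :=
    (isometry_planeEmb _ _).isClosedEmbedding.isCompact_preimage
      (T.face F).isCompact_closedInterior
  exact hcomp.measure_lt_top

theorem closedInterior_subset_frontier (hF : T.IsFaceOf F K) :
    (T.face F).closedInterior ⊆ frontier (T.elem K) := by
  rw [T.frontier_elem K]
  exact Set.subset_iUnion₂_of_subset F hF subset_rfl

theorem integrableOn_mul_of_continuous {μ : Measure (E d)} {S : Set (E d)}
    (hS : Bornology.IsBounded S) {f g : E d → ℝ} (hf : Integrable f (μ.restrict S))
    (hg : Continuous g) : Integrable (fun x => f x * g x) (μ.restrict S) := by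
  obtain ⟨C, hC⟩ := hS.isCompact_closure.exists_bound_of_continuousOn hg.continuousOn
  refine hf.mul_bdd (c := C) hg.aestronglyMeasurable ?_
  have : ∀ᵐ x ∂μ.restrict (closure S), ‖g x‖ ≤ C := by
    filter_upwards [ae_restrict_mem isClosed_closure.measurableSet] with x hx using hC x hx
  exact ae_mono (Measure.restrict_mono subset_closure le_rfl) this

theorem isBounded_elem (hΩ : Bornology.IsBounded Ω) : Bornology.IsBounded (T.elem K) :=
  hΩ.subset (T.elem_subset K)

open Classical in
/-- The difference of the two sides of the integration by parts formula on the element `K`, as a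
functional of the smooth function `φ`. -/
noncomputable def ibpDefect (T : PolytopicMesh Ω) (K : Fin T.numElem) (w : E d → ℝ)
    (g : Fin d → E d → ℝ) (j : Fin d) (φ : E d → ℝ) : ℝ :=
  (∫ x in T.elem K, (g j x * φ x + w x * fderiv ℝ φ x (EuclideanSpace.single j 1))) -
    ∑ F with T.IsFaceOf F K,
      outward T K F j * ∫ x, trace (T.elem K) w x * φ x ∂T.faceMeasure F

variable {w : E d → ℝ} {g : Fin d → E d → ℝ} {j : Fin d} {φ ψ : E d → ℝ}

theorem ibpDefect_congr (h : ∀ x ∈ closure (T.elem K), φ x = ψ x) :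
    ibpDefect T K w g j φ = ibpDefect T K w g j ψ := by
  classical
  have hK : Set.EqOn φ ψ (T.elem K) := fun x hx => h x (subset_closure hx)
  rw [ibpDefect, ibpDefect]
  congr 1
  · refine setIntegral_congr_fun (T.isOpen_elem K).measurableSet fun x hx => ?_
    have hev : φ =ᶠ[𝓝 x] ψ := hK.eventuallyEq_of_mem ((T.isOpen_elem K).mem_nhds hx)
    rw [hev.fderiv_eq, hK hx]
  · refine Finset.sum_congr rfl fun F hF => ?_
    have hFK : T.IsFaceOf F K := (Finset.mem_filter.1 hF).2
    congr 1
    refine setIntegral_congr_fun (T.face F).isClosed_closedInterior.measurableSet fun x hx => ?_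
    rw [h x (frontier_subset_closure (closedInterior_subset_frontier hFK hx))]

theorem ibpDefect_zero : ibpDefect T K w g j (fun _ => 0) = 0 := by
  simp [ibpDefect]

theorem integrableOn_ibp (hΩ : Bornology.IsBounded Ω) (hw : HasWeakGrad (T.elem K) w g)
    (hφ : ContDiff ℝ ∞ φ) :
    IntegrableOn (fun x => g j x * φ x) (T.elem K) ∧
      IntegrableOn (fun x => w x * fderiv ℝ φ x (EuclideanSpace.single j 1)) (T.elem K) :=
  ⟨integrableOn_mul_of_continuous (isBounded_elem hΩ)
      (integrableOn_of_memLp_two (elem_measure_ne_top hΩ) (hw.memLp_grad j)) hφ.continuous,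
    integrableOn_mul_of_continuous (isBounded_elem hΩ)
      (hw.integrableOn (elem_measure_ne_top hΩ)) (continuous_fderiv_dir hφ _)⟩

theorem integrable_trace_mul (hd : 2 ≤ d) (hΩ : Bornology.IsBounded Ω) {c : ℝ}
    (hreg : T.PolytopicRegular c) (hF : T.IsFaceOf F K) (hw : HasWeakGrad (T.elem K) w g)
    (hφ : Continuous φ) : Integrable (fun x => trace (T.elem K) w x * φ x) (T.faceMeasure F) :=
  integrableOn_mul_of_continuous (T.face F).isCompact_closedInterior.isBounded
    (hw.ae_hasTrace_and_integrable hd hΩ hreg hF).2 hφ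

theorem ibpDefect_add (hd : 2 ≤ d) (hΩ : Bornology.IsBounded Ω) {c : ℝ}
    (hreg : T.PolytopicRegular c) (hw : HasWeakGrad (T.elem K) w g)
    (hφ : ContDiff ℝ ∞ φ) (hψ : ContDiff ℝ ∞ ψ) :
    ibpDefect T K w g j (fun x => φ x + ψ x) = ibpDefect T K w g j φ + ibpDefect T K w g j ψ := by
  classical
  have h1 : ∫ x in T.elem K, (g j x * (φ x + ψ x) +
        w x * fderiv ℝ (fun x => φ x + ψ x) x (EuclideanSpace.single j 1)) =
      (∫ x in T.elem K, (g j x * φ x + w x * fderiv ℝ φ x (EuclideanSpace.single j 1))) +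
      ∫ x in T.elem K, (g j x * ψ x + w x * fderiv ℝ ψ x (EuclideanSpace.single j 1)) := by
    have hi : ∀ {θ : E d → ℝ}, ContDiff ℝ ∞ θ → IntegrableOn (fun x => g j x * θ x +
        w x * fderiv ℝ θ x (EuclideanSpace.single j 1)) (T.elem K) := fun hθ =>
      (integrableOn_ibp hΩ hw hθ).1.add (integrableOn_ibp hΩ hw hθ).2
    rw [← integral_add (hi hφ) (hi hψ)]
    refine integral_congr_ae (ae_of_all _ fun x => ?_)
    simp only
    rw [fderiv_fun_add (hφ.differentiable (by simp) x) (hψ.differentiable (by simp) x),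
      add_apply]
    ring
  have h2 : ∀ F, T.IsFaceOf F K → ∫ x, trace (T.elem K) w x * (φ x + ψ x) ∂T.faceMeasure F =
      (∫ x, trace (T.elem K) w x * φ x ∂T.faceMeasure F) +
        ∫ x, trace (T.elem K) w x * ψ x ∂T.faceMeasure F := by
    intro F hF
    rw [← integral_add (integrable_trace_mul hd hΩ hreg hF hw hφ.continuous)
      (integrable_trace_mul hd hΩ hreg hF hw hψ.continuous)]
    simp only [mul_add]
  rw [ibpDefect, ibpDefect, ibpDefect, h1, Finset.sum_congr rfl fun F hF => by
    rw [h2 F (Finset.mem_filter.1 hF).2, mul_add], Finset.sum_add_distrib]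
  ring

/-- Near an interior point of the face `F` of `K`, no other face of `K` is met. -/
theorem exists_ball_disjoint_faces (hd : 2 ≤ d) (hF : T.IsFaceOf F K) {x : E d}
    (hx : x ∈ (T.face F).interior) :
    ∃ r > 0, ∀ F', T.IsFaceOf F' K → F' ≠ F →
      ∀ y ∈ Metric.ball x r, y ∉ (T.face F').interior := by
  obtain ⟨r₁, hr₁, h1⟩ := exists_ball_inter_elem hF hx
  obtain ⟨r₂, hr₂, h2⟩ := exists_ball_subset_interior (by omega) norm_outward
    (outward_orthogonal (T := T) (K := K) (F := F)) hx
  refine ⟨min r₁ r₂, lt_min hr₁ hr₂, fun F' hF' hne y hy hyF' => ?_⟩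
  have hy1 : y ∈ Metric.ball x r₁ := Metric.ball_subset_ball (min_le_left _ _) hy
  have hy2 : y ∈ Metric.ball x r₂ := Metric.ball_subset_ball (min_le_right _ _) hy
  have hfr := closedInterior_subset_frontier hF' ((T.face F').interior_subset_closedInterior hyF')
  rw [(T.isOpen_elem K).frontier_eq] at hfr
  have hge : 0 ≤ inner ℝ (outward T K F) (y - x) := by
    by_contra! hlt
    have hmem : y ∈ Metric.ball x r₁ ∩ {y | inner ℝ (outward T K F) (y - x) < 0} := ⟨hy1, hlt⟩
    rw [← h1] at hmem
    exact hfr.2 hmem.2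
  have hle : inner ℝ (outward T K F) (y - x) ≤ 0 := by
    have hcl : y ∈ closure (Metric.ball x r₁ ∩ T.elem K) :=
      Metric.isOpen_ball.inter_closure ⟨hy1, hfr.1⟩
    rw [h1] at hcl
    have hclosed : IsClosed {y | inner ℝ (outward T K F) (y - x) ≤ 0} :=
      isClosed_le (by fun_prop) continuous_const
    refine closure_minimal ?_ hclosed hcl
    intro z hz
    have hz2 : inner ℝ (outward T K F) (z - x) < 0 := hz.2
    exact hz2.le
  exact Set.disjoint_left.1 (T.disjoint_face hne) hyF' (h2 y hy2 (le_antisymm hle hge))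

/-- Integration by parts holds for test functions supported near a point of the element or near
an interior point of one of its faces. -/
theorem exists_ball_ibpDefect_eq_zero (hd : 2 ≤ d) (hΩ : Bornology.IsBounded Ω)
    (hw : HasWeakGrad (T.elem K) w g) (j : Fin d) {x : E d}
    (hx : x ∈ T.elem K ∨ ∃ F, T.IsFaceOf F K ∧ x ∈ (T.face F).interior) :
    ∃ r > 0, ∀ ψ, ContDiff ℝ ∞ ψ → tsupport ψ ⊆ Metric.ball x r →
      ibpDefect T K w g j ψ = 0 := by
  classical
  rcases hx with hx | ⟨F, hF, hx⟩
  · obtain ⟨r, hr, hsub⟩ := Metric.isOpen_iff.1 (T.isOpen_elem K) x hx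
    refine ⟨r, hr, fun ψ hψ hψs => ?_⟩
    have hψc : HasCompactSupport ψ := HasCompactSupport.of_support_subset_isCompact
      (isCompact_closedBall x r)
      ((subset_tsupport ψ).trans (hψs.trans Metric.ball_subset_closedBall))
    have h := (hw.hasWeakDeriv j).2.2 ψ hψ hψc (hψs.trans hsub)
    rw [ibpDefect, integral_add (integrableOn_ibp hΩ hw hψ).1 (integrableOn_ibp hΩ hw hψ).2, h,
      add_neg_cancel, zero_sub, neg_eq_zero]
    refine Finset.sum_eq_zero fun F hF => ?_
    have hFK : T.IsFaceOf F K := (Finset.mem_filter.1 hF).2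
    refine mul_eq_zero_of_right _ (setIntegral_eq_zero_of_forall_eq_zero fun y hy => ?_)
    have hfr := closedInterior_subset_frontier hFK hy
    rw [(T.isOpen_elem K).frontier_eq] at hfr
    rw [image_eq_zero_of_notMem_tsupport fun h' => hfr.2 (hsub (hψs h')), mul_zero]
  · obtain ⟨r₁, hr₁, h1⟩ := exists_local_ibp hd hΩ hF hx
    obtain ⟨r₂, hr₂, h2⟩ := exists_ball_disjoint_faces hd hF hx
    refine ⟨min r₁ r₂, lt_min hr₁ hr₂, fun ψ hψ hψs => ?_⟩
    rw [ibpDefect, h1 w g hw ψ hψ (hψs.trans (Metric.ball_subset_ball (min_le_left _ _))) j,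
      Finset.sum_eq_single F, sub_self]
    · intro F' hF' hne
      have hFK : T.IsFaceOf F' K := (Finset.mem_filter.1 hF').2
      refine mul_eq_zero_of_right _ (integral_eq_zero_of_ae ?_)
      filter_upwards [ae_mem_interior (T := T) (F := F') hd] with y hy
      rw [image_eq_zero_of_notMem_tsupport fun h' => h2 F' hFK hne y
        (Metric.ball_subset_ball (min_le_right _ _) (hψs h')) hy]
      simp
    · intro h
      exact absurd (Finset.mem_filter.2 ⟨Finset.mem_univ F, hF⟩) h

/-- Integration by parts holds for functions which vanish near the relative boundaries of the
faces, by a partition of unity. -/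
theorem ibpDefect_eq_zero_of_forall_mem (hd : 2 ≤ d) (hΩ : Bornology.IsBounded Ω) {c : ℝ}
    (hreg : T.PolytopicRegular c) (hw : HasWeakGrad (T.elem K) w g)
    (hφ : ContDiff ℝ ∞ φ) (hφs : ∀ x ∈ closure (T.elem K), x ∈ tsupport φ →
      x ∈ T.elem K ∨ ∃ F, T.IsFaceOf F K ∧ x ∈ (T.face F).interior) :
    ibpDefect T K w g j φ = 0 := by
  have hcomp : IsCompact (closure (T.elem K) ∩ tsupport φ) :=
    (isBounded_elem hΩ).isCompact_closure.inter_right (isClosed_tsupport φ)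
  obtain ⟨χ, hχ, hχ1, hχ0⟩ := hcomp.induction_on
    (p := fun s => ∃ χ : E d → ℝ, ContDiff ℝ ∞ χ ∧ (∀ x ∈ s, χ x = 1) ∧
      ∀ ψ : E d → ℝ, ContDiff ℝ ∞ ψ → ibpDefect T K w g j (fun x => χ x * ψ x) = 0)
    ⟨fun _ => 0, contDiff_const, by simp, fun ψ _ => by simp [ibpDefect_zero]⟩
    (fun s t hst ⟨χ, h1, h2, h3⟩ => ⟨χ, h1, fun x hx => h2 x (hst hx), h3⟩)
    (by
      rintro s t ⟨χ₁, h1, h2, h3⟩ ⟨χ₂, k1, k2, k3⟩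
      refine ⟨fun x => χ₁ x + χ₂ x * (1 - χ₁ x), h1.add (k1.mul (contDiff_const.sub h1)), ?_, ?_⟩
      · rintro x (hx | hx)
        · simp [h2 x hx]
        · simp [k2 x hx]
      · intro ψ hψ
        have e : (fun x => (χ₁ x + χ₂ x * (1 - χ₁ x)) * ψ x) =
            fun x => χ₁ x * ψ x + χ₂ x * ((1 - χ₁ x) * ψ x) := by
          ext x
          ring
        have hψ' : ContDiff ℝ ∞ fun x => (1 - χ₁ x) * ψ x := (contDiff_const.sub h1).mul hψ
        rw [e, ibpDefect_add hd hΩ hreg hw (h1.mul hψ) (k1.mul hψ'), h3 ψ hψ, k3 _ hψ', add_zero])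
    (by
      rintro x ⟨hxK, hxφ⟩
      obtain ⟨r, hr, h⟩ := exists_ball_ibpDefect_eq_zero hd hΩ hw j (hφs x hxK hxφ)
      let β : ContDiffBump x := ⟨r / 4, r / 2, by positivity, by linarith⟩
      refine ⟨Metric.closedBall x (r / 4),
        mem_nhdsWithin_of_mem_nhds (Metric.closedBall_mem_nhds x (by positivity)), β, β.contDiff,
        fun y hy => β.one_of_mem_closedBall hy, fun ψ hψ => h _ (β.contDiff.mul hψ) ?_⟩
      refine (tsupport_mul_subset_left (f := β) (g := ψ)).trans ?_
      rw [β.tsupport_eq]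
      exact Metric.closedBall_subset_ball (half_lt_self hr))
  rw [← hχ0 φ hφ]
  refine ibpDefect_congr fun x hx => ?_
  by_cases hxs : x ∈ tsupport φ
  · rw [hχ1 x ⟨hx, hxs⟩, one_mul]
  · rw [image_eq_zero_of_notMem_tsupport hxs, mul_zero]

/-- The relative boundaries of the faces of the mesh lie in finitely many flats of
codimension two. -/
theorem exists_flats (hd : 2 ≤ d) (T : PolytopicMesh Ω) :
    ∃ (n₁ n₂ : Fin T.numFace × Fin (d - 1 + 1) → E d)
      (s₁ s₂ : Fin T.numFace × Fin (d - 1 + 1) → ℝ),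
      (∀ k, ‖n₁ k‖ = 1) ∧ (∀ k, ‖n₂ k‖ = 1) ∧ (∀ k, inner ℝ (n₁ k) (n₂ k) = 0) ∧
      ∀ F, ∀ x ∈ (T.face F).closedInterior, x ∉ (T.face F).interior →
        ∃ k, inner ℝ (n₁ k) x = s₁ k ∧ inner ℝ (n₂ k) x = s₂ k := by
  choose B hB using fun F => exists_faceBasis (by omega) (T.norm_normal F) (T.normal_orthogonal F)
  choose n s hn hNn hy using fun F => exists_flat_of_coord hd ((T.face F).points 0) (B F)
  refine ⟨fun k => T.normal k.1, fun k => n k.1 k.2,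
    fun k => inner ℝ (T.normal k.1) ((T.face k.1).points 0), fun k => s k.1 k.2,
    fun k => T.norm_normal _, fun k => hn _ _, fun k => hNn _ _, fun F x hx hx' => ?_⟩
  obtain ⟨y, rfl, -⟩ := (mem_setInterior_iff (hB F)).1 hx
  obtain ⟨i, hi⟩ := exists_coord_eq_zero hd (hB F) hx hx'
  exact ⟨(F, i), hy F i y hi⟩

/-- Cutting off a flat of codimension two does not change the defect in the limit. -/
theorem tendsto_ibpDefect_mul (hd : 2 ≤ d) (hΩ : Bornology.IsBounded Ω) {c : ℝ}
    (hreg : T.PolytopicRegular c) (hw : HasWeakGrad (T.elem K) w g) (hφ : ContDiff ℝ ∞ φ)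
    {η : ℕ → E d → ℝ} (hη : ∀ n, ContDiff ℝ ∞ (η n)) (hη1 : ∀ n x, |η n x| ≤ 1)
    {Z : Set (E d)} (hZ : ∀ᵐ x : E d, x ∉ Z) (hZF : ∀ F, ∀ᵐ x ∂T.faceMeasure F, x ∉ Z)
    (hlim : ∀ x, x ∉ Z → Tendsto (fun n => η n x) atTop (𝓝 1))
    (hgrad : ∀ v, Tendsto (fun n => ∫ x in T.elem K, |w x * fderiv ℝ (η n) x v|) atTop (𝓝 0)) :
    Tendsto (fun n => ibpDefect T K w g j fun x => φ x * η n x) atTop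
      (𝓝 (ibpDefect T K w g j φ)) := by
  classical
  have hi := integrableOn_ibp (j := j) hΩ hw hφ
  set e : E d := EuclideanSpace.single j 1 with he
  have hmul : ∀ {μ : Measure (E d)} {f : E d → ℝ}, Integrable f μ → (∀ᵐ x ∂μ, x ∉ Z) →
      Tendsto (fun n => ∫ x, f x * η n x ∂μ) atTop (𝓝 (∫ x, f x ∂μ)) := by
    intro μ f hf hμ
    refine tendsto_integral_of_dominated_convergence (fun x => |f x|)
      (fun n => hf.aestronglyMeasurable.mul (hη n).continuous.aestronglyMeasurable) hf.abs
      (fun n => ae_of_all _ fun x => ?_) ?_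
    · rw [Real.norm_eq_abs, abs_mul]
      exact mul_le_of_le_one_right (abs_nonneg _) (hη1 n x)
    · filter_upwards [hμ] with x hx
      simpa using (hlim x hx).const_mul (f x)
  obtain ⟨M, hM⟩ := (isBounded_elem (T := T) (K := K) hΩ).isCompact_closure
    |>.exists_bound_of_continuousOn hφ.continuous.continuousOn
  have hvol : Tendsto (fun n => ∫ x in T.elem K, (g j x * (φ x * η n x) +
      w x * fderiv ℝ (fun x => φ x * η n x) x e)) atTop
      (𝓝 (∫ x in T.elem K, (g j x * φ x + w x * fderiv ℝ φ x e))) := by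
    have hηi : ∀ n, IntegrableOn (fun x => w x * fderiv ℝ (η n) x e) (T.elem K) := fun n =>
      (integrableOn_ibp (j := j) hΩ hw (hη n)).2
    have hcross : Tendsto (fun n => ∫ x in T.elem K, (w x * fderiv ℝ (η n) x e) * φ x) atTop
        (𝓝 0) := by
      refine squeeze_zero_norm (a := fun n => M * ∫ x in T.elem K, |w x * fderiv ℝ (η n) x e|)
        (fun n => ?_) (by simpa using (hgrad e).const_mul M)
      rw [← integral_const_mul]
      refine norm_integral_le_of_norm_le ((hηi n).abs.const_mul M) ?_
      filter_upwards [ae_restrict_mem (T.isOpen_elem K).measurableSet] with x hx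
      rw [norm_mul, mul_comm, Real.norm_eq_abs (w x * _)]
      exact mul_le_mul_of_nonneg_right (hM x (subset_closure hx)) (abs_nonneg _)
    have hmain := hmul (hi.1.add hi.2) (ae_restrict_of_ae hZ)
    have hsum := hmain.add hcross
    rw [add_zero] at hsum
    refine hsum.congr fun n => ?_
    rw [← integral_add]
    · refine integral_congr_ae (ae_of_all _ fun x => ?_)
      simp only [Pi.add_apply]
      rw [fderiv_fun_mul (hφ.differentiable (by simp) x) ((hη n).differentiable (by simp) x)]
      simp only [add_apply, smul_apply, smul_eq_mul]
      ring
    · exact integrableOn_mul_of_continuous (isBounded_elem hΩ) (hi.1.add hi.2) (hη n).continuous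
    · exact integrableOn_mul_of_continuous (isBounded_elem hΩ) (hηi n) hφ.continuous
  refine hvol.sub (tendsto_finsetSum _ fun F hF => Tendsto.const_mul _ ?_)
  have hFK : T.IsFaceOf F K := (Finset.mem_filter.1 hF).2
  simpa only [mul_assoc] using
    hmul (integrable_trace_mul hd hΩ hreg hFK hw hφ.continuous) (hZF F)

/-- Integration by parts on an element of the mesh. -/
theorem ibpDefect_eq_zero (hd : 2 ≤ d) (hΩ : Bornology.IsBounded Ω) {c : ℝ}
    (hreg : T.PolytopicRegular c) (hw : HasWeakGrad (T.elem K) w g) (hφ : ContDiff ℝ ∞ φ) :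
    ibpDefect T K w g j φ = 0 := by
  classical
  obtain ⟨n₁, n₂, s₁, s₂, h1, h2, h12, hcov⟩ := exists_flats hd T
  -- Induction over the flats that may meet the support of the test function: they are cut off one
  -- by one.
  suffices H : ∀ (A : Finset (Fin T.numFace × Fin (d - 1 + 1))) (φ : E d → ℝ), ContDiff ℝ ∞ φ →
      (∀ k ∉ A, ∀ x, inner ℝ (n₁ k) x = s₁ k → inner ℝ (n₂ k) x = s₂ k → x ∉ tsupport φ) →
      ibpDefect T K w g j φ = 0 from
    H Finset.univ φ hφ fun k hk => absurd (Finset.mem_univ k) hk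
  intro A
  induction A using Finset.induction_on with
  | empty =>
    intro φ hφ hs
    refine ibpDefect_eq_zero_of_forall_mem hd hΩ hreg hw hφ fun x hx hxs => ?_
    by_contra! hne
    have hfr : x ∈ frontier (T.elem K) := by
      rw [(T.isOpen_elem K).frontier_eq]
      exact ⟨hx, hne.1⟩
    rw [T.frontier_elem K] at hfr
    obtain ⟨F, hF, hxF⟩ := Set.mem_iUnion₂.1 hfr
    obtain ⟨k, hk1, hk2⟩ := hcov F x hxF (hne.2 F hF)
    exact hs k (Finset.notMem_empty k) x hk1 hk2 hxs
  | insert k A _ ih =>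
    intro φ hφ hs
    obtain ⟨η, hη, hη1, hηs, hηl, hηg⟩ := exists_cutoff hd (h1 k) (h2 k) (h12 k) (s₁ k) (s₂ k)
    have hZ : ∀ᵐ x : E d, x ∉ {x : E d | inner ℝ (n₁ k) x = s₁ k ∧ inner ℝ (n₂ k) x = s₂ k} := by
      have hn : n₁ k ≠ 0 := fun h => by simpa [h] using h1 k
      refine measure_mono_null (fun x hx => ?_) (volume_setOf_inner_eq hn (s₁ k))
      by_contra hne
      exact hx fun h => hne h.1
    have hlim := tendsto_ibpDefect_mul (j := j) hd hΩ hreg hw hφ hη hη1 hZ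
      (fun F => euclideanHausdorffMeasure_face_flat (by omega) (T.norm_normal F)
        (T.normal_orthogonal F) (h1 k) (h2 k) (h12 k) (s₁ k) (s₂ k)) hηl
      (hηg _ w (isBounded_elem hΩ) hw.memLp)
    refine tendsto_nhds_unique hlim ?_
    refine tendsto_const_nhds.congr fun n => (ih _ (hφ.mul (hη n))
      fun k' hk' x hx1 hx2 hxs => ?_).symm
    by_cases hkk : k' = k
    · subst hkk
      exact hηs n x hx1 hx2 (tsupport_mul_subset_right hxs)
    · exact hs k' (by simp [hkk, hk']) x hx1 hx2 (tsupport_mul_subset_left hxs)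

end GlobalIbp

/-! ### Calculus of weak gradients -/

section WeakCalculus

variable {d : ℕ} {U V : Set (E d)} {w w' : E d → ℝ} {g g' : Fin d → E d → ℝ} {φ : E d → ℝ}

theorem integrableOn_mul_of_tsupport_subset {f : E d → ℝ} (hU : IsOpen U)
    (hf : LocallyIntegrableOn f U) (hφ : Continuous φ) (hφc : HasCompactSupport φ)
    (hφs : tsupport φ ⊆ U) : IntegrableOn (fun x => f x * φ x) U := by
  have h1 : IntegrableOn (fun x => f x * φ x) (tsupport φ) :=
    (hf.integrableOn_compact_subset hφs hφc).mul_continuousOn hφ.continuousOn hφc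
  refine h1.of_forall_sdiff_eq_zero hU.measurableSet fun x hx => ?_
  rw [image_eq_zero_of_notMem_tsupport hx.2, mul_zero]

theorem HasWeakDeriv.ae_eq {j : Fin d} {g g' : E d → ℝ} (hU : IsOpen U)
    (h : HasWeakDeriv U j w g) (h' : HasWeakDeriv U j w g') : g =ᵐ[volume.restrict U] g' := by
  have hz : ∀ᵐ x : E d, x ∈ U → g x - g' x = 0 := by
    refine hU.ae_eq_zero_of_integral_contDiff_smul_eq_zero (h.2.1.sub h'.2.1)
      fun φ hφ hφc hφs => ?_
    have e : ∫ x, φ x • (g x - g' x) = ∫ x in U, (g x * φ x - g' x * φ x) := by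
      rw [← setIntegral_eq_integral_of_forall_compl_eq_zero (s := U)]
      · refine integral_congr_ae (ae_of_all _ fun x => ?_)
        simp only [smul_eq_mul]
        ring
      · intro x hx
        rw [image_eq_zero_of_notMem_tsupport fun h => hx (hφs h), zero_smul]
    have e1 := h.2.2 φ hφ hφc hφs
    have e2 := h'.2.2 φ hφ hφc hφs
    rw [e, integral_sub (integrableOn_mul_of_tsupport_subset hU h.2.1 hφ.continuous hφc hφs)
      (integrableOn_mul_of_tsupport_subset hU h'.2.1 hφ.continuous hφc hφs)]
    linarith
  filter_upwards [(ae_restrict_iff' hU.measurableSet).2 hz] with x hx using sub_eq_zero.1 hx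

theorem HasWeakDeriv.weakDeriv_ae_eq {j : Fin d} {g : E d → ℝ} (hU : IsOpen U)
    (h : HasWeakDeriv U j w g) : weakDeriv U j w =ᵐ[volume.restrict U] g := by
  have hex : ∃ g, HasWeakDeriv U j w g := ⟨g, h⟩
  rw [weakDeriv, dif_pos hex]
  exact hex.choose_spec.ae_eq hU h

theorem HasWeakGrad.of_integral (hU : volume U ≠ ⊤) (h1 : MemLp w 2 (volume.restrict U))
    (h2 : ∀ j, MemLp (g j) 2 (volume.restrict U))
    (h3 : ∀ j, ∀ φ : E d → ℝ, ContDiff ℝ ∞ φ → HasCompactSupport φ → tsupport φ ⊆ U →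
      ∫ x in U, w x * fderiv ℝ φ x (EuclideanSpace.single j 1) = -∫ x in U, g j x * φ x) :
    HasWeakGrad U w g :=
  ⟨h1, h2, fun j => ⟨(integrableOn_of_memLp_two hU h1).locallyIntegrableOn,
    (integrableOn_of_memLp_two hU (h2 j)).locallyIntegrableOn, h3 j⟩⟩

theorem HasWeakGrad.congr (hU : volume U ≠ ⊤) (h : HasWeakGrad U w g)
    (hw : w =ᵐ[volume.restrict U] w') (hg : ∀ j, g j =ᵐ[volume.restrict U] g' j) :
    HasWeakGrad U w' g' := by
  refine HasWeakGrad.of_integral hU (h.memLp.ae_eq hw) (fun j => (h.memLp_grad j).ae_eq (hg j))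
    fun j φ h1 h2 h3 => ?_
  have e1 : ∫ x in U, w' x * fderiv ℝ φ x (EuclideanSpace.single j 1) =
      ∫ x in U, w x * fderiv ℝ φ x (EuclideanSpace.single j 1) :=
    integral_congr_ae (hw.symm.mul (ae_eq_refl _))
  have e2 : ∫ x in U, g' j x * φ x = ∫ x in U, g j x * φ x :=
    integral_congr_ae ((hg j).symm.mul (ae_eq_refl _))
  rw [e1, e2]
  exact (h.hasWeakDeriv j).2.2 φ h1 h2 h3

theorem HasWeakGrad.weakDeriv_ae_eq (hU : IsOpen U) (h : HasWeakGrad U w g) (j : Fin d) :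
    weakDeriv U j w =ᵐ[volume.restrict U] g j :=
  (h.hasWeakDeriv j).weakDeriv_ae_eq hU

theorem HasWeakGrad.weakDeriv (hUo : IsOpen U) (hU : volume U ≠ ⊤) (h : HasWeakGrad U w g) :
    HasWeakGrad U w fun j => weakDeriv U j w :=
  h.congr hU (ae_eq_refl _) fun j => (h.weakDeriv_ae_eq hUo j).symm

theorem HasWeakGrad.mono (hU : IsOpen U) (hUv : volume U ≠ ⊤) (hVU : V ⊆ U)
    (h : HasWeakGrad U w g) : HasWeakGrad V w g := by
  refine HasWeakGrad.of_integral (measure_ne_top_of_subset hVU hUv)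
    (h.memLp.mono_measure (Measure.restrict_mono hVU le_rfl))
    (fun j => (h.memLp_grad j).mono_measure (Measure.restrict_mono hVU le_rfl))
    fun j φ h1 h2 h3 => ?_
  rw [← setIntegral_mul_eq_of_tsupport hU hVU (Set.inter_subset_right.trans h3),
    ← setIntegral_mul_fderiv_eq_of_tsupport hU hVU (Set.inter_subset_right.trans h3)]
  exact (h.hasWeakDeriv j).2.2 φ h1 h2 (h3.trans hVU)

theorem HasWeakGrad.sub (hUv : volume U ≠ ⊤) (h : HasWeakGrad U w g)
    (h' : HasWeakGrad U w' g') :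
    HasWeakGrad U (fun x => w x - w' x) (fun j x => g j x - g' j x) := by
  refine HasWeakGrad.of_integral hUv (h.memLp.sub h'.memLp)
    (fun j => (h.memLp_grad j).sub (h'.memLp_grad j)) fun j φ h1 h2 h3 => ?_
  have i1 : ∀ {f : E d → ℝ}, MemLp f 2 (volume.restrict U) →
      IntegrableOn (fun x => f x * φ x) U := fun hf =>
    Integrable.mul_of_continuous_compact (integrableOn_of_memLp_two hUv hf) h1.continuous h2
  have i2 : ∀ {f : E d → ℝ}, MemLp f 2 (volume.restrict U) →
      IntegrableOn (fun x => f x * fderiv ℝ φ x (EuclideanSpace.single j 1)) U := fun hf =>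
    Integrable.mul_of_continuous_compact (integrableOn_of_memLp_two hUv hf)
      (continuous_fderiv_dir h1 _) (h2.fderiv_apply ℝ _)
  simp only [sub_mul]
  rw [integral_sub (i2 h.memLp) (i2 h'.memLp),
    integral_sub (i1 (h.memLp_grad j)) (i1 (h'.memLp_grad j)),
    (h.hasWeakDeriv j).2.2 φ h1 h2 h3, (h'.hasWeakDeriv j).2.2 φ h1 h2 h3]
  ring

theorem HasWeakGrad.const_mul (hUv : volume U ≠ ⊤) (c : ℝ) (h : HasWeakGrad U w g) :
    HasWeakGrad U (fun x => c * w x) (fun j x => c * g j x) := by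
  refine HasWeakGrad.of_integral hUv (h.memLp.const_mul c)
    (fun j => (h.memLp_grad j).const_mul c) fun j φ h1 h2 h3 => ?_
  simp only [mul_assoc]
  rw [integral_const_mul, integral_const_mul, (h.hasWeakDeriv j).2.2 φ h1 h2 h3, mul_neg]

theorem memLp_of_continuous (hU : Bornology.IsBounded U) (hφ : Continuous φ) :
    MemLp φ 2 (volume.restrict U) := by
  obtain ⟨C, hC⟩ := hU.isCompact_closure.exists_bound_of_continuousOn hφ.continuousOn
  have : IsFiniteMeasure ((volume : Measure (E d)).restrict U) := ⟨by simpa using hU.measure_lt_top⟩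
  refine MemLp.of_bound hφ.aestronglyMeasurable C ?_
  have h : ∀ᵐ x ∂(volume : Measure (E d)).restrict (closure U), ‖φ x‖ ≤ C := by
    filter_upwards [ae_restrict_mem isClosed_closure.measurableSet] with x hx using hC x hx
  exact ae_mono (Measure.restrict_mono subset_closure le_rfl) h

theorem hasWeakGrad_of_contDiff (hUb : Bornology.IsBounded U) (hφ : ContDiff ℝ ∞ φ) :
    HasWeakGrad U φ (fun j x => fderiv ℝ φ x (EuclideanSpace.single j 1)) := by
  refine HasWeakGrad.of_integral hUb.measure_lt_top.ne (memLp_of_continuous hUb hφ.continuous)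
    (fun j => memLp_of_continuous hUb (continuous_fderiv_dir hφ _)) fun j ψ h1 h2 h3 => ?_
  have hψ0 : ∀ x, x ∉ U → ψ x = 0 := fun x hx =>
    image_eq_zero_of_notMem_tsupport fun h => hx (h3 h)
  have hψ'0 : ∀ x, x ∉ U → fderiv ℝ ψ x = 0 := fun x hx =>
    fderiv_eq_zero_of_notMem_tsupport fun h => hx (h3 h)
  rw [setIntegral_eq_integral_of_forall_compl_eq_zero fun x hx => by rw [hψ'0 x hx]; simp,
    setIntegral_eq_integral_of_forall_compl_eq_zero fun x hx => by rw [hψ0 x hx, mul_zero]]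
  have hψ' := h2.fderiv_apply ℝ (EuclideanSpace.single j 1)
  refine integral_mul_fderiv_eq_neg_fderiv_mul_of_integrable ?_ ?_ ?_
    (fun x _ => hφ.differentiable (by simp) x) (fun x _ => h1.differentiable (by simp) x)
  · exact ((continuous_fderiv_dir hφ _).mul h1.continuous).integrable_of_hasCompactSupport
      h2.mul_left
  · exact (hφ.continuous.mul (continuous_fderiv_dir h1 _)).integrable_of_hasCompactSupport
      hψ'.mul_left
  · exact (hφ.continuous.mul h1.continuous).integrable_of_hasCompactSupport h2.mul_left

theorem MemSobolev.exists_hasWeakGrad {k : ℕ} (h : MemSobolev U (k + 1) w) :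
    ∃ g, HasWeakGrad U w g ∧ ∀ j, MemSobolev U k (g j) := by
  choose g hg hgk using h.2
  refine ⟨g, ⟨h.1, fun j => ?_, hg⟩, hgk⟩
  cases k with
  | zero => exact hgk j
  | succ k => exact (hgk j).1

theorem HasWeakGrad.memSobolev (h : HasWeakGrad U w g) : MemSobolev U 1 w :=
  ⟨h.memLp, fun j => ⟨g j, h.hasWeakDeriv j, h.memLp_grad j⟩⟩

end WeakCalculus

/-! ### Calculus of traces -/

section TraceCalculus

variable {d : ℕ} {U V : Set (E d)} {w w' φ : E d → ℝ} {x : E d} {a b r : ℝ}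

theorem setAverage_ball_congr (h : w =ᵐ[volume.restrict U] w') (r : ℝ) :
    ⨍ y in Metric.ball x r ∩ U, w y = ⨍ y in Metric.ball x r ∩ U, w' y :=
  average_congr (ae_mono (Measure.restrict_mono Set.inter_subset_right le_rfl) h)

theorem trace_congr (h : w =ᵐ[volume.restrict U] w') : trace U w x = trace U w' x := by
  rw [trace, trace]
  simp only [setAverage_ball_congr h]

theorem HasTrace.congr (h : w =ᵐ[volume.restrict U] w') (ht : HasTrace U w x a) :
    HasTrace U w' x a := by
  rw [HasTrace] at *
  simpa only [setAverage_ball_congr h] using ht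

theorem HasTrace.sub (hw : IntegrableOn w U) (hw' : IntegrableOn w' U) (h : HasTrace U w x a)
    (h' : HasTrace U w' x b) : HasTrace U (fun y => w y - w' y) x (a - b) := by
  refine (Tendsto.sub h h').congr fun r => ?_
  rw [setAverage_eq, setAverage_eq, setAverage_eq, ← smul_sub,
    integral_sub (hw.mono_set Set.inter_subset_right) (hw'.mono_set Set.inter_subset_right)]

theorem hasTrace_of_continuous (hU : IsOpen U) (hφ : Continuous φ) (hx : x ∈ closure U)
    (hw : ∀ y ∈ U, w y = φ y) : HasTrace U w x (φ x) := by
  refine HasTrace.congr (w := φ) ((ae_restrict_mem hU.measurableSet).mono fun y hy =>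
    (hw y hy).symm) ?_
  rw [HasTrace, Metric.tendsto_nhds]
  intro ε hε
  obtain ⟨δ, hδ, h⟩ := Metric.continuous_iff.1 hφ x (ε / 2) (half_pos hε)
  filter_upwards [Ioo_mem_nhdsGT hδ] with r hr
  have hopen : IsOpen (Metric.ball x r ∩ U) := Metric.isOpen_ball.inter hU
  have hne : (Metric.ball x r ∩ U).Nonempty :=
    mem_closure_iff_nhds.1 hx _ (Metric.ball_mem_nhds x hr.1)
  have hfin : volume (Metric.ball x r ∩ U) ≠ ⊤ :=
    measure_ne_top_of_subset Set.inter_subset_left measure_ball_lt_top.ne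
  have hmem : ⨍ y in Metric.ball x r ∩ U, φ y ∈ Metric.closedBall (φ x) (ε / 2) := by
    refine (convex_closedBall _ _).set_average_mem Metric.isClosed_closedBall
      (hopen.measure_pos volume hne).ne' hfin ?_ ?_
    · filter_upwards [ae_restrict_mem hopen.measurableSet] with y hy
      exact (h y (lt_trans hy.1 hr.2)).le
    · exact (hφ.continuousOn.integrableOn_compact (isCompact_closedBall x r)).mono_set
        (Set.inter_subset_left.trans Metric.ball_subset_closedBall)
  exact lt_of_le_of_lt hmem (half_lt_self hε)

theorem HasTrace.of_ball_inter_eq (hr : 0 < r)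
    (h : Metric.ball x r ∩ U = Metric.ball x r ∩ V) (ht : HasTrace U w x a) :
    HasTrace V w x a := by
  refine Tendsto.congr' ?_ ht
  filter_upwards [Ioo_mem_nhdsGT hr] with s hs
  rw [half_ball_mono hs.2.le h]

end TraceCalculus

/-! ### Jumps across faces -/

section Jumps

variable {d : ℕ} {Ω : Set (E d)} {T : PolytopicMesh Ω} {K : Fin T.numElem} {F : Fin T.numFace}

theorem outward_plus : outward T (T.plus F) F = T.normal F := by
  rw [outward, if_pos rfl]

theorem outward_minus (hd : 2 ≤ d) (h : T.minus F = some K) :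
    outward T K F = -T.normal F := by
  rw [outward, if_neg (plus_ne_of_minus_eq hd h)]

/-- An integrable function on a face vanishes almost everywhere if, near each interior point, its
integral against every smooth bump function is zero. -/
theorem ae_eq_zero_of_local_integral_eq_zero (hd : 2 ≤ d) {f : E d → ℝ}
    (hf : Integrable f (T.faceMeasure F))
    (h : ∀ x ∈ (T.face F).interior, ∃ r > 0, ∀ ψ : E d → ℝ, ContDiff ℝ ∞ ψ →
      HasCompactSupport ψ → tsupport ψ ⊆ Metric.ball x r →
      ∫ y, ψ y * f y ∂T.faceMeasure F = 0) :
    ∀ᵐ x ∂T.faceMeasure F, f x = 0 := by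
  have hnull : T.faceMeasure F {x | x ∈ (T.face F).interior ∧ f x ≠ 0} = 0 := by
    refine measure_null_of_locally_null _ fun x hx => ?_
    obtain ⟨r, hr, hψ⟩ := h x hx.1
    have hz := Metric.isOpen_ball.ae_eq_zero_of_integral_contDiff_smul_eq_zero
      (U := Metric.ball x r) (hf.locallyIntegrable.locallyIntegrableOn _) hψ
    refine ⟨Metric.ball x r ∩ {x | x ∈ (T.face F).interior ∧ f x ≠ 0},
      inter_mem (mem_nhdsWithin_of_mem_nhds (Metric.ball_mem_nhds x hr)) self_mem_nhdsWithin, ?_⟩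
    refine measure_mono_null (fun y hy => ?_) (ae_iff.1 hz)
    exact fun hy' => hy.2.2 (hy' hy.1)
  filter_upwards [ae_mem_interior (T := T) (F := F) hd, measure_eq_zero_iff_ae_notMem.1 hnull]
    with x hx hx'
  by_contra hne
  exact hx' ⟨hx, hne⟩

/-- A broken vector field whose distributional divergence on `Ω` is its elementwise divergence has
no jump in its normal component. -/
theorem ae_normal_jump_eq_zero (hd : 2 ≤ d) (hΩo : IsOpen Ω) (hΩ : Bornology.IsBounded Ω) {c : ℝ}
    (hreg : T.PolytopicRegular c) (hm : T.minus F = some K)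
    {σ : Fin d → Fin T.numElem → E d → ℝ} {γ : Fin d → Fin T.numElem → Fin d → E d → ℝ}
    (hσ : ∀ j K, HasWeakGrad (T.elem K) (σ j K) (γ j K))
    (h : ∀ ψ : E d → ℝ, ContDiff ℝ ∞ ψ → HasCompactSupport ψ → tsupport ψ ⊆ Ω →
      ∑ K, ∫ x in T.elem K, ∑ j, (γ j K j x * ψ x +
        σ j K x * fderiv ℝ ψ x (EuclideanSpace.single j 1)) = 0) :
    ∀ᵐ x ∂T.faceMeasure F, ∑ j, T.normal F j *
      (trace (T.elem (T.plus F)) (σ j (T.plus F)) x - trace (T.elem K) (σ j K) x) = 0 := by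
  have hF1 : T.IsFaceOf F (T.plus F) := Or.inl rfl
  have hF2 : T.IsFaceOf F K := Or.inr hm
  have hne : T.plus F ≠ K := plus_ne_of_minus_eq hd hm
  have hi1 : ∀ j, Integrable (trace (T.elem (T.plus F)) (σ j (T.plus F))) (T.faceMeasure F) :=
    fun j => ((hσ j _).ae_hasTrace_and_integrable hd hΩ hreg hF1).2
  have hi2 : ∀ j, Integrable (trace (T.elem K) (σ j K)) (T.faceMeasure F) :=
    fun j => ((hσ j _).ae_hasTrace_and_integrable hd hΩ hreg hF2).2
  refine ae_eq_zero_of_local_integral_eq_zero hd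
    (integrable_finsetSum _ fun j _ => ((hi1 j).sub (hi2 j)).const_mul _) fun x hx => ?_
  obtain ⟨hxΩ, r₂, hr₂, h2⟩ := T.minus_side F K hm x hx
  obtain ⟨r₁, hr₁, h1⟩ := T.plus_side F x hx
  obtain ⟨r₃, hr₃, h3⟩ := Metric.isOpen_iff.1 hΩo x hxΩ
  obtain ⟨r₄, hr₄, h4⟩ := exists_local_ibp hd hΩ hF1 hx
  obtain ⟨r₅, hr₅, h5⟩ := exists_local_ibp hd hΩ hF2 hx
  set r := min r₁ (min r₂ (min r₃ (min r₄ r₅))) with hr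
  have l1 : r ≤ r₁ := min_le_left _ _
  have l2 : r ≤ r₂ := (min_le_right _ _).trans (min_le_left _ _)
  have l3 : r ≤ r₃ := (min_le_right _ _).trans ((min_le_right _ _).trans (min_le_left _ _))
  have l4 : r ≤ r₄ := (min_le_right _ _).trans ((min_le_right _ _).trans
    ((min_le_right _ _).trans (min_le_left _ _)))
  have l5 : r ≤ r₅ := (min_le_right _ _).trans ((min_le_right _ _).trans
    ((min_le_right _ _).trans (min_le_right _ _)))
  refine ⟨r, lt_min hr₁ (lt_min hr₂ (lt_min hr₃ (lt_min hr₄ hr₅))), fun ψ hψ hψc hψs => ?_⟩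
  have hsum := h ψ hψ hψc (hψs.trans ((Metric.ball_subset_ball l3).trans h3))
  have hN : T.normal F ≠ 0 := fun h0 => by simpa [h0] using T.norm_normal F
  -- Up to a null set, the ball is covered by the two elements which share the face.
  have hrest : ∀ K', K' ≠ T.plus F ∧ K' ≠ K → ∫ x in T.elem K', ∑ j, (γ j K' j x * ψ x +
      σ j K' x * fderiv ℝ ψ x (EuclideanSpace.single j 1)) = 0 := by
    rintro K' ⟨hK1, hK2⟩
    refine integral_eq_zero_of_ae ?_
    have hplane : ∀ᵐ y : E d, ¬ inner ℝ (T.normal F) y = inner ℝ (T.normal F) x :=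
      measure_eq_zero_iff_ae_notMem.1 (volume_setOf_inner_eq hN (inner ℝ (T.normal F) x))
    filter_upwards [ae_restrict_of_ae hplane, ae_restrict_mem (T.isOpen_elem K').measurableSet]
      with y hy hyK
    have hyb : y ∉ tsupport ψ := by
      intro hyψ
      have hyr := hψs hyψ
      have hne0 : inner ℝ (T.normal F) (y - x) ≠ 0 := by
        rw [inner_sub_right]
        exact sub_ne_zero.2 hy
      rcases lt_or_gt_of_ne hne0 with hlt | hgt
      · have hmem : y ∈ Metric.ball x r₁ ∩ {y | inner ℝ (T.normal F) (y - x) < 0} :=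
          ⟨Metric.ball_subset_ball l1 hyr, hlt⟩
        rw [← h1] at hmem
        exact Set.disjoint_left.1 (T.disjoint_elem hK1) hyK hmem.2
      · have hmem : y ∈ Metric.ball x r₂ ∩ {y | 0 < inner ℝ (T.normal F) (y - x)} :=
          ⟨Metric.ball_subset_ball l2 hyr, hgt⟩
        rw [← h2] at hmem
        exact Set.disjoint_left.1 (T.disjoint_elem hK2) hyK hmem.2
    rw [fderiv_eq_zero_of_notMem_tsupport hyb, image_eq_zero_of_notMem_tsupport hyb]
    simp
  rw [Finset.sum_eq_add (T.plus F) K hne (fun K' _ hK' => hrest K' hK') (by simp) (by simp)] at hsum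
  have hint : ∀ K' j, IntegrableOn (fun x => γ j K' j x * ψ x +
      σ j K' x * fderiv ℝ ψ x (EuclideanSpace.single j 1)) (T.elem K') := fun K' j =>
    (integrableOn_ibp hΩ (hσ j K') hψ).1.add (integrableOn_ibp hΩ (hσ j K') hψ).2
  rw [integral_finsetSum _ fun j _ => hint _ j, integral_finsetSum _ fun j _ => hint _ j] at hsum
  simp only [fun j => h4 _ _ (hσ j _) ψ hψ (hψs.trans (Metric.ball_subset_ball l4)) j,
    fun j => h5 _ _ (hσ j _) ψ hψ (hψs.trans (Metric.ball_subset_ball l5)) j, outward_plus,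
    outward_minus hd hm] at hsum
  have k1 : ∀ j, Integrable (fun x => trace (T.elem (T.plus F)) (σ j (T.plus F)) x * ψ x)
      (T.faceMeasure F) := fun j => integrable_trace_mul hd hΩ hreg hF1 (hσ j _) hψ.continuous
  have k2 : ∀ j, Integrable (fun x => trace (T.elem K) (σ j K) x * ψ x)
      (T.faceMeasure F) := fun j => integrable_trace_mul hd hΩ hreg hF2 (hσ j _) hψ.continuous
  rw [← hsum, ← Finset.sum_add_distrib]
  calc _ = ∫ y, ∑ j, T.normal F j * (trace (T.elem (T.plus F)) (σ j (T.plus F)) y * ψ y -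
        trace (T.elem K) (σ j K) y * ψ y) ∂T.faceMeasure F := by
        refine integral_congr_ae (ae_of_all _ fun y => ?_)
        simp only [Finset.mul_sum]
        exact Finset.sum_congr rfl fun j _ => by ring
    _ = _ := by
        have k3 : ∀ j, Integrable (fun x => T.normal F j *
            (trace (T.elem (T.plus F)) (σ j (T.plus F)) x * ψ x -
              trace (T.elem K) (σ j K) x * ψ x)) (T.faceMeasure F) := fun j =>
          ((k1 j).sub (k2 j)).const_mul _
        rw [integral_finsetSum _ fun j _ => k3 j]
        refine Finset.sum_congr rfl fun j _ => ?_
        rw [integral_const_mul, integral_sub (k1 j) (k2 j), PiLp.neg_apply]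
        ring

/-- The boundary of an element is covered by finitely many hyperplanes. -/
theorem volume_frontier_elem (hd : 2 ≤ d) : volume (frontier (T.elem K)) = 0 := by
  rw [T.frontier_elem K]
  refine (measure_biUnion_null_iff (Set.to_countable _)).2 fun F _ => ?_
  have hN : T.normal F ≠ 0 := fun h0 => by simpa [h0] using T.norm_normal F
  obtain ⟨B, hB⟩ := exists_faceBasis (by omega) (T.norm_normal F) (T.normal_orthogonal F)
  refine measure_mono_null (fun x hx => ?_)
    (volume_setOf_inner_eq hN (inner ℝ (T.normal F) ((T.face F).points 0)))
  obtain ⟨y, rfl, -⟩ := (mem_setInterior_iff hB).1 hx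
  change inner ℝ _ (planeEmb _ _ _) = _
  rw [planeEmb, inner_add_right, inner_perp, add_zero]

/-- The elements cover the domain up to a null set. -/
theorem sum_setIntegral_elem (hd : 2 ≤ d) {f : E d → ℝ}
    (hf : IntegrableOn f Ω) : ∑ K, ∫ x in T.elem K, f x = ∫ x in Ω, f x := by
  have hae : (Ω : Set (E d)) =ᵐ[volume] ⋃ K, T.elem K := by
    refine ae_eq_set.2 ⟨?_, ?_⟩
    · refine measure_mono_null (t := ⋃ K, frontier (T.elem K)) (fun x hx => ?_)
        (measure_iUnion_null fun K => volume_frontier_elem hd)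
      have hcl : x ∈ closure Ω := subset_closure hx.1
      rw [T.closure_eq] at hcl
      obtain ⟨K, hK⟩ := Set.mem_iUnion.1 hcl
      refine Set.mem_iUnion.2 ⟨K, ?_⟩
      rw [(T.isOpen_elem K).frontier_eq]
      exact ⟨hK, fun h => hx.2 (Set.mem_iUnion.2 ⟨K, h⟩)⟩
    · rw [Set.sdiff_eq_empty.2 (Set.iUnion_subset fun K => T.elem_subset K), measure_empty]
  rw [setIntegral_congr_set hae, integral_iUnion_fintype
    (fun K => (T.isOpen_elem K).measurableSet) T.disjoint_elem
    fun K => hf.mono_set (T.elem_subset K)]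

theorem trace_zero {U : Set (E d)} {x : E d} : trace U (fun _ => 0) x = 0 :=
  trace_eq (by simp [HasTrace])

/-- Functions in `H^1(Ω)` have no jumps across interior faces. -/
theorem HasWeakGrad.ae_jump_eq_zero (hd : 2 ≤ d) (hΩo : IsOpen Ω) (hΩ : Bornology.IsBounded Ω)
    {c : ℝ} (hreg : T.PolytopicRegular c) (hm : T.minus F = some K) {w : E d → ℝ}
    {g : Fin d → E d → ℝ} (hw : HasWeakGrad Ω w g) :
    ∀ᵐ x ∂T.faceMeasure F, trace (T.elem (T.plus F)) w x = trace (T.elem K) w x := by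
  have hΩv : volume Ω ≠ ⊤ := hΩ.measure_lt_top.ne
  have hk : ∀ k, ∀ᵐ x ∂T.faceMeasure F, T.normal F k *
      (trace (T.elem (T.plus F)) w x - trace (T.elem K) w x) = 0 := by
    intro k
    -- The vector field `w e_k`.
    have h := ae_normal_jump_eq_zero hd hΩo hΩ hreg hm
      (σ := fun j _ x => (if j = k then (1 : ℝ) else 0) * w x)
      (γ := fun j _ l x => (if j = k then (1 : ℝ) else 0) * g l x)
      (fun j K => (hw.mono hΩo hΩv (T.elem_subset K)).const_mul (elem_measure_ne_top hΩ) _)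
      (fun ψ hψ hψc hψs => by
        have e : ∀ x, ∑ j, ((if j = k then (1 : ℝ) else 0) * g j x * ψ x +
            (if j = k then (1 : ℝ) else 0) * w x * fderiv ℝ ψ x (EuclideanSpace.single j 1)) =
            g k x * ψ x + w x * fderiv ℝ ψ x (EuclideanSpace.single k 1) := by
          intro x
          rw [Finset.sum_eq_single k (fun j _ hj => by simp [hj]) (by simp)]
          simp
        simp only [e]
        have i1 : IntegrableOn (fun x => g k x * ψ x) Ω :=
          Integrable.mul_of_continuous_compact
            (integrableOn_of_memLp_two hΩv (hw.memLp_grad k)) hψ.continuous hψc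
        have i2 : IntegrableOn (fun x => w x * fderiv ℝ ψ x (EuclideanSpace.single k 1)) Ω :=
          Integrable.mul_of_continuous_compact (hw.integrableOn hΩv)
            (continuous_fderiv_dir hψ _) (hψc.fderiv_apply ℝ _)
        have i3 : IntegrableOn (fun x => g k x * ψ x +
            w x * fderiv ℝ ψ x (EuclideanSpace.single k 1)) Ω := i1.add i2
        rw [sum_setIntegral_elem hd i3, integral_add i1 i2,
          (hw.hasWeakDeriv k).2.2 ψ hψ hψc hψs, add_neg_cancel])
    filter_upwards [h] with x hx
    rw [Finset.sum_eq_single k (fun j _ hj => by simp [hj, trace_zero]) (by simp)] at hx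
    simpa using hx
  have hN : T.normal F ≠ 0 := fun h0 => by simpa [h0] using T.norm_normal F
  obtain ⟨k, hNk⟩ : ∃ k, T.normal F k ≠ 0 := by
    by_contra! h0
    exact hN (PiLp.ext h0)
  filter_upwards [hk k] with x hx
  exact sub_eq_zero.1 ((mul_eq_zero.1 hx).resolve_left hNk)

/-- The homogeneous Dirichlet condition, read on a boundary face. -/
theorem ae_trace_eq_zero_of_boundary (hd : 2 ≤ d) (hm : T.minus F = none) {w : E d → ℝ}
    (hw : ∀ᵐ x ∂(μHE[d - 1] : Measure (E d)).restrict (frontier Ω), HasTrace Ω w x 0) :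
    ∀ᵐ x ∂T.faceMeasure F, trace (T.elem (T.plus F)) w x = 0 := by
  have h := ae_restrict_of_ae (s := (T.face F).closedInterior)
    ((ae_restrict_iff' isClosed_frontier.measurableSet).1 hw)
  filter_upwards [h, ae_mem_interior (T := T) (F := F) hd] with x hx hxF
  obtain ⟨r₁, hr₁, h1⟩ := T.boundary_side F hm x hxF
  obtain ⟨r₂, hr₂, h2⟩ := T.plus_side F x hxF
  have hxfr : x ∈ frontier Ω := by
    have hcl : x ∈ closure (T.elem (T.plus F)) := frontier_subset_closure
      (closedInterior_subset_frontier (Or.inl rfl) ((T.face F).interior_subset_closedInterior hxF))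
    refine ⟨closure_mono (T.elem_subset _) hcl, fun hxΩ => ?_⟩
    have hmem : x ∈ Metric.ball x r₁ ∩ Ω := ⟨Metric.mem_ball_self hr₁, interior_subset hxΩ⟩
    rw [h1] at hmem
    have hlt : inner ℝ (T.normal F) (x - x) < 0 := hmem.2
    simp at hlt
  refine trace_eq ((hx hxfr).of_ball_inter_eq (lt_min hr₁ hr₂) ?_)
  rw [half_ball_mono (min_le_left r₁ r₂) h1, half_ball_mono (min_le_right r₁ r₂) h2]

end Jumps

/-! ### Broken Sobolev spaces -/

section Broken

variable {d : ℕ} {Ω : Set (E d)} {T : PolytopicMesh Ω} {K : Fin T.numElem} {F : Fin T.numFace}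

/-- The broken Sobolev space `H^1` of the mesh. -/
def BrokenH1 (T : PolytopicMesh Ω) (w : E d → ℝ) : Prop :=
  ∀ K, ∃ g, HasWeakGrad (T.elem K) w g

/-- The broken Sobolev space `H^2` of the mesh. -/
def BrokenH2 (T : PolytopicMesh Ω) (w : E d → ℝ) : Prop :=
  ∀ K, ∃ g, HasWeakGrad (T.elem K) w g ∧ ∀ j, ∃ g', HasWeakGrad (T.elem K) (g j) g'

/-- `w` agrees on each element with a function that is smooth on the whole space. -/
def PiecewiseSmooth (T : PolytopicMesh Ω) (w : E d → ℝ) : Prop :=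
  ∀ K, ∃ φ : E d → ℝ, ContDiff ℝ ∞ φ ∧ ∀ x ∈ T.elem K, w x = φ x

variable {w w' : E d → ℝ}

theorem ae_elem_of_forall {P : E d → Prop} (h : ∀ x ∈ T.elem K, P x) :
    ∀ᵐ x ∂volume.restrict (T.elem K), P x :=
  (ae_restrict_mem (T.isOpen_elem K).measurableSet).mono h

theorem BrokenH2.brokenH1 (h : BrokenH2 T w) : BrokenH1 T w := fun K =>
  let ⟨g, hg, _⟩ := h K
  ⟨g, hg⟩

theorem BrokenH1.hasWeakGrad (hΩ : Bornology.IsBounded Ω) (h : BrokenH1 T w) (K) :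
    HasWeakGrad (T.elem K) w fun j => weakDeriv (T.elem K) j w :=
  let ⟨_, hg⟩ := h K
  hg.weakDeriv (T.isOpen_elem K) (elem_measure_ne_top hΩ)

theorem BrokenH2.hasWeakGrad_weakDeriv (hΩ : Bornology.IsBounded Ω) (h : BrokenH2 T w) (K j) :
    ∃ g, HasWeakGrad (T.elem K) (weakDeriv (T.elem K) j w) g := by
  obtain ⟨g, hg, hg'⟩ := h K
  obtain ⟨g', hg'⟩ := hg' j
  exact ⟨g', hg'.congr (elem_measure_ne_top hΩ)
    (hg.weakDeriv_ae_eq (T.isOpen_elem K) j).symm fun _ => ae_eq_refl _⟩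

theorem BrokenH1.sub (hΩ : Bornology.IsBounded Ω) (h : BrokenH1 T w) (h' : BrokenH1 T w') :
    BrokenH1 T fun x => w x - w' x := fun K =>
  ⟨_, (h.hasWeakGrad hΩ K).sub (elem_measure_ne_top hΩ) (h'.hasWeakGrad hΩ K)⟩

theorem brokenH1_of_memSobolev (hΩo : IsOpen Ω) (hΩ : Bornology.IsBounded Ω)
    (h : MemSobolev Ω 1 w) : BrokenH1 T w := by
  obtain ⟨g, hg, -⟩ := h.exists_hasWeakGrad
  exact fun K => ⟨g, hg.mono hΩo hΩ.measure_lt_top.ne (T.elem_subset K)⟩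

theorem brokenH2_of_memSobolev (hΩo : IsOpen Ω) (hΩ : Bornology.IsBounded Ω)
    (h : MemSobolev Ω 2 w) : BrokenH2 T w := by
  obtain ⟨g, hg, hg1⟩ := h.exists_hasWeakGrad
  refine fun K => ⟨g, hg.mono hΩo hΩ.measure_lt_top.ne (T.elem_subset K), fun j => ?_⟩
  exact brokenH1_of_memSobolev hΩo hΩ (hg1 j) K

theorem hasWeakGrad_of_eqOn (hΩ : Bornology.IsBounded Ω) {φ : E d → ℝ} (hφ : ContDiff ℝ ∞ φ)
    (h : ∀ x ∈ T.elem K, w x = φ x) :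
    HasWeakGrad (T.elem K) w (fun j x => fderiv ℝ φ x (EuclideanSpace.single j 1)) :=
  (hasWeakGrad_of_contDiff (isBounded_elem hΩ) hφ).congr (elem_measure_ne_top hΩ)
    (ae_elem_of_forall fun x hx => (h x hx).symm) fun _ => ae_eq_refl _

theorem PiecewiseSmooth.brokenH2 (hΩ : Bornology.IsBounded Ω) (h : PiecewiseSmooth T w) :
    BrokenH2 T w := by
  intro K
  obtain ⟨φ, hφ, hw⟩ := h K
  exact ⟨_, hasWeakGrad_of_eqOn hΩ hφ hw, fun j =>
    ⟨_, hasWeakGrad_of_contDiff (isBounded_elem hΩ)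
      ((hφ.fderiv_right (by simp)).clm_apply contDiff_const)⟩⟩

theorem contDiff_mvPolynomial_eval (P : MvPolynomial (Fin d) ℝ) :
    ContDiff ℝ ∞ fun x : E d => MvPolynomial.eval (fun i => x i) P := by
  induction P using MvPolynomial.induction_on with
  | C a => simpa using contDiff_const
  | add p q hp hq => simpa using hp.add hq
  | mul_X p i hp =>
    have hi : ContDiff ℝ ∞ fun x : E d => x i := by fun_prop
    simpa using hp.mul hi

theorem piecewiseSmooth_of_isPiecewisePoly {k : ℕ} (h : T.IsPiecewisePoly k w) :
    PiecewiseSmooth T w := fun K =>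
  let ⟨P, _, hP⟩ := h K
  ⟨_, contDiff_mvPolynomial_eval P, hP⟩

/-! ### Functions on the faces -/

/-- `f` agrees almost everywhere on the face `F` with a continuous function. -/
def AEContinuousOnFace (T : PolytopicMesh Ω) (F : Fin T.numFace) (f : E d → ℝ) : Prop :=
  ∃ J : E d → ℝ, Continuous J ∧ f =ᵐ[T.faceMeasure F] J

variable {f f' : E d → ℝ}

theorem AEContinuousOnFace.integrable_mul (h : Integrable f (T.faceMeasure F))
    (h' : AEContinuousOnFace T F f') : Integrable (fun x => f x * f' x) (T.faceMeasure F) := by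
  obtain ⟨J, hJ, hfJ⟩ := h'
  exact (integrableOn_mul_of_continuous (T.face F).isCompact_closedInterior.isBounded h hJ).congr
    ((ae_eq_refl _).mul hfJ.symm)

theorem AEContinuousOnFace.integrable (hd : 1 ≤ d) (h : AEContinuousOnFace T F f) :
    Integrable f (T.faceMeasure F) := by
  have := isFiniteMeasure_faceMeasure (T := T) (F := F) hd
  simpa using h.integrable_mul (integrable_const (1 : ℝ))

theorem AEContinuousOnFace.mul (h : AEContinuousOnFace T F f) (h' : AEContinuousOnFace T F f') :
    AEContinuousOnFace T F fun x => f x * f' x :=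
  let ⟨_, hJ, hf⟩ := h
  let ⟨_, hJ', hf'⟩ := h'
  ⟨_, hJ.mul hJ', hf.mul hf'⟩

theorem AEContinuousOnFace.sub (h : AEContinuousOnFace T F f) (h' : AEContinuousOnFace T F f') :
    AEContinuousOnFace T F fun x => f x - f' x :=
  let ⟨_, hJ, hf⟩ := h
  let ⟨_, hJ', hf'⟩ := h'
  ⟨_, hJ.sub hJ', hf.sub hf'⟩

theorem AEContinuousOnFace.add (h : AEContinuousOnFace T F f) (h' : AEContinuousOnFace T F f') :
    AEContinuousOnFace T F fun x => f x + f' x :=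
  let ⟨_, hJ, hf⟩ := h
  let ⟨_, hJ', hf'⟩ := h'
  ⟨_, hJ.add hJ', hf.add hf'⟩

theorem AEContinuousOnFace.congr (h : AEContinuousOnFace T F f) (h' : f' =ᵐ[T.faceMeasure F] f) :
    AEContinuousOnFace T F f' :=
  let ⟨_, hJ, hf⟩ := h
  ⟨_, hJ, h'.trans hf⟩

theorem aeContinuousOnFace_const (c : ℝ) : AEContinuousOnFace T F fun _ => c :=
  ⟨_, continuous_const, ae_eq_refl _⟩

/-- On the faces of an element, the trace of a smooth function is its restriction. -/
theorem ae_trace_eq_of_eqOn (hF : T.IsFaceOf F K) {φ : E d → ℝ} (hφ : Continuous φ)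
    (h : ∀ x ∈ T.elem K, w x = φ x) : ∀ᵐ x ∂T.faceMeasure F, trace (T.elem K) w x = φ x := by
  filter_upwards [ae_restrict_mem (T.face F).isClosed_closedInterior.measurableSet] with x hx
  exact trace_eq (hasTrace_of_continuous (T.isOpen_elem K) hφ
    (frontier_subset_closure (closedInterior_subset_frontier hF hx)) h)

theorem PiecewiseSmooth.aeContinuousOnFace_trace (h : PiecewiseSmooth T w)
    (hF : T.IsFaceOf F K) : AEContinuousOnFace T F (trace (T.elem K) w) :=
  let ⟨φ, hφ, hw⟩ := h K
  ⟨φ, hφ.continuous, ae_trace_eq_of_eqOn hF hφ.continuous hw⟩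

theorem PiecewiseSmooth.aeContinuousOnFace_trace_weakDeriv (hΩ : Bornology.IsBounded Ω)
    (h : PiecewiseSmooth T w) (hF : T.IsFaceOf F K) (c : ℝ) (j : Fin d) :
    AEContinuousOnFace T F (trace (T.elem K) fun y => c * weakDeriv (T.elem K) j w y) := by
  obtain ⟨φ, hφ, hw⟩ := h K
  have hφ' : Continuous fun x => c * fderiv ℝ φ x (EuclideanSpace.single j 1) :=
    continuous_const.mul (continuous_fderiv_dir hφ _)
  refine ⟨_, hφ', ?_⟩
  filter_upwards [ae_trace_eq_of_eqOn hF hφ' fun x _ => rfl] with x hx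
  rw [← hx]
  refine trace_congr ?_
  filter_upwards [(hasWeakGrad_of_eqOn hΩ hφ hw).weakDeriv_ae_eq (T.isOpen_elem K) j] with y hy
  rw [hy]

/-- The trace is linear on the faces of an element. -/
theorem HasWeakGrad.ae_trace_sub (hd : 2 ≤ d) (hΩ : Bornology.IsBounded Ω) {c : ℝ}
    (hreg : T.PolytopicRegular c) (hF : T.IsFaceOf F K) {g g' : Fin d → E d → ℝ}
    (h : HasWeakGrad (T.elem K) w g) (h' : HasWeakGrad (T.elem K) w' g') :
    ∀ᵐ x ∂T.faceMeasure F, trace (T.elem K) (fun y => w y - w' y) x =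
      trace (T.elem K) w x - trace (T.elem K) w' x := by
  filter_upwards [(h.ae_hasTrace_and_integrable hd hΩ hreg hF).1,
    (h'.ae_hasTrace_and_integrable hd hΩ hreg hF).1] with x hx hx'
  exact trace_eq (hx.sub (h.integrableOn (elem_measure_ne_top hΩ))
    (h'.integrableOn (elem_measure_ne_top hΩ)) hx')

theorem jump_of_some (hm : T.minus F = some K) (w : E d → ℝ) (x : E d) :
    T.jump F w x = trace (T.elem (T.plus F)) w x - trace (T.elem K) w x := by
  simp only [PolytopicMesh.jump, hm]

theorem jump_of_none (hm : T.minus F = none) (w : E d → ℝ) (x : E d) :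
    T.jump F w x = trace (T.elem (T.plus F)) w x := by
  simp only [PolytopicMesh.jump, hm, sub_zero]

theorem avg_of_some (hm : T.minus F = some K) (w : Fin T.numElem → E d → ℝ) (x : E d) :
    T.avg F w x =
      (trace (T.elem (T.plus F)) (w (T.plus F)) x + trace (T.elem K) (w K) x) / 2 := by
  simp only [PolytopicMesh.avg, hm]

theorem avg_of_none (hm : T.minus F = none) (w : Fin T.numElem → E d → ℝ) (x : E d) :
    T.avg F w x = trace (T.elem (T.plus F)) (w (T.plus F)) x := by
  simp only [PolytopicMesh.avg, hm]

theorem ae_jump_sub (hd : 2 ≤ d) (hΩ : Bornology.IsBounded Ω) {c : ℝ}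
    (hreg : T.PolytopicRegular c) (h : BrokenH1 T w) (h' : BrokenH1 T w') :
    ∀ᵐ x ∂T.faceMeasure F, T.jump F (fun y => w y - w' y) x = T.jump F w x - T.jump F w' x := by
  have h1 := (h.hasWeakGrad hΩ (T.plus F)).ae_trace_sub hd hΩ hreg (F := F) (Or.inl rfl)
    (h'.hasWeakGrad hΩ (T.plus F))
  rcases hm : T.minus F with _ | K
  · filter_upwards [h1] with x hx
    simp only [jump_of_none hm, hx]
  · filter_upwards [h1, (h.hasWeakGrad hΩ K).ae_trace_sub hd hΩ hreg (F := F) (Or.inr hm)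
      (h'.hasWeakGrad hΩ K)] with x hx hx'
    simp only [jump_of_some hm, hx, hx']
    ring

theorem integrable_jump (hd : 2 ≤ d) (hΩ : Bornology.IsBounded Ω) {c : ℝ}
    (hreg : T.PolytopicRegular c) (h : BrokenH1 T w) :
    Integrable (T.jump F w) (T.faceMeasure F) := by
  have h1 := ((h.hasWeakGrad hΩ (T.plus F)).ae_hasTrace_and_integrable hd hΩ hreg (F := F)
    (Or.inl rfl)).2
  rcases hm : T.minus F with _ | K
  · exact h1.congr (ae_of_all _ fun x => (jump_of_none hm w x).symm)
  · exact (h1.sub ((h.hasWeakGrad hΩ K).ae_hasTrace_and_integrable hd hΩ hreg (F := F)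
      (Or.inr hm)).2).congr (ae_of_all _ fun x => (jump_of_some hm w x).symm)

theorem PiecewiseSmooth.aeContinuousOnFace_jump (h : PiecewiseSmooth T w) :
    AEContinuousOnFace T F (T.jump F w) := by
  have h1 := h.aeContinuousOnFace_trace (F := F) (K := T.plus F) (Or.inl rfl)
  rcases hm : T.minus F with _ | K
  · exact h1.congr (ae_of_all _ fun x => jump_of_none hm w x)
  · exact (h1.sub (h.aeContinuousOnFace_trace (F := F) (K := K) (Or.inr hm))).congr
      (ae_of_all _ fun x => jump_of_some hm w x)

variable {v v' : Fin T.numElem → E d → ℝ}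

theorem ae_avg_sub (hd : 2 ≤ d) (hΩ : Bornology.IsBounded Ω) {c : ℝ}
    (hreg : T.PolytopicRegular c) (h : ∀ K, ∃ g, HasWeakGrad (T.elem K) (v K) g)
    (h' : ∀ K, ∃ g, HasWeakGrad (T.elem K) (v' K) g) :
    ∀ᵐ x ∂T.faceMeasure F, T.avg F (fun K y => v K y - v' K y) x = T.avg F v x - T.avg F v' x := by
  choose g hg using h
  choose g' hg' using h'
  have h1 := (hg (T.plus F)).ae_trace_sub hd hΩ hreg (F := F) (Or.inl rfl) (hg' (T.plus F))
  rcases hm : T.minus F with _ | K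
  · filter_upwards [h1] with x hx
    simp only [avg_of_none hm, hx]
  · filter_upwards [h1, (hg K).ae_trace_sub hd hΩ hreg (F := F) (Or.inr hm) (hg' K)] with x hx hx'
    simp only [avg_of_some hm, hx, hx']
    ring

theorem avg_congr (h : ∀ K, v K =ᵐ[volume.restrict (T.elem K)] v' K) (x : E d) :
    T.avg F v x = T.avg F v' x := by
  rcases hm : T.minus F with _ | K
  · rw [avg_of_none hm, avg_of_none hm, trace_congr (h _)]
  · rw [avg_of_some hm, avg_of_some hm, trace_congr (h _), trace_congr (h K)]

theorem integrable_avg (hd : 2 ≤ d) (hΩ : Bornology.IsBounded Ω) {c : ℝ}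
    (hreg : T.PolytopicRegular c) (h : ∀ K, ∃ g, HasWeakGrad (T.elem K) (v K) g) :
    Integrable (T.avg F v) (T.faceMeasure F) := by
  choose g hg using h
  have h1 := ((hg (T.plus F)).ae_hasTrace_and_integrable hd hΩ hreg (F := F) (Or.inl rfl)).2
  rcases hm : T.minus F with _ | K
  · exact h1.congr (ae_of_all _ fun x => (avg_of_none hm v x).symm)
  · exact ((h1.add ((hg K).ae_hasTrace_and_integrable hd hΩ hreg (F := F)
      (Or.inr hm)).2).div_const 2).congr (ae_of_all _ fun x => (avg_of_some hm v x).symm)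

theorem aeContinuousOnFace_avg
    (h : ∀ K, T.IsFaceOf F K → AEContinuousOnFace T F (trace (T.elem K) (v K))) :
    AEContinuousOnFace T F (T.avg F v) := by
  have h1 := h (T.plus F) (Or.inl rfl)
  rcases hm : T.minus F with _ | K
  · exact h1.congr (ae_of_all _ fun x => avg_of_none hm v x)
  · refine ((h1.add (h K (Or.inr hm))).mul (aeContinuousOnFace_const (1 / 2))).congr
      (ae_of_all _ fun x => ?_)
    simp only [avg_of_some hm v x]
    ring

end Broken

/-! ### Linearity of the discrete forms -/

section Linearity

variable {d : ℕ} {Ω : Set (E d)} {S : Scheme Ω} {K : Fin S.mesh.numElem} {F : Fin S.mesh.numFace}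
  {u u' v : E d → Fin d → ℝ} {p p' q : E d → ℝ} {c : ℝ}

theorem integral_sub_of_ae {α : Type*} [MeasurableSpace α] {μ : Measure α} {f g k : α → ℝ}
    (hf : Integrable f μ) (hg : Integrable g μ) (h : ∀ᵐ x ∂μ, k x = f x - g x) :
    ∫ x, k x ∂μ = (∫ x, f x ∂μ) - ∫ x, g x ∂μ := by
  rw [← integral_sub hf hg]
  exact integral_congr_ae h

theorem memLp_brokenGrad (hΩ : Bornology.IsBounded Ω) (h : ∀ i, BrokenH1 S.mesh fun y => u y i)
    (i j : Fin d) (K) : MemLp (S.brokenGrad u i j K) 2 (volume.restrict (S.mesh.elem K)) :=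
  ((h i).hasWeakGrad hΩ K).memLp_grad j

theorem ae_brokenGrad_sub (hΩ : Bornology.IsBounded Ω) (h : ∀ i, BrokenH1 S.mesh fun y => u y i)
    (h' : ∀ i, BrokenH1 S.mesh fun y => u' y i) (K) :
    ∀ᵐ x ∂volume.restrict (S.mesh.elem K), ∀ i j, S.brokenGrad (u - u') i j K x =
      S.brokenGrad u i j K x - S.brokenGrad u' i j K x :=
  ae_all_iff.2 fun i => ae_all_iff.2 fun j =>
    (((h i).hasWeakGrad hΩ K).sub (elem_measure_ne_top hΩ)
      ((h' i).hasWeakGrad hΩ K)).weakDeriv_ae_eq (S.mesh.isOpen_elem K) j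

theorem ae_jumpTensor_sub (hd : 2 ≤ d) (hΩ : Bornology.IsBounded Ω)
    (hreg : S.mesh.PolytopicRegular c) (h : ∀ i, BrokenH1 S.mesh fun y => u y i)
    (h' : ∀ i, BrokenH1 S.mesh fun y => u' y i) :
    ∀ᵐ x ∂S.mesh.faceMeasure F, ∀ i j, S.jumpTensor F (u - u') i j x =
      S.jumpTensor F u i j x - S.jumpTensor F u' i j x := by
  filter_upwards [ae_all_iff.2 fun i => ae_jump_sub (F := F) hd hΩ hreg (h i) (h' i)]
    with x hx i j
  have e : S.mesh.jump F (fun y => (u - u') y i) x = _ := hx i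
  rw [Scheme.jumpTensor, e, sub_mul]
  rfl

theorem integrable_jumpTensor (hd : 2 ≤ d) (hΩ : Bornology.IsBounded Ω)
    (hreg : S.mesh.PolytopicRegular c) (h : ∀ i, BrokenH1 S.mesh fun y => u y i) (i j : Fin d) :
    Integrable (S.jumpTensor F u i j) (S.mesh.faceMeasure F) :=
  (integrable_jump hd hΩ hreg (h i)).mul_const _

theorem aeContinuousOnFace_jumpTensor (h : ∀ i, PiecewiseSmooth S.mesh fun y => v y i)
    (i j : Fin d) : AEContinuousOnFace S.mesh F (S.jumpTensor F v i j) :=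
  (h i).aeContinuousOnFace_jump.mul (aeContinuousOnFace_const _)

theorem exists_hasWeakGrad_flux (hΩ : Bornology.IsBounded Ω)
    (h : ∀ i, BrokenH2 S.mesh fun y => u y i) (i j : Fin d) (K) :
    ∃ g, HasWeakGrad (S.mesh.elem K) (fun y => S.mu K * S.brokenGrad u i j K y) g := by
  obtain ⟨g, hg⟩ := (h i).hasWeakGrad_weakDeriv hΩ K j
  exact ⟨_, hg.const_mul (elem_measure_ne_top hΩ) (S.mu K)⟩

theorem ae_avgFlux_sub (hd : 2 ≤ d) (hΩ : Bornology.IsBounded Ω)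
    (hreg : S.mesh.PolytopicRegular c) (h : ∀ i, BrokenH2 S.mesh fun y => u y i)
    (h' : ∀ i, BrokenH2 S.mesh fun y => u' y i) :
    ∀ᵐ x ∂S.mesh.faceMeasure F, ∀ i j, S.avgFlux F (u - u') i j x =
      S.avgFlux F u i j x - S.avgFlux F u' i j x := by
  refine ae_all_iff.2 fun i => ae_all_iff.2 fun j => ?_
  filter_upwards [ae_avg_sub (F := F) hd hΩ hreg (exists_hasWeakGrad_flux hΩ h i j)
    (exists_hasWeakGrad_flux hΩ h' i j)] with x hx
  rw [Scheme.avgFlux, Scheme.avgFlux, Scheme.avgFlux, ← hx]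
  refine avg_congr (fun K => ?_) x
  filter_upwards [ae_brokenGrad_sub hΩ (fun i => (h i).brokenH1) (fun i => (h' i).brokenH1) K]
    with y hy
  rw [hy i j, mul_sub]

theorem integrable_avgFlux (hd : 2 ≤ d) (hΩ : Bornology.IsBounded Ω)
    (hreg : S.mesh.PolytopicRegular c) (h : ∀ i, BrokenH2 S.mesh fun y => u y i) (i j : Fin d) :
    Integrable (S.avgFlux F u i j) (S.mesh.faceMeasure F) := by
  have e : S.avgFlux F u i j = S.mesh.avg F fun K y => S.mu K * S.brokenGrad u i j K y := rfl
  rw [e]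
  exact integrable_avg hd hΩ hreg (exists_hasWeakGrad_flux hΩ h i j)

theorem aeContinuousOnFace_avgFlux (hΩ : Bornology.IsBounded Ω)
    (h : ∀ i, PiecewiseSmooth S.mesh fun y => v y i) (i j : Fin d) :
    AEContinuousOnFace S.mesh F (S.avgFlux F v i j) := by
  have e : S.avgFlux F v i j = S.mesh.avg F fun K y => S.mu K * S.brokenGrad v i j K y := rfl
  rw [e]
  exact aeContinuousOnFace_avg fun K hK =>
    (h i).aeContinuousOnFace_trace_weakDeriv hΩ hK (S.mu K) j

theorem integrable_grad_mul_grad (hΩ : Bornology.IsBounded Ω)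
    (hu : ∀ i, BrokenH1 S.mesh fun y => u y i) (hv : ∀ i, PiecewiseSmooth S.mesh fun y => v y i)
    (K) : Integrable (fun x => S.mu K * ∑ i, ∑ j, S.brokenGrad u i j K x * S.brokenGrad v i j K x)
      (volume.restrict (S.mesh.elem K)) :=
  (integrable_finsetSum _ fun i _ => integrable_finsetSum _ fun j _ =>
    (memLp_brokenGrad hΩ hu i j K).integrable_mul
      (memLp_brokenGrad hΩ (fun i => ((hv i).brokenH2 hΩ).brokenH1) i j K)).const_mul _

theorem integrable_avgFlux_mul_jumpTensor (hd : 2 ≤ d) (hΩ : Bornology.IsBounded Ω)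
    (hreg : S.mesh.PolytopicRegular c) (hu : ∀ i, BrokenH2 S.mesh fun y => u y i)
    (hv : ∀ i, PiecewiseSmooth S.mesh fun y => v y i) (F) :
    Integrable (fun x => ∑ i, ∑ j, S.avgFlux F u i j x * S.jumpTensor F v i j x)
      (S.mesh.faceMeasure F) :=
  integrable_finsetSum _ fun i _ => integrable_finsetSum _ fun j _ =>
    AEContinuousOnFace.integrable_mul (integrable_avgFlux hd hΩ hreg hu i j)
      (aeContinuousOnFace_jumpTensor hv i j)

theorem integrable_mul_div (hΩ : Bornology.IsBounded Ω) (hp : BrokenH1 S.mesh p)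
    (hu : ∀ i, BrokenH1 S.mesh fun y => u y i) (K) :
    Integrable (fun x => p x * ∑ i, S.brokenGrad u i i K x)
      (volume.restrict (S.mesh.elem K)) :=
  (hp.hasWeakGrad hΩ K).memLp.integrable_mul
    (memLp_finsetSum _ fun i _ => memLp_brokenGrad hΩ hu i i K)

theorem integrable_avg_mul_jumpTensor (hd : 2 ≤ d) (hΩ : Bornology.IsBounded Ω)
    (hreg : S.mesh.PolytopicRegular c) (hp : BrokenH1 S.mesh p)
    (hv : ∀ i, PiecewiseSmooth S.mesh fun y => v y i) (F) :
    Integrable (fun x => S.mesh.avg F (fun _ => p) x * ∑ i, S.jumpTensor F v i i x)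
      (S.mesh.faceMeasure F) := by
  simp only [Finset.mul_sum]
  exact integrable_finsetSum _ fun i _ =>
    AEContinuousOnFace.integrable_mul (integrable_avg hd hΩ hreg hp)
      (aeContinuousOnFace_jumpTensor hv i i)

theorem ah_sub (hd : 2 ≤ d) (hΩ : Bornology.IsBounded Ω) (hreg : S.mesh.PolytopicRegular c)
    (h : ∀ i, BrokenH2 S.mesh fun y => u y i) (h' : ∀ i, BrokenH2 S.mesh fun y => u' y i)
    (hv : ∀ i, PiecewiseSmooth S.mesh fun y => v y i) :
    S.ah (u - u') v = S.ah u v - S.ah u' v := by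
  have k := fun i => (h i).brokenH1
  have k' := fun i => (h' i).brokenH1
  have i3 : ∀ {u : E d → Fin d → ℝ}, (∀ i, BrokenH2 S.mesh fun y => u y i) → ∀ F,
      Integrable (fun x => ∑ i, ∑ j, S.jumpTensor F u i j x * S.avgFlux F v i j x)
        (S.mesh.faceMeasure F) := fun hu F =>
    integrable_finsetSum _ fun i _ => integrable_finsetSum _ fun j _ =>
      AEContinuousOnFace.integrable_mul
        (integrable_jumpTensor hd hΩ hreg (fun i => (hu i).brokenH1) i j)
        (aeContinuousOnFace_avgFlux hΩ hv i j)
  have i4 : ∀ {u : E d → Fin d → ℝ}, (∀ i, BrokenH2 S.mesh fun y => u y i) → ∀ F,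
      Integrable (fun x => S.sigmaV F * ∑ i, ∑ j, S.jumpTensor F u i j x * S.jumpTensor F v i j x)
        (S.mesh.faceMeasure F) := fun hu F =>
    (integrable_finsetSum _ fun i _ => integrable_finsetSum _ fun j _ =>
      AEContinuousOnFace.integrable_mul
        (integrable_jumpTensor hd hΩ hreg (fun i => (hu i).brokenH1) i j)
        (aeContinuousOnFace_jumpTensor hv i j)).const_mul _
  have e1 := Finset.sum_congr rfl fun K (_ : K ∈ Finset.univ) =>
    integral_sub_of_ae (integrable_grad_mul_grad hΩ k hv K)
      (integrable_grad_mul_grad hΩ k' hv K) (k := fun x => S.mu K * ∑ i, ∑ j,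
      S.brokenGrad (u - u') i j K x * S.brokenGrad v i j K x) (by
        filter_upwards [ae_brokenGrad_sub hΩ k k' K] with x hx
        simp only [hx, sub_mul, Finset.sum_sub_distrib, mul_sub])
  have e2 := Finset.sum_congr rfl fun F (_ : F ∈ Finset.univ) =>
    integral_sub_of_ae (integrable_avgFlux_mul_jumpTensor hd hΩ hreg h hv F)
      (integrable_avgFlux_mul_jumpTensor hd hΩ hreg h' hv F) (k := fun x => ∑ i, ∑ j,
      S.avgFlux F (u - u') i j x * S.jumpTensor F v i j x) (by
        filter_upwards [ae_avgFlux_sub (F := F) hd hΩ hreg h h'] with x hx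
        simp only [hx, sub_mul, Finset.sum_sub_distrib])
  have e3 := Finset.sum_congr rfl fun F (_ : F ∈ Finset.univ) =>
    integral_sub_of_ae (i3 h F) (i3 h' F) (k := fun x => ∑ i, ∑ j,
      S.jumpTensor F (u - u') i j x * S.avgFlux F v i j x) (by
        filter_upwards [ae_jumpTensor_sub (F := F) hd hΩ hreg k k'] with x hx
        simp only [hx, sub_mul, Finset.sum_sub_distrib])
  have e4 := Finset.sum_congr rfl fun F (_ : F ∈ Finset.univ) =>
    integral_sub_of_ae (i4 h F) (i4 h' F) (k := fun x => S.sigmaV F * ∑ i, ∑ j,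
      S.jumpTensor F (u - u') i j x * S.jumpTensor F v i j x) (by
        filter_upwards [ae_jumpTensor_sub (F := F) hd hΩ hreg k k'] with x hx
        simp only [hx, sub_mul, Finset.sum_sub_distrib, mul_sub])
  simp only [Scheme.ah, e1, e2, e3, e4, Finset.sum_sub_distrib]
  ring

theorem bh_sub_left (hd : 2 ≤ d) (hΩ : Bornology.IsBounded Ω) (hreg : S.mesh.PolytopicRegular c)
    (h : BrokenH1 S.mesh p) (h' : BrokenH1 S.mesh p')
    (hv : ∀ i, PiecewiseSmooth S.mesh fun y => v y i) :
    S.bh (p - p') v = S.bh p v - S.bh p' v := by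
  have hv1 := fun i => ((hv i).brokenH2 hΩ).brokenH1
  have e1 := Finset.sum_congr rfl fun K (_ : K ∈ Finset.univ) =>
    integral_sub_of_ae (integrable_mul_div hΩ h hv1 K)
      (integrable_mul_div hΩ h' hv1 K) (k := fun x => (p - p') x * ∑ i,
      S.brokenGrad v i i K x) (ae_of_all _ fun x => by rw [Pi.sub_apply, sub_mul])
  have e2 := Finset.sum_congr rfl fun F (_ : F ∈ Finset.univ) =>
    integral_sub_of_ae (integrable_avg_mul_jumpTensor hd hΩ hreg h hv F)
      (integrable_avg_mul_jumpTensor hd hΩ hreg h' hv F)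
      (k := fun x => S.mesh.avg F (fun _ => p - p') x *
      ∑ i, S.jumpTensor F v i i x) (by
        filter_upwards [ae_avg_sub (F := F) hd hΩ hreg h h'] with x hx
        have e : S.mesh.avg F (fun _ => p - p') x = _ := hx
        rw [e, sub_mul])
  simp only [Scheme.bh, e1, e2, Finset.sum_sub_distrib]
  ring

theorem bh_sub_right (hd : 2 ≤ d) (hΩ : Bornology.IsBounded Ω) (hreg : S.mesh.PolytopicRegular c)
    (h : ∀ i, BrokenH1 S.mesh fun y => u y i) (h' : ∀ i, BrokenH1 S.mesh fun y => u' y i)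
    (hq : PiecewiseSmooth S.mesh q) :
    S.bh q (u - u') = S.bh q u - S.bh q u' := by
  have hq1 := (hq.brokenH2 hΩ).brokenH1
  have i2 : ∀ {u : E d → Fin d → ℝ}, (∀ i, BrokenH1 S.mesh fun y => u y i) → ∀ F,
      Integrable (fun x => S.mesh.avg F (fun _ => q) x * ∑ i, S.jumpTensor F u i i x)
        (S.mesh.faceMeasure F) := fun hu F => by
    simp only [mul_comm (S.mesh.avg F _ _)]
    exact AEContinuousOnFace.integrable_mul
      (integrable_finsetSum _ fun i _ => integrable_jumpTensor hd hΩ hreg hu i i)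
      (aeContinuousOnFace_avg fun K hK => hq.aeContinuousOnFace_trace hK)
  have e1 := Finset.sum_congr rfl fun K (_ : K ∈ Finset.univ) =>
    integral_sub_of_ae (integrable_mul_div hΩ hq1 h K)
      (integrable_mul_div hΩ hq1 h' K) (k := fun x => q x * ∑ i,
      S.brokenGrad (u - u') i i K x) (by
        filter_upwards [ae_brokenGrad_sub hΩ h h' K] with x hx
        simp only [hx, Finset.sum_sub_distrib, mul_sub])
  have e2 := Finset.sum_congr rfl fun F (_ : F ∈ Finset.univ) =>
    integral_sub_of_ae (i2 h F) (i2 h' F) (k := fun x => S.mesh.avg F (fun _ => q) x *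
      ∑ i, S.jumpTensor F (u - u') i i x) (by
        filter_upwards [ae_jumpTensor_sub (F := F) hd hΩ hreg h h'] with x hx
        simp only [hx, Finset.sum_sub_distrib, mul_sub])
  simp only [Scheme.bh, e1, e2, Finset.sum_sub_distrib]
  ring

theorem sh_sub (hd : 2 ≤ d) (hΩ : Bornology.IsBounded Ω) (hreg : S.mesh.PolytopicRegular c)
    (h : BrokenH1 S.mesh p) (h' : BrokenH1 S.mesh p') (hq : PiecewiseSmooth S.mesh q) :
    S.sh (p - p') q = S.sh p q - S.sh p' q := by
  have i1 : ∀ {p : E d → ℝ}, BrokenH1 S.mesh p → ∀ F, Integrable (fun x => S.sigmaP F *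
      ∑ i, (S.mesh.jump F p x * S.mesh.normal F i) * (S.mesh.jump F q x * S.mesh.normal F i))
        (S.mesh.faceMeasure F) := fun hp F =>
    (integrable_finsetSum _ fun i _ => AEContinuousOnFace.integrable_mul
      ((integrable_jump hd hΩ hreg hp).mul_const _)
      (hq.aeContinuousOnFace_jump.mul (aeContinuousOnFace_const _))).const_mul _
  have e1 := fun F => integral_sub_of_ae (i1 h F) (i1 h' F) (k := fun x => S.sigmaP F *
      ∑ i, (S.mesh.jump F (p - p') x * S.mesh.normal F i) *
        (S.mesh.jump F q x * S.mesh.normal F i)) (by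
        filter_upwards [ae_jump_sub (F := F) hd hΩ hreg h h'] with x hx
        have e : S.mesh.jump F (p - p') x = _ := hx
        simp only [e, sub_mul, Finset.sum_sub_distrib, mul_sub])
  simp only [Scheme.sh, e1, Finset.sum_sub_distrib]

/-- Pairs of a broken `H^2` velocity and a broken `H^1` pressure. -/
def BrokenPair (S : Scheme Ω) (x : Pair d) : Prop :=
  (∀ i, BrokenH2 S.mesh fun y => x.1 y i) ∧ BrokenH1 S.mesh x.2

/-- Pairs of a piecewise smooth velocity and a piecewise smooth pressure. -/
def SmoothPair (S : Scheme Ω) (x : Pair d) : Prop :=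
  (∀ i, PiecewiseSmooth S.mesh fun y => x.1 y i) ∧ PiecewiseSmooth S.mesh x.2

theorem SmoothPair.brokenPair (hΩ : Bornology.IsBounded Ω) {x : Pair d} (h : SmoothPair S x) :
    BrokenPair S x :=
  ⟨fun i => (h.1 i).brokenH2 hΩ, (h.2.brokenH2 hΩ).brokenH1⟩

theorem smoothPair_of_mem_discreteSpace {x : Pair d} (h : x ∈ S.discreteSpace) :
    SmoothPair S x :=
  ⟨fun i => piecewiseSmooth_of_isPiecewisePoly (h.1 i).2, piecewiseSmooth_of_isPiecewisePoly h.2.2⟩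

theorem Bh_sub (hd : 2 ≤ d) (hΩ : Bornology.IsBounded Ω) (hreg : S.mesh.PolytopicRegular c)
    {x x' y : Pair d} (hx : BrokenPair S x) (hx' : BrokenPair S x') (hy : SmoothPair S y) :
    S.Bh (x - x') y = S.Bh x y - S.Bh x' y := by
  rw [Scheme.Bh, Scheme.Bh, Scheme.Bh, Prod.fst_sub, Prod.snd_sub,
    ah_sub hd hΩ hreg hx.1 hx'.1 hy.1, bh_sub_left hd hΩ hreg hx.2 hx'.2 hy.1,
    bh_sub_right hd hΩ hreg (fun i => (hx.1 i).brokenH1) (fun i => (hx'.1 i).brokenH1) hy.2,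
    sh_sub hd hΩ hreg hx.2 hx'.2 hy.2]
  ring

end Linearity

/-! ### The triangle inequality for the energy norm -/

section Triangle

/-- The square roots of `a`, `b`, `c` satisfy the triangle inequality `√c ≤ √a + √b`. The
relation is stable under sums and integrals, by Minkowski's inequality. -/
def SqrtTriangle (a b c : ℝ) : Prop := 0 ≤ a ∧ 0 ≤ b ∧ 0 ≤ c ∧ c ≤ (√a + √b) ^ 2

namespace SqrtTriangle

variable {a b c a' b' c' : ℝ}

theorem sqrt_le (h : SqrtTriangle a b c) : √c ≤ √a + √b :=
  Real.sqrt_le_iff.2 ⟨by positivity, h.2.2.2⟩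

theorem sub_sq (a b : ℝ) : SqrtTriangle (a ^ 2) (b ^ 2) ((a - b) ^ 2) := by
  refine ⟨sq_nonneg _, sq_nonneg _, sq_nonneg _, ?_⟩
  rw [Real.sqrt_sq_eq_abs, Real.sqrt_sq_eq_abs, ← sq_abs (a - b)]
  exact pow_le_pow_left₀ (abs_nonneg _) (abs_sub _ _) 2

theorem const_mul {k : ℝ} (hk : 0 ≤ k) (h : SqrtTriangle a b c) :
    SqrtTriangle (k * a) (k * b) (k * c) := by
  obtain ⟨h1, h2, h3, h4⟩ := h
  refine ⟨mul_nonneg hk h1, mul_nonneg hk h2, mul_nonneg hk h3, ?_⟩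
  rw [Real.sqrt_mul hk, Real.sqrt_mul hk, ← mul_add, mul_pow, Real.sq_sqrt hk]
  exact mul_le_mul_of_nonneg_left h4 hk

theorem add (h : SqrtTriangle a b c) (h' : SqrtTriangle a' b' c') :
    SqrtTriangle (a + a') (b + b') (c + c') := by
  obtain ⟨h1, h2, h3, h4⟩ := h
  obtain ⟨h1', h2', h3', h4'⟩ := h'
  refine ⟨add_nonneg h1 h1', add_nonneg h2 h2', add_nonneg h3 h3', ?_⟩
  have hCS : √a * √b + √a' * √b' ≤ √(a + a') * √(b + b') := by
    rw [← Real.sqrt_mul (add_nonneg h1 h1')]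
    refine Real.le_sqrt_of_sq_le ?_
    have e1 := Real.sq_sqrt h1
    have e2 := Real.sq_sqrt h2
    have e3 := Real.sq_sqrt h1'
    have e4 := Real.sq_sqrt h2'
    have e5 : (a + a') * (b + b') = (√a ^ 2 + √a' ^ 2) * (√b ^ 2 + √b' ^ 2) := by
      rw [e1, e2, e3, e4]
    rw [e5]
    nlinarith [sq_nonneg (√a * √b' - √a' * √b)]
  have f1 := Real.sq_sqrt h1
  have f2 := Real.sq_sqrt h2
  have f3 := Real.sq_sqrt h1'
  have f4 := Real.sq_sqrt h2'
  have f5 := Real.sq_sqrt (add_nonneg h1 h1')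
  have f6 := Real.sq_sqrt (add_nonneg h2 h2')
  nlinarith

theorem sum {ι : Type*} (s : Finset ι) {f g h : ι → ℝ}
    (H : ∀ i ∈ s, SqrtTriangle (f i) (g i) (h i)) :
    SqrtTriangle (∑ i ∈ s, f i) (∑ i ∈ s, g i) (∑ i ∈ s, h i) := by
  classical
  induction s using Finset.induction_on with
  | empty => simp [SqrtTriangle]
  | insert i s hi ih =>
    rw [Finset.sum_insert hi, Finset.sum_insert hi, Finset.sum_insert hi]
    exact (H i (Finset.mem_insert_self i s)).add
      (ih fun j hj => H j (Finset.mem_insert_of_mem hj))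

theorem integral {α : Type*} [MeasurableSpace α] {μ : Measure α} {f g h : α → ℝ}
    (hf : Integrable f μ) (hg : Integrable g μ)
    (H : ∀ᵐ x ∂μ, SqrtTriangle (f x) (g x) (h x)) :
    SqrtTriangle (∫ x, f x ∂μ) (∫ x, g x ∂μ) (∫ x, h x ∂μ) := by
  have hf0 : 0 ≤ᵐ[μ] f := H.mono fun x hx => hx.1
  have hg0 : 0 ≤ᵐ[μ] g := H.mono fun x hx => hx.2.1
  have hh0 : 0 ≤ᵐ[μ] h := H.mono fun x hx => hx.2.2.1
  have hfm := Real.continuous_sqrt.comp_aestronglyMeasurable hf.aestronglyMeasurable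
  have hgm := Real.continuous_sqrt.comp_aestronglyMeasurable hg.aestronglyMeasurable
  have sqf : ∀ᵐ x ∂μ, √(f x) ^ 2 = f x := hf0.mono fun x hx => Real.sq_sqrt hx
  have sqg : ∀ᵐ x ∂μ, √(g x) ^ 2 = g x := hg0.mono fun x hx => Real.sq_sqrt hx
  have lf : MemLp (fun x => √(f x)) 2 μ :=
    (memLp_two_iff_integrable_sq hfm).2 (hf.congr (sqf.mono fun x hx => hx.symm))
  have lg : MemLp (fun x => √(g x)) 2 μ :=
    (memLp_two_iff_integrable_sq hgm).2 (hg.congr (sqg.mono fun x hx => hx.symm))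
  have hfg : Integrable (fun x => √(f x) * √(g x)) μ := lf.integrable_mul lg
  refine ⟨integral_nonneg_of_ae hf0, integral_nonneg_of_ae hg0, integral_nonneg_of_ae hh0, ?_⟩
  have hCS : ∫ x, √(f x) * √(g x) ∂μ ≤ √(∫ x, f x ∂μ) * √(∫ x, g x ∂μ) := by
    have := integral_mul_le_Lp_mul_Lq_of_nonneg (μ := μ) Real.HolderConjugate.two_two
      (f := fun x => √(f x)) (g := fun x => √(g x)) (ae_of_all _ fun _ => Real.sqrt_nonneg _)
      (ae_of_all _ fun _ => Real.sqrt_nonneg _) (by simpa using lf) (by simpa using lg)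
    refine this.trans_eq ?_
    rw [Real.sqrt_eq_rpow, Real.sqrt_eq_rpow]
    congr 2
    · exact integral_congr_ae (sqf.mono fun x hx => by simpa using hx)
    · exact integral_congr_ae (sqg.mono fun x hx => by simpa using hx)
  have hbound : ∫ x, h x ∂μ ≤ ∫ x, (f x + 2 * (√(f x) * √(g x)) + g x) ∂μ := by
    refine integral_mono_of_nonneg hh0 ((hf.add (hfg.const_mul 2)).add hg) ?_
    filter_upwards [H, sqf, sqg] with x hx h1 h2
    refine hx.2.2.2.trans_eq ?_
    rw [add_sq, h1, h2]
    ring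
  have hfg2 : Integrable (fun x => f x + 2 * (√(f x) * √(g x))) μ := hf.add (hfg.const_mul 2)
  rw [integral_add hfg2 hg, integral_add hf (hfg.const_mul 2), integral_const_mul] at hbound
  rw [add_sq, Real.sq_sqrt (integral_nonneg_of_ae hf0), Real.sq_sqrt (integral_nonneg_of_ae hg0)]
  linarith

end SqrtTriangle

variable {d : ℕ} {Ω : Set (E d)} {S : Scheme Ω} {c : ℝ}

/-- Pairs of finite energy whose jumps are continuous on the faces, as for the difference of the
weak solution and a discrete function. -/
structure EnergyPair (S : Scheme Ω) (x : Pair d) : Prop where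
  vel : ∀ i, BrokenH1 S.mesh fun y => x.1 y i
  jump_vel : ∀ F i, AEContinuousOnFace S.mesh F (S.mesh.jump F fun y => x.1 y i)
  pres : BrokenH1 S.mesh x.2
  memLp_pres : MemLp x.2 2 (volume.restrict Ω)
  jump_pres : ∀ F, (S.mesh.minus F).isSome → AEContinuousOnFace S.mesh F (S.mesh.jump F x.2)

theorem sigmaV_nonneg (F) : 0 ≤ S.sigmaV F := by
  have h : ∀ K, 0 ≤ (S.l : ℝ) ^ 2 * S.mu K / S.mesh.diam K := fun K =>
    div_nonneg (mul_nonneg (sq_nonneg _) (S.mu_pos K).le) Metric.diam_nonneg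
  rcases hm : S.mesh.minus F with _ | K
  · simp only [Scheme.sigmaV, hm]
    exact mul_nonneg S.gammaV_pos.le (h _)
  · simp only [Scheme.sigmaV, hm]
    exact mul_nonneg S.gammaV_pos.le (le_max_of_le_left (h _))

theorem sigmaP_nonneg (F) : 0 ≤ S.sigmaP F := by
  have h : ∀ K, 0 ≤ S.mesh.diam K / (S.m : ℝ) := fun K =>
    div_nonneg Metric.diam_nonneg (Nat.cast_nonneg _)
  rcases hm : S.mesh.minus F with _ | K
  · simp only [Scheme.sigmaP, hm, le_refl]
  · simp only [Scheme.sigmaP, hm]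
    exact mul_nonneg S.gammaP_pos.le (le_min (h _) (h _))

/-- The triangle inequality for the energy norm. -/
theorem energyNorm_sub_le (hd : 2 ≤ d) (hΩ : Bornology.IsBounded Ω)
    (hreg : S.mesh.PolytopicRegular c) {x z : Pair d} (hx : EnergyPair S x)
    (hz : EnergyPair S z) : S.energyNorm (x - z) ≤ S.energyNorm x + S.energyNorm z := by
  have i1 : ∀ {x : Pair d}, EnergyPair S x → ∀ K, Integrable (fun y => S.mu K * ∑ i, ∑ j,
      S.brokenGrad x.1 i j K y ^ 2) (volume.restrict (S.mesh.elem K)) := fun hx K =>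
    (integrable_finsetSum _ fun i _ => integrable_finsetSum _ fun j _ =>
      (memLp_brokenGrad hΩ hx.vel i j K).integrable_sq).const_mul _
  have i2 : ∀ {x : Pair d}, EnergyPair S x → ∀ F, Integrable (fun y => S.sigmaV F * ∑ i, ∑ j,
      S.jumpTensor F x.1 i j y ^ 2) (S.mesh.faceMeasure F) := fun hx F =>
    (integrable_finsetSum _ fun i _ => integrable_finsetSum _ fun j _ => by
      have h := (hx.jump_vel F i).mul (aeContinuousOnFace_const (S.mesh.normal F j))
      simp only [sq]
      exact (h.mul h).integrable (by omega)).const_mul _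
  have i3 : ∀ {x : Pair d}, EnergyPair S x → ∀ F, (S.mesh.minus F).isSome →
      Integrable (fun y => S.sigmaP F * ∑ i, (S.mesh.jump F x.2 y * S.mesh.normal F i) *
        (S.mesh.jump F x.2 y * S.mesh.normal F i)) (S.mesh.faceMeasure F) := fun hx F hF =>
    (integrable_finsetSum _ fun i _ => by
      have h := (hx.jump_pres F hF).mul (aeContinuousOnFace_const (S.mesh.normal F i))
      exact (h.mul h).integrable (by omega)).const_mul _
  have t1 : SqrtTriangle (S.velNormSq x.1) (S.velNormSq z.1) (S.velNormSq (x.1 - z.1)) := by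
    refine (SqrtTriangle.sum _ fun K _ => ?_).add (SqrtTriangle.sum _ fun F _ => ?_)
    · refine SqrtTriangle.integral (i1 hx K) (i1 hz K) ?_
      filter_upwards [ae_brokenGrad_sub hΩ hx.vel hz.vel K] with y hy
      refine (SqrtTriangle.sum _ fun i _ => SqrtTriangle.sum _ fun j _ => ?_).const_mul
        (S.mu_pos K).le
      rw [hy i j]
      exact SqrtTriangle.sub_sq _ _
    · refine SqrtTriangle.integral (i2 hx F) (i2 hz F) ?_
      filter_upwards [ae_jumpTensor_sub (F := F) hd hΩ hreg hx.vel hz.vel] with y hy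
      refine (SqrtTriangle.sum _ fun i _ => SqrtTriangle.sum _ fun j _ => ?_).const_mul
        (sigmaV_nonneg F)
      rw [hy i j]
      exact SqrtTriangle.sub_sq _ _
  have t2 : SqrtTriangle (S.presNormSq x.2) (S.presNormSq z.2) (S.presNormSq (x.2 - z.2)) := by
    refine SqrtTriangle.add ?_ (SqrtTriangle.sum _ fun F hF => ?_)
    · exact SqrtTriangle.integral hx.memLp_pres.integrable_sq hz.memLp_pres.integrable_sq
        (ae_of_all _ fun y => SqrtTriangle.sub_sq _ _)
    · have hF' := (Finset.mem_filter.1 hF).2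
      refine SqrtTriangle.integral (i3 hx F hF') (i3 hz F hF') ?_
      filter_upwards [ae_jump_sub (F := F) hd hΩ hreg hx.pres hz.pres] with y hy
      have e : S.mesh.jump F (x.2 - z.2) y = _ := hy
      refine (SqrtTriangle.sum _ fun i _ => ?_).const_mul (sigmaP_nonneg F)
      rw [e, sub_mul, ← sq, ← sq, ← sq]
      exact SqrtTriangle.sub_sq _ _
  exact (t1.add t2).sqrt_le

theorem EnergyPair.sub (hd : 2 ≤ d) (hΩ : Bornology.IsBounded Ω)
    (hreg : S.mesh.PolytopicRegular c) {x z : Pair d} (hx : EnergyPair S x)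
    (hz : EnergyPair S z) : EnergyPair S (x - z) where
  vel i := (hx.vel i).sub hΩ (hz.vel i)
  jump_vel F i := ((hx.jump_vel F i).sub (hz.jump_vel F i)).congr
    (ae_jump_sub hd hΩ hreg (hx.vel i) (hz.vel i))
  pres := hx.pres.sub hΩ hz.pres
  memLp_pres := hx.memLp_pres.sub hz.memLp_pres
  jump_pres F hF := ((hx.jump_pres F hF).sub (hz.jump_pres F hF)).congr
    (ae_jump_sub hd hΩ hreg hx.pres hz.pres)

theorem energyPair_of_mem_discreteSpace (hΩ : Bornology.IsBounded Ω) {x : Pair d}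
    (h : x ∈ S.discreteSpace) : EnergyPair S x where
  vel i := ((smoothPair_of_mem_discreteSpace h).brokenPair hΩ).1 i |>.brokenH1
  jump_vel _ i := ((smoothPair_of_mem_discreteSpace h).1 i).aeContinuousOnFace_jump
  pres := ((smoothPair_of_mem_discreteSpace h).brokenPair hΩ).2
  memLp_pres := h.2.1.1
  jump_pres _ _ := (smoothPair_of_mem_discreteSpace h).2.aeContinuousOnFace_jump

end Triangle

/-! ### Integration by parts against broken test functions -/

section BrokenIbp

variable {d : ℕ} {Ω : Set (E d)} {T : PolytopicMesh Ω} {K : Fin T.numElem} {F : Fin T.numFace}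
  {c : ℝ}

open Classical in
/-- The divergence theorem on an element. -/
theorem setIntegral_elem_eq_sum_faces (hd : 2 ≤ d) (hΩ : Bornology.IsBounded Ω)
    (hreg : T.PolytopicRegular c) {σ : Fin d → E d → ℝ} {γ : Fin d → Fin d → E d → ℝ}
    (hσ : ∀ j, HasWeakGrad (T.elem K) (σ j) (γ j)) {φ : E d → ℝ} (hφ : ContDiff ℝ ∞ φ) :
    ∫ x in T.elem K, ∑ j, (γ j j x * φ x + σ j x * fderiv ℝ φ x (EuclideanSpace.single j 1)) =
      ∑ F with T.IsFaceOf F K,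
        ∫ x, ∑ j, outward T K F j * (trace (T.elem K) (σ j) x * φ x) ∂T.faceMeasure F := by
  have hint : ∀ j, IntegrableOn (fun x => γ j j x * φ x +
      σ j x * fderiv ℝ φ x (EuclideanSpace.single j 1)) (T.elem K) := fun j =>
    (integrableOn_ibp hΩ (hσ j) hφ).1.add (integrableOn_ibp hΩ (hσ j) hφ).2
  rw [integral_finsetSum _ fun j _ => hint j]
  have h1 : ∀ j, ∫ x in T.elem K, (γ j j x * φ x +
      σ j x * fderiv ℝ φ x (EuclideanSpace.single j 1)) = ∑ F with T.IsFaceOf F K,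
        outward T K F j * ∫ x, trace (T.elem K) (σ j) x * φ x ∂T.faceMeasure F := fun j =>
    sub_eq_zero.1 (ibpDefect_eq_zero (j := j) hd hΩ hreg (hσ j) hφ)
  rw [Finset.sum_congr rfl fun j _ => h1 j, Finset.sum_comm]
  refine Finset.sum_congr rfl fun F hF => ?_
  have hFK : T.IsFaceOf F K := (Finset.mem_filter.1 hF).2
  rw [integral_finsetSum _ fun j _ =>
    (integrable_trace_mul hd hΩ hreg hFK (hσ j) hφ.continuous).const_mul _]
  exact Finset.sum_congr rfl fun j _ => (integral_const_mul _ _).symm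

/-- Elementwise integration by parts of a vector field without normal jumps against a broken test
function leaves only the jumps of the test function. -/
theorem sum_setIntegral_elem_eq_sum_jump (hd : 2 ≤ d) (hΩ : Bornology.IsBounded Ω)
    (hreg : T.PolytopicRegular c)
    {σ : Fin d → Fin T.numElem → E d → ℝ} {γ : Fin d → Fin T.numElem → Fin d → E d → ℝ}
    (hσ : ∀ j K, HasWeakGrad (T.elem K) (σ j K) (γ j K))
    (hjump : ∀ F K, T.minus F = some K → ∀ᵐ x ∂T.faceMeasure F, ∑ j, T.normal F j *
      (trace (T.elem (T.plus F)) (σ j (T.plus F)) x - trace (T.elem K) (σ j K) x) = 0)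
    {v : E d → ℝ} (hv : PiecewiseSmooth T v) :
    ∑ K, ∫ x in T.elem K, ∑ j, (γ j K j x * v x + σ j K x * weakDeriv (T.elem K) j v x) =
      ∑ F, ∫ x, ∑ j, T.avg F (σ j) x * (T.jump F v x * T.normal F j) ∂T.faceMeasure F := by
  classical
  choose φ hφ hvφ using hv
  have h1 : ∀ K, ∫ x in T.elem K, ∑ j, (γ j K j x * v x +
      σ j K x * weakDeriv (T.elem K) j v x) = ∑ F with T.IsFaceOf F K,
        ∫ x, ∑ j, outward T K F j * (trace (T.elem K) (σ j K) x * φ K x) ∂T.faceMeasure F := by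
    intro K
    rw [← setIntegral_elem_eq_sum_faces hd hΩ hreg (fun j => hσ j K) (hφ K)]
    have hg := hasWeakGrad_of_eqOn hΩ (hφ K) (hvφ K)
    refine integral_congr_ae ?_
    filter_upwards [ae_all_iff.2 fun j => hg.weakDeriv_ae_eq (T.isOpen_elem K) j,
      ae_elem_of_forall (hvφ K)] with x hx hx'
    simp only [hx, hx']
  have h2 : ∀ F K, T.IsFaceOf F K → Integrable (fun x => ∑ j, outward T K F j *
      (trace (T.elem K) (σ j K) x * φ K x)) (T.faceMeasure F) := fun F K hF =>
    integrable_finsetSum _ fun j _ =>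
      (integrable_trace_mul hd hΩ hreg hF (hσ j K) (hφ K).continuous).const_mul _
  rw [Finset.sum_congr rfl fun K _ => h1 K]
  simp only [Finset.sum_filter]
  rw [Finset.sum_comm]
  refine Finset.sum_congr rfl fun F _ => ?_
  rw [← Finset.sum_filter]
  have hp := ae_trace_eq_of_eqOn (F := F) (Or.inl rfl) (hφ (T.plus F)).continuous (hvφ (T.plus F))
  rcases hm : T.minus F with _ | K
  · have hfilt : (Finset.univ.filter fun K => T.IsFaceOf F K) = {T.plus F} := by
      ext K
      simp [PolytopicMesh.IsFaceOf, hm, eq_comm]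
    rw [hfilt, Finset.sum_singleton, outward_plus]
    refine integral_congr_ae ?_
    filter_upwards [hp] with x hx
    refine Finset.sum_congr rfl fun j _ => ?_
    rw [avg_of_none hm, jump_of_none hm, hx]
    ring
  · have hne : T.plus F ≠ K := plus_ne_of_minus_eq hd hm
    have hfilt : (Finset.univ.filter fun K => T.IsFaceOf F K) = {T.plus F, K} := by
      ext K'
      simp [PolytopicMesh.IsFaceOf, hm, eq_comm]
    rw [hfilt, Finset.sum_pair hne, ← integral_add (h2 F _ (Or.inl rfl)) (h2 F K (Or.inr hm)),
      outward_plus, outward_minus hd hm]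
    refine integral_congr_ae ?_
    filter_upwards [hp, ae_trace_eq_of_eqOn (F := F) (Or.inr hm) (hφ K).continuous (hvφ K),
      hjump F K hm] with x hx hx' hj
    rw [← Finset.sum_add_distrib, ← sub_eq_zero, ← Finset.sum_sub_distrib]
    -- The two sides differ by the average of the test function times the normal jump.
    rw [← mul_zero ((φ (T.plus F) x + φ K x) / 2), ← hj, Finset.mul_sum]
    refine Finset.sum_congr rfl fun j _ => ?_
    rw [avg_of_some hm, jump_of_some hm, hx, hx', PiLp.neg_apply]
    ring

end BrokenIbp

/-! ### The weak solution as an argument of the discrete forms -/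

section Consistency

variable {d : ℕ} {Ω : Set (E d)} {S : Scheme Ω} {c : ℝ} {f u : E d → Fin d → ℝ} {p : E d → ℝ}

theorem ae_jump_eq_zero_of_mem_velocitySpace (hd : 2 ≤ d) (hΩo : IsOpen Ω)
    (hΩ : Bornology.IsBounded Ω) (hreg : S.mesh.PolytopicRegular c) (hu : u ∈ velocitySpace Ω)
    (F i) : ∀ᵐ x ∂S.mesh.faceMeasure F, S.mesh.jump F (fun y => u y i) x = 0 := by
  rcases hm : S.mesh.minus F with _ | K
  · filter_upwards [ae_trace_eq_zero_of_boundary hd hm (hu i).2] with x hx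
    rw [jump_of_none hm, hx]
  · obtain ⟨g, hg, -⟩ := (hu i).1.exists_hasWeakGrad
    filter_upwards [hg.ae_jump_eq_zero hd hΩo hΩ hreg hm] with x hx
    rw [jump_of_some hm, hx, sub_self]

theorem ae_jump_eq_zero_of_memSobolev (hd : 2 ≤ d) (hΩo : IsOpen Ω)
    (hΩ : Bornology.IsBounded Ω) (hreg : S.mesh.PolytopicRegular c) (hp : MemSobolev Ω 1 p)
    {F} (hF : (S.mesh.minus F).isSome) :
    ∀ᵐ x ∂S.mesh.faceMeasure F, S.mesh.jump F p x = 0 := by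
  obtain ⟨K, hm⟩ := Option.isSome_iff_exists.1 hF
  obtain ⟨g, hg, -⟩ := hp.exists_hasWeakGrad
  filter_upwards [hg.ae_jump_eq_zero hd hΩo hΩ hreg hm] with x hx
  rw [jump_of_some hm, hx, sub_self]

/-- A velocity in `V` and a pressure in `H^1(Ω)` have finite energy: the jumps of the velocity
vanish on every face, those of the pressure on every interior face. -/
theorem energyPair_of_memSobolev (hd : 2 ≤ d) (hΩo : IsOpen Ω)
    (hΩ : Bornology.IsBounded Ω) (hreg : S.mesh.PolytopicRegular c) (hu : u ∈ velocitySpace Ω)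
    (hp : MemSobolev Ω 1 p) : EnergyPair S (u, p) where
  vel i := brokenH1_of_memSobolev hΩo hΩ (hu i).1
  jump_vel F i := (aeContinuousOnFace_const 0).congr
    (ae_jump_eq_zero_of_mem_velocitySpace hd hΩo hΩ hreg hu F i)
  pres := brokenH1_of_memSobolev hΩo hΩ hp
  memLp_pres := hp.1
  jump_pres _ hF := (aeContinuousOnFace_const 0).congr
    (ae_jump_eq_zero_of_memSobolev hd hΩo hΩ hreg hp hF)

theorem zero_mem_pressureSpace : (0 : E d → ℝ) ∈ pressureSpace Ω :=
  ⟨MemLp.zero', by simp⟩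

/-- The vector field `ψ e_i`. -/
noncomputable def testField (i : Fin d) (ψ : E d → ℝ) (y : E d) (k : Fin d) : ℝ :=
  (if k = i then 1 else 0) * ψ y

theorem testField_mem_velocitySpace (hΩ : Bornology.IsBounded Ω) (i : Fin d) {ψ : E d → ℝ}
    (hψ : ContDiff ℝ ∞ ψ) (hΩo : IsOpen Ω) (hψs : tsupport ψ ⊆ Ω) :
    testField i ψ ∈ velocitySpace Ω := by
  intro k
  have hk : ContDiff ℝ ∞ fun y => testField i ψ y k := contDiff_const.mul hψ
  refine ⟨(hasWeakGrad_of_contDiff hΩ hk).memSobolev, ?_⟩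
  filter_upwards [ae_restrict_mem isClosed_frontier.measurableSet] with x hx
  rw [hΩo.frontier_eq] at hx
  have hψ0 : ψ x = 0 := image_eq_zero_of_notMem_tsupport fun h => hx.2 (hψs h)
  have hx0 : testField i ψ x k = 0 := by rw [testField, hψ0, mul_zero]
  have := hasTrace_of_continuous (w := fun y => testField i ψ y k) hΩo hk.continuous hx.1
    fun y _ => rfl
  rwa [hx0] at this

theorem ae_weakDeriv_testField (hΩo : IsOpen Ω) (hΩ : Bornology.IsBounded Ω) (i k j : Fin d)
    {ψ : E d → ℝ} (hψ : ContDiff ℝ ∞ ψ) :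
    ∀ᵐ x ∂volume.restrict Ω, weakDeriv Ω j (fun y => testField i ψ y k) x =
      (if k = i then 1 else 0) * fderiv ℝ ψ x (EuclideanSpace.single j 1) :=
  ((hasWeakGrad_of_contDiff hΩ hψ).const_mul hΩ.measure_lt_top.ne _).weakDeriv_ae_eq hΩo j

theorem ae_weakDeriv_eq_brokenGrad (hΩo : IsOpen Ω) (hΩ : Bornology.IsBounded Ω)
    (hu : ∀ i, MemSobolev Ω 1 fun y => u y i) (i j : Fin d) (K) :
    ∀ᵐ x ∂volume.restrict (S.mesh.elem K),
      weakDeriv Ω j (fun y => u y i) x = S.brokenGrad u i j K x := by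
  obtain ⟨g, hg, -⟩ := (hu i).exists_hasWeakGrad
  filter_upwards [ae_mono (Measure.restrict_mono (S.mesh.elem_subset K) le_rfl)
      (hg.weakDeriv_ae_eq hΩo j), (hg.mono hΩo hΩ.measure_lt_top.ne
      (S.mesh.elem_subset K)).weakDeriv_ae_eq (S.mesh.isOpen_elem K) j] with x hx hx'
  rw [hx, Scheme.brokenGrad, hx']

/-- The entry `(i, j)` of the stress `μ ∇u - p I` on the element `K`. -/
noncomputable def stress (S : Scheme Ω) (u : E d → Fin d → ℝ) (p : E d → ℝ) (i j : Fin d)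
    (K : Fin S.mesh.numElem) (x : E d) : ℝ :=
  S.mu K * S.brokenGrad u i j K x - (if i = j then 1 else 0) * p x

end Consistency

/-! ### Consistency -/

section Galerkin

variable {d : ℕ} {Ω : Set (E d)} {S : Scheme Ω} {c : ℝ} {f u v : E d → Fin d → ℝ} {p r : E d → ℝ}

theorem exists_hasWeakGrad_stress (hΩ : Bornology.IsBounded Ω)
    (hu : ∀ i, BrokenH2 S.mesh fun y => u y i) (hp : BrokenH1 S.mesh p) (i j K) :
    ∃ g, HasWeakGrad (S.mesh.elem K) (stress S u p i j K) g := by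
  obtain ⟨g, hg⟩ := exists_hasWeakGrad_flux hΩ hu i j K
  exact ⟨_, hg.sub (elem_measure_ne_top hΩ)
    ((hp.hasWeakGrad hΩ K).const_mul (elem_measure_ne_top hΩ) _)⟩

/-- The weak form of the momentum balance, tested with `ψ e_i`. -/
theorem sum_stress_mul_fderiv (hd : 2 ≤ d) (hΩo : IsOpen Ω) (hΩ : Bornology.IsBounded Ω)
    (hp : MemSobolev Ω 1 p) (hsol : S.IsWeakSolution f (u, p)) (i : Fin d) {ψ : E d → ℝ}
    (hψ : ContDiff ℝ ∞ ψ) (hψs : tsupport ψ ⊆ Ω) :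
    ∑ K, ∫ x in S.mesh.elem K, ∑ j, stress S u p i j K x *
      fderiv ℝ ψ x (EuclideanSpace.single j 1) = ∫ x in Ω, f x i * ψ x := by
  have hΩv : volume Ω ≠ ⊤ := hΩ.measure_lt_top.ne
  have hu1 : ∀ i, MemSobolev Ω 1 fun y => u y i := fun i => (hsol.1 i).1
  have hub : ∀ i, BrokenH1 S.mesh fun y => u y i := fun i =>
    brokenH1_of_memSobolev hΩo hΩ (hu1 i)
  have h : S.a u (testField i ψ) + S.b p (testField i ψ) - S.b 0 u =
      ∫ y in Ω, ∑ k, f y k * testField i ψ y k :=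
    hsol.2.2 _ (testField_mem_velocitySpace hΩ i hψ hΩo hψs) _ zero_mem_pressureSpace
  have hb0 : S.b 0 u = 0 := by simp [Scheme.b]
  have hrhs : ∫ y in Ω, ∑ k, f y k * testField i ψ y k = ∫ y in Ω, f y i * ψ y := by
    simp [testField]
  have ha : S.a u (testField i ψ) = ∑ K, ∫ x in S.mesh.elem K,
      ∑ j, S.mu K * (S.brokenGrad u i j K x * fderiv ℝ ψ x (EuclideanSpace.single j 1)) := by
    refine Finset.sum_congr rfl fun K _ => integral_congr_ae ?_
    filter_upwards [ae_all_iff.2 fun k => ae_all_iff.2 fun j =>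
        ae_weakDeriv_eq_brokenGrad hΩo hΩ hu1 k j K,
      ae_mono (Measure.restrict_mono (S.mesh.elem_subset K) le_rfl) (ae_all_iff.2 fun k =>
        ae_all_iff.2 fun j => ae_weakDeriv_testField hΩo hΩ i k j hψ)] with x hx hx'
    simp only [hx, hx']
    rw [Finset.sum_eq_single i (fun k _ hk => by simp [hk]) (by simp), Finset.mul_sum]
    simp
  have hip : IntegrableOn (fun x => p x * fderiv ℝ ψ x (EuclideanSpace.single i 1)) Ω :=
    integrableOn_mul_of_continuous hΩ (integrableOn_of_memLp_two hΩv hp.1)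
      (continuous_fderiv_dir hψ _)
  have hb : S.b p (testField i ψ) = -∑ K, ∫ x in S.mesh.elem K,
      p x * fderiv ℝ ψ x (EuclideanSpace.single i 1) := by
    rw [sum_setIntegral_elem hd hip, Scheme.b]
    congr 1
    refine integral_congr_ae ?_
    filter_upwards [ae_all_iff.2 fun k => ae_weakDeriv_testField hΩo hΩ i k k hψ] with x hx
    simp only [hx]
    rw [Finset.sum_eq_single i (fun k _ hk => by simp [hk]) (by simp)]
    simp
  rw [← hrhs, ← h, ha, hb, hb0, sub_zero, ← sub_eq_add_neg, ← Finset.sum_sub_distrib]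
  refine Finset.sum_congr rfl fun K _ => integral_sub_of_ae ?_ ?_ (ae_of_all _ fun x => ?_)
  · exact integrable_finsetSum _ fun j _ => (integrableOn_mul_of_continuous (isBounded_elem hΩ)
      (integrableOn_of_memLp_two (elem_measure_ne_top hΩ) (memLp_brokenGrad hΩ hub i j K))
      (continuous_fderiv_dir hψ _)).const_mul _
  · exact hip.mono_set (S.mesh.elem_subset K)
  · simp [stress, sub_mul, mul_assoc]

/-- The momentum balance holds almost everywhere in each element. -/
theorem ae_add_div_stress_eq_zero (hd : 2 ≤ d) (hΩo : IsOpen Ω) (hΩ : Bornology.IsBounded Ω)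
    (hf : ∀ i, MemLp (fun y => f y i) 2 (volume.restrict Ω))
    (hp : MemSobolev Ω 1 p) (hsol : S.IsWeakSolution f (u, p)) (i : Fin d)
    {γ : Fin d → Fin S.mesh.numElem → Fin d → E d → ℝ}
    (hγ : ∀ j K, HasWeakGrad (S.mesh.elem K) (stress S u p i j K) (γ j K)) (K) :
    ∀ᵐ x ∂volume.restrict (S.mesh.elem K), f x i + ∑ j, γ j K j x = 0 := by
  have hKv : volume (S.mesh.elem K) ≠ ⊤ := elem_measure_ne_top hΩ
  have hKo := S.mesh.isOpen_elem K
  have hfK : IntegrableOn (fun x => f x i) (S.mesh.elem K) :=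
    (integrableOn_of_memLp_two hΩ.measure_lt_top.ne (hf i)).mono_set (S.mesh.elem_subset K)
  have hγi : ∀ j, IntegrableOn (γ j K j) (S.mesh.elem K) := fun j =>
    integrableOn_of_memLp_two hKv ((hγ j K).memLp_grad j)
  have hsum : IntegrableOn (fun x => f x i + ∑ j, γ j K j x) (S.mesh.elem K) :=
    hfK.add (integrable_finsetSum _ fun j _ => hγi j)
  refine (ae_restrict_iff' hKo.measurableSet).2
    (hKo.ae_eq_zero_of_integral_contDiff_smul_eq_zero hsum.locallyIntegrableOn
      fun ψ hψ hψc hψs => ?_)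
  have hψ0 : ∀ x, x ∉ S.mesh.elem K → ψ x = 0 := fun x hx =>
    image_eq_zero_of_notMem_tsupport fun h => hx (hψs h)
  have h := sum_stress_mul_fderiv hd hΩo hΩ hp hsol i hψ (hψs.trans (S.mesh.elem_subset K))
  rw [Finset.sum_eq_single K (fun K' _ hK' => by
      refine setIntegral_eq_zero_of_forall_eq_zero fun x hx => ?_
      rw [fderiv_eq_zero_of_notMem_tsupport fun h' =>
        Set.disjoint_left.1 (S.mesh.disjoint_elem hK') hx (hψs h')]
      simp) (by simp),
    setIntegral_mul_eq_of_tsupport hΩo (S.mesh.elem_subset K)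
      (Set.inter_subset_right.trans hψs),
    integral_finsetSum _ fun j _ => (integrableOn_ibp hΩ (hγ j K) hψ).2,
    Finset.sum_congr rfl fun j _ => ((hγ j K).hasWeakDeriv j).2.2 ψ hψ hψc hψs] at h
  have i1 : IntegrableOn (fun x => f x i * ψ x) (S.mesh.elem K) :=
    integrableOn_mul_of_continuous (isBounded_elem hΩ) hfK hψ.continuous
  have i2 : ∀ j, IntegrableOn (fun x => γ j K j x * ψ x) (S.mesh.elem K) := fun j =>
    (integrableOn_ibp hΩ (hγ j K) hψ).1
  calc ∫ x, ψ x • (f x i + ∑ j, γ j K j x)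
      = ∫ x in S.mesh.elem K, (f x i * ψ x + ∑ j, γ j K j x * ψ x) := by
        rw [← setIntegral_eq_integral_of_forall_compl_eq_zero (s := S.mesh.elem K)
          fun x hx => by rw [hψ0 x hx, zero_smul]]
        refine integral_congr_ae (ae_of_all _ fun x => ?_)
        simp only [smul_eq_mul]
        rw [mul_add, Finset.mul_sum, mul_comm (ψ x)]
        simp only [mul_comm (ψ x)]
    _ = 0 := by
        rw [integral_add i1 (integrable_finsetSum _ fun j _ => i2 j),
          integral_finsetSum _ fun j _ => i2 j, ← h, Finset.sum_neg_distrib, neg_add_cancel]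

/-- Testing the momentum balance of the weak solution with a broken field. -/
theorem sum_stress_mul_brokenGrad (hd : 2 ≤ d) (hΩo : IsOpen Ω) (hΩ : Bornology.IsBounded Ω)
    (hreg : S.mesh.PolytopicRegular c) (hf : ∀ i, MemLp (fun y => f y i) 2 (volume.restrict Ω))
    (hu : ∀ i, MemSobolev Ω 2 fun y => u y i) (hp : MemSobolev Ω 1 p)
    (hsol : S.IsWeakSolution f (u, p)) (hv : ∀ i, PiecewiseSmooth S.mesh fun y => v y i)
    (hv2 : ∀ i, MemLp (fun y => v y i) 2 (volume.restrict Ω)) (i : Fin d) :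
    ∑ K, ∫ x in S.mesh.elem K, ∑ j, stress S u p i j K x * S.brokenGrad v i j K x =
      (∫ x in Ω, f x i * v x i) + ∑ F, ∫ x, ∑ j, S.mesh.avg F (stress S u p i j) x *
        S.jumpTensor F v i j x ∂S.mesh.faceMeasure F := by
  have hub : ∀ i, BrokenH2 S.mesh fun y => u y i := fun i => brokenH2_of_memSobolev hΩo hΩ (hu i)
  have hpb : BrokenH1 S.mesh p := brokenH1_of_memSobolev hΩo hΩ hp
  choose γ hγ using exists_hasWeakGrad_stress hΩ hub hpb i
  have hdiv := ae_add_div_stress_eq_zero hd hΩo hΩ hf hp hsol i hγ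
  -- On each element the divergence of the stress may be replaced by `-f`.
  have key : ∀ {w : E d → ℝ} {dw : Fin d → Fin S.mesh.numElem → E d → ℝ},
      MemLp w 2 (volume.restrict Ω) →
      (∀ j K, MemLp (dw j K) 2 (volume.restrict (S.mesh.elem K))) →
      ∑ K, ∫ x in S.mesh.elem K, ∑ j, (γ j K j x * w x + stress S u p i j K x * dw j K x) =
      (∑ K, ∫ x in S.mesh.elem K, ∑ j, stress S u p i j K x * dw j K x) -
        ∫ x in Ω, f x i * w x := by
    intro w dw hw hdw
    have hfw : IntegrableOn (fun x => f x i * w x) Ω := (hf i).integrable_mul hw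
    rw [← sum_setIntegral_elem hd hfw, ← Finset.sum_sub_distrib]
    refine Finset.sum_congr rfl fun K _ => integral_sub_of_ae
      (integrable_finsetSum _ fun j _ => (hγ j K).memLp.integrable_mul (hdw j K))
      (hfw.mono_set (S.mesh.elem_subset K)) ?_
    filter_upwards [hdiv K] with x hx
    rw [Finset.sum_add_distrib, ← Finset.sum_mul, eq_neg_of_add_eq_zero_right hx]
    ring
  have hjump : ∀ F K, S.mesh.minus F = some K → ∀ᵐ x ∂S.mesh.faceMeasure F,
      ∑ j, S.mesh.normal F j * (trace (S.mesh.elem (S.mesh.plus F))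
        (stress S u p i j (S.mesh.plus F)) x -
          trace (S.mesh.elem K) (stress S u p i j K) x) = 0 := by
    intro F K hm
    refine ae_normal_jump_eq_zero hd hΩo hΩ hreg hm hγ fun ψ hψ _ hψs => ?_
    rw [key (memLp_of_continuous hΩ hψ.continuous) fun j K =>
        memLp_of_continuous (isBounded_elem hΩ) (continuous_fderiv_dir hψ _),
      sum_stress_mul_fderiv hd hΩo hΩ hp hsol i hψ hψs, sub_self]
  have h := sum_setIntegral_elem_eq_sum_jump hd hΩ hreg hγ hjump (hv i)
  rw [key (dw := fun j K => weakDeriv (S.mesh.elem K) j fun y => v y i) (hv2 i)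
    fun j K => memLp_brokenGrad hΩ (fun i => ((hv i).brokenH2 hΩ).brokenH1) i j K] at h
  exact eq_add_of_sub_eq' h

theorem ae_avg_stress (hd : 2 ≤ d) (hΩ : Bornology.IsBounded Ω)
    (hreg : S.mesh.PolytopicRegular c) (hu : ∀ i, BrokenH2 S.mesh fun y => u y i)
    (hp : BrokenH1 S.mesh p) (F) :
    ∀ᵐ x ∂S.mesh.faceMeasure F, ∀ i j, S.mesh.avg F (stress S u p i j) x =
      S.avgFlux F u i j x - (if i = j then 1 else 0) * S.mesh.avg F (fun _ => p) x := by
  refine ae_all_iff.2 fun i => ae_all_iff.2 fun j => ?_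
  filter_upwards [ae_avg_sub (F := F) hd hΩ hreg (exists_hasWeakGrad_flux hΩ hu i j)
    (fun K => ⟨_, (hp.hasWeakGrad hΩ K).const_mul (elem_measure_ne_top hΩ)
      (if i = j then 1 else 0)⟩)] with x hx
  have e : S.mesh.avg F (stress S u p i j) x = _ := hx
  rw [e, Scheme.avgFlux]
  congr 1
  split_ifs with hij
  · simp
  · rcases hm : S.mesh.minus F with _ | K
    · simp [avg_of_none hm, trace_zero]
    · simp [avg_of_some hm, trace_zero]

/-- The velocity of the weak solution is divergence free, in the sense of the discrete form. -/
theorem bh_eq_zero (hd : 2 ≤ d) (hΩo : IsOpen Ω) (hΩ : Bornology.IsBounded Ω)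
    (hreg : S.mesh.PolytopicRegular c) (hsol : S.IsWeakSolution f (u, p))
    (hr : r ∈ pressureSpace Ω) : S.bh r u = 0 := by
  have hu1 : ∀ i, MemSobolev Ω 1 fun y => u y i := fun i => (hsol.1 i).1
  have hz : (0 : E d → Fin d → ℝ) ∈ velocitySpace Ω := by
    intro i
    exact ⟨(hasWeakGrad_of_contDiff hΩ (contDiff_const (c := (0 : ℝ)))).memSobolev,
      ae_of_all _ fun x => by simp [HasTrace]⟩
  have hw0 : ∀ j : Fin d, ∀ᵐ x ∂volume.restrict Ω, weakDeriv Ω j (fun _ => (0 : ℝ)) x = 0 := by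
    intro j
    filter_upwards [(hasWeakGrad_of_contDiff hΩ
      (contDiff_const (c := (0 : ℝ)))).weakDeriv_ae_eq hΩo j] with x hx
    simpa using hx
  have h : S.a u 0 + S.b p 0 - S.b r u = ∫ y in Ω, ∑ k, f y k * (0 : E d → Fin d → ℝ) y k :=
    hsol.2.2 _ hz _ hr
  have ha : S.a u 0 = 0 := by
    refine Finset.sum_eq_zero fun K _ => integral_eq_zero_of_ae ?_
    filter_upwards [ae_mono (Measure.restrict_mono (S.mesh.elem_subset K) le_rfl)
      (ae_all_iff.2 hw0)] with x hx
    simp [hx]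
  have hb : S.b p 0 = 0 := by
    refine neg_eq_zero.2 (integral_eq_zero_of_ae ?_)
    filter_upwards [ae_all_iff.2 hw0] with x hx
    simp [hx]
  have hbr : S.b r u = 0 := by
    rw [ha, hb] at h
    simpa using h
  have hint : IntegrableOn (fun x => r x * ∑ i, weakDeriv Ω i (fun y => u y i) x) Ω := by
    have hdiv : MemLp (fun x => ∑ i, weakDeriv Ω i (fun y => u y i) x) 2 (volume.restrict Ω) := by
      refine memLp_finsetSum _ fun i _ => ?_
      obtain ⟨g, hg, -⟩ := (hu1 i).exists_hasWeakGrad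
      exact (hg.weakDeriv hΩo hΩ.measure_lt_top.ne).memLp_grad i
    exact hr.1.integrable_mul hdiv
  have hvol : ∑ K, ∫ x in S.mesh.elem K, r x * ∑ i, S.brokenGrad u i i K x = 0 := by
    rw [Scheme.b, neg_eq_zero, ← sum_setIntegral_elem (T := S.mesh) hd hint] at hbr
    rw [← hbr]
    refine Finset.sum_congr rfl fun K _ => integral_congr_ae ?_
    filter_upwards [ae_all_iff.2 fun i => ae_weakDeriv_eq_brokenGrad hΩo hΩ hu1 i i K] with x hx
    simp only [hx]
  rw [Scheme.bh, hvol, neg_zero, zero_add]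
  refine Finset.sum_eq_zero fun F _ => integral_eq_zero_of_ae ?_
  filter_upwards [ae_all_iff.2 fun i =>
    ae_jump_eq_zero_of_mem_velocitySpace hd hΩo hΩ hreg hsol.1 F i] with x hx
  simp [Scheme.jumpTensor, hx]

/-- Consistency: the weak solution satisfies the discrete equations. -/
theorem Bh_eq_of_isWeakSolution (hd : 2 ≤ d) (hΩo : IsOpen Ω) (hΩ : Bornology.IsBounded Ω)
    (hreg : S.mesh.PolytopicRegular c) (hf : ∀ i, MemLp (fun y => f y i) 2 (volume.restrict Ω))
    (hu : ∀ i, MemSobolev Ω 2 fun y => u y i) (hp : MemSobolev Ω 1 p)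
    (hsol : S.IsWeakSolution f (u, p)) {y : Pair d} (hy : y ∈ S.discreteSpace) :
    S.Bh (u, p) y = ∫ x in Ω, ∑ i, f x i * y.1 x i := by
  have hub : ∀ i, BrokenH2 S.mesh fun y => u y i := fun i => brokenH2_of_memSobolev hΩo hΩ (hu i)
  have hpb : BrokenH1 S.mesh p := brokenH1_of_memSobolev hΩo hΩ hp
  have hys := smoothPair_of_mem_discreteSpace hy
  have hv := hys.1
  have hv1 := fun i => ((hv i).brokenH2 hΩ).brokenH1
  have hu0 := ae_jump_eq_zero_of_mem_velocitySpace (S := S) hd hΩo hΩ hreg hsol.1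
  have z1 : ∑ F, ∫ x, (∑ i, ∑ j, S.jumpTensor F u i j x * S.avgFlux F y.1 i j x)
      ∂S.mesh.faceMeasure F = 0 := by
    refine Finset.sum_eq_zero fun F _ => integral_eq_zero_of_ae ?_
    filter_upwards [ae_all_iff.2 fun i => hu0 F i] with x hx
    simp [Scheme.jumpTensor, hx]
  have z2 : ∑ F, ∫ x, S.sigmaV F * (∑ i, ∑ j, S.jumpTensor F u i j x * S.jumpTensor F y.1 i j x)
      ∂S.mesh.faceMeasure F = 0 := by
    refine Finset.sum_eq_zero fun F _ => integral_eq_zero_of_ae ?_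
    filter_upwards [ae_all_iff.2 fun i => hu0 F i] with x hx
    simp [Scheme.jumpTensor, hx]
  have z3 : S.sh p y.2 = 0 := by
    refine Finset.sum_eq_zero fun F hF => integral_eq_zero_of_ae ?_
    filter_upwards [ae_jump_eq_zero_of_memSobolev hd hΩo hΩ hreg hp
      (Finset.mem_filter.1 hF).2] with x hx
    simp [hx]
  have hmain := Finset.sum_congr rfl fun i (_ : i ∈ Finset.univ) =>
    sum_stress_mul_brokenGrad hd hΩo hΩ hreg hf hu hp hsol hv (fun i => (hy.1 i).1) i
  rw [Finset.sum_comm, Finset.sum_add_distrib, Finset.sum_comm (s := Finset.univ (α := Fin d))]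
    at hmain
  have hst : ∀ i j K, MemLp (stress S u p i j K) 2 (volume.restrict (S.mesh.elem K)) :=
    fun i j K =>
      let ⟨_, hg⟩ := exists_hasWeakGrad_stress hΩ hub hpb i j K
      hg.memLp
  have evol : ∀ K, ∑ i, ∫ x in S.mesh.elem K, ∑ j, stress S u p i j K x *
      S.brokenGrad y.1 i j K x =
      (∫ x in S.mesh.elem K, S.mu K * ∑ i, ∑ j,
        S.brokenGrad u i j K x * S.brokenGrad y.1 i j K x) -
      ∫ x in S.mesh.elem K, p x * ∑ i, S.brokenGrad y.1 i i K x := by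
    intro K
    have hi : ∀ i, IntegrableOn (fun x => ∑ j, stress S u p i j K x *
        S.brokenGrad y.1 i j K x) (S.mesh.elem K) := fun i => integrable_finsetSum _ fun j _ =>
      (hst i j K).integrable_mul (memLp_brokenGrad hΩ hv1 i j K)
    rw [← integral_finsetSum _ fun i _ => hi i]
    refine integral_sub_of_ae
      (integrable_grad_mul_grad hΩ (fun i => (hub i).brokenH1) hv K)
      (integrable_mul_div hΩ hpb hv1 K) (ae_of_all _ fun x => ?_)
    simp [stress, sub_mul, Finset.mul_sum, mul_assoc]
  have eface : ∀ F, ∑ i, ∫ x, ∑ j, S.mesh.avg F (stress S u p i j) x *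
      S.jumpTensor F y.1 i j x ∂S.mesh.faceMeasure F =
      (∫ x, ∑ i, ∑ j, S.avgFlux F u i j x * S.jumpTensor F y.1 i j x ∂S.mesh.faceMeasure F) -
      ∫ x, S.mesh.avg F (fun _ => p) x * ∑ i, S.jumpTensor F y.1 i i x
        ∂S.mesh.faceMeasure F := by
    intro F
    rw [← integral_finsetSum _ fun i _ => integrable_finsetSum _ fun j _ =>
      AEContinuousOnFace.integrable_mul
        (integrable_avg hd hΩ hreg (exists_hasWeakGrad_stress hΩ hub hpb i j))
        (aeContinuousOnFace_jumpTensor hv i j)]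
    refine integral_sub_of_ae (integrable_avgFlux_mul_jumpTensor hd hΩ hreg hub hv F)
      (integrable_avg_mul_jumpTensor hd hΩ hreg hpb hv F) ?_
    filter_upwards [ae_avg_stress hd hΩ hreg hub hpb F] with x hx
    simp [hx, sub_mul, Finset.mul_sum]
  have erhs : ∫ x in Ω, ∑ i, f x i * y.1 x i = ∑ i, ∫ x in Ω, f x i * y.1 x i :=
    integral_finsetSum _ fun i _ => (hf i).integrable_mul (hy.1 i).1
  rw [Finset.sum_congr rfl fun K _ => evol K, Finset.sum_congr rfl fun F _ => eface F,
    Finset.sum_sub_distrib, Finset.sum_sub_distrib, ← erhs] at hmain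
  rw [Scheme.Bh, bh_eq_zero hd hΩo hΩ hreg hsol hy.2.1, z3, Scheme.ah, Scheme.bh, z1, z2]
  linarith

end Galerkin

/-! ### Stability and the error estimate -/

section ErrorEstimate

variable {d : ℕ} {Ω : Set (E d)} {S : Scheme Ω} {C : ℝ}

theorem sub_mem_discreteSpace (hΩ : Bornology.IsBounded Ω) {x y : Pair d}
    (hx : x ∈ S.discreteSpace) (hy : y ∈ S.discreteSpace) : x - y ∈ S.discreteSpace := by
  have hpoly : ∀ {k : ℕ} {w w' : E d → ℝ}, S.mesh.IsPiecewisePoly k w →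
      S.mesh.IsPiecewisePoly k w' → S.mesh.IsPiecewisePoly k fun z => w z - w' z := by
    intro k w w' h h' K
    obtain ⟨P, hP, hw⟩ := h K
    obtain ⟨P', hP', hw'⟩ := h' K
    refine ⟨P - P', (MvPolynomial.totalDegree_sub P P').trans (max_le hP hP'), fun z hz => ?_⟩
    simp only [hw z hz, hw' z hz, map_sub]
  refine ⟨fun i => ⟨(hx.1 i).1.sub (hy.1 i).1, hpoly (hx.1 i).2 (hy.1 i).2⟩,
    ⟨hx.2.1.1.sub hy.2.1.1, ?_⟩, hpoly hx.2.2 hy.2.2⟩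
  have hi : ∀ {q : E d → ℝ}, q ∈ pressureSpace Ω → IntegrableOn q Ω := fun hq =>
    integrableOn_of_memLp_two hΩ.measure_lt_top.ne hq.1
  have e : ∫ z in Ω, (x.2 z - y.2 z) = 0 := by
    rw [integral_sub (hi hx.2.1) (hi hy.2.1), hx.2.1.2, hy.2.1.2, sub_zero]
  exact e

theorem energyNorm_nonneg (x : Pair d) : 0 ≤ S.energyNorm x := Real.sqrt_nonneg _

/-- In the inf-sup condition the supremum is bounded by any constant that bounds the form. -/
theorem energyNorm_le_of_isStable (hstab : S.IsStable C) {x : Pair d} (hx : x ∈ S.discreteSpace)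
    {M : ℝ} (hM : 0 ≤ M) (h : ∀ y ∈ S.discreteSpace, S.Bh x y ≤ M * S.energyNorm y) :
    C * S.energyNorm x ≤ M := by
  refine EReal.coe_le_coe_iff.1 ((hstab x hx).trans (iSup₂_le fun y hy => ?_))
  exact EReal.coe_le_coe_iff.2 (div_le_of_le_mul₀ (energyNorm_nonneg y) hM (h y hy))

end ErrorEstimate

end StokesDG

theorem mainTheorem3 {d : ℕ} (hd : d = 2 ∨ d = 3)
    (Ω : Set (StokesDG.E d)) (hΩo : IsOpen Ω) (hΩb : Bornology.IsBounded Ω)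
    (S : StokesDG.Scheme Ω) (c : ℝ) (hreg : S.mesh.PolytopicRegular c)
    (f : StokesDG.E d → Fin d → ℝ)
    (hf : ∀ i, MemLp (fun y => f y i) 2 (volume.restrict Ω))
    (u : StokesDG.E d → Fin d → ℝ) (p : StokesDG.E d → ℝ)
    (hu : ∀ i, StokesDG.MemSobolev Ω 2 (fun y => u y i))
    (hp : StokesDG.MemSobolev Ω 1 p)
    (hsol : S.IsWeakSolution f (u, p))
    (uh : StokesDG.E d → Fin d → ℝ) (ph : StokesDG.E d → ℝ)
    (hsolh : S.IsDiscreteSolution f (uh, ph))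
    (W : Submodule ℝ (StokesDG.Pair d)) (hW : S.discreteSpace ⊆ W) (hupW : (u, p) ∈ W)
    (Cstab Cbdd : ℝ) (hCstab : 0 < Cstab) (hCbdd : 0 ≤ Cbdd)
    (hstab : S.IsStable Cstab) (hbdd : S.IsBoundedOn W Cbdd) :
    S.energyNorm (u - uh, p - ph) ≤
      (1 + Cbdd / Cstab) *
        ⨅ y : S.discreteSpace, S.energyNorm (u - y.1.1, p - y.1.2) := by
  open StokesDG in
  have hd2 : 2 ≤ d := by omega
  have hpos : 0 < 1 + Cbdd / Cstab := by positivity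
  have hne : Nonempty S.discreteSpace := ⟨⟨(uh, ph), hsolh.1⟩⟩
  rw [← div_le_iff₀' hpos]
  refine le_ciInf fun ⟨z, hz⟩ => ?_
  rw [div_le_iff₀' hpos]
  change S.energyNorm ((u, p) - (uh, ph)) ≤ (1 + Cbdd / Cstab) * S.energyNorm ((u, p) - z)
  have hup : BrokenPair S (u, p) :=
    ⟨fun i => brokenH2_of_memSobolev hΩo hΩb (hu i), brokenH1_of_memSobolev hΩo hΩb hp⟩
  have hbp : ∀ {x}, x ∈ S.discreteSpace → BrokenPair S x := fun hx =>
    (smoothPair_of_mem_discreteSpace hx).brokenPair hΩb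
  have hdiff := sub_mem_discreteSpace hΩb hsolh.1 hz
  -- Galerkin orthogonality: the weak and the discrete solution have the same residual.
  have hort : ∀ y ∈ S.discreteSpace, S.Bh ((uh, ph) - z) y = S.Bh ((u, p) - z) y := by
    intro y hy
    have hys := smoothPair_of_mem_discreteSpace hy
    rw [Bh_sub hd2 hΩb hreg (hbp hsolh.1) (hbp hz) hys, Bh_sub hd2 hΩb hreg hup (hbp hz) hys,
      hsolh.2 y hy, Bh_eq_of_isWeakSolution hd2 hΩo hΩb hreg hf hu hp hsol hy]
  have hquasi : Cstab * S.energyNorm ((uh, ph) - z) ≤ Cbdd * S.energyNorm ((u, p) - z) := by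
    refine energyNorm_le_of_isStable hstab hdiff
      (mul_nonneg hCbdd (energyNorm_nonneg _)) fun y hy => ?_
    rw [hort y hy]
    exact (le_abs_self _).trans (hbdd _ (W.sub_mem hupW (hW hz)) y hy)
  have hE := (energyPair_of_memSobolev hd2 hΩo hΩb hreg hsol.1 hp).sub hd2 hΩb hreg
    (energyPair_of_mem_discreteSpace hΩb hz)
  have htri := energyNorm_sub_le hd2 hΩb hreg hE (energyPair_of_mem_discreteSpace hΩb hdiff)
  rw [sub_sub_sub_cancel_right] at htri
  calc S.energyNorm ((u, p) - (uh, ph))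
      ≤ S.energyNorm ((u, p) - z) + S.energyNorm ((uh, ph) - z) := htri
    _ ≤ S.energyNorm ((u, p) - z) + Cbdd * S.energyNorm ((u, p) - z) / Cstab := by
        gcongr
        rwa [le_div_iff₀' hCstab]
    _ = (1 + Cbdd / Cstab) * S.energyNorm ((u, p) - z) := by ring
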